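/- **Setting.** Fix integers $K\ge 1$ and $d_1,\dots,d_K\ge 1$, put $d=d_1+\cdots+d_K$, and fix $0\le t\le d$. For $k=1,\dots,K$ let $X^{(k)}_1,\dots,X^{(k)}_{n_k}$ be i.i.d. from a distribution $F_k$ on $\mathbb R$, the $K$ samples being independent. Let $g:\mathbb R^d\to\mathbb R$ be a measurable kernel, with $d_k$ arguments for sample $k$, symmetric in the arguments that belong to the same sample, with $E\,g^2<\infty$ when all $d$ arguments are independent and those of sample $k$ have law $F_k$; put $\Theta=E\,g$. Let $$U_0=\prod_{k=1}^K\binom{n_k}{d_k}^{-1}\sum_{\eta}g(\mathcal X_\eta)$$ be the complete U-statistic; the sum is over $\eta=(\eta_1,\dots,\eta_K)$ with $\eta_k=(\eta_{k,1}<\cdots<\eta_{k,d_k})$ in $\{1,\dots,n_k\}$, and $\mathcal X_\eta=(X^{(k)}_{\eta_{k,j}})_{k,j}$. For a set $u$ of argument positions $(k,j)$ let $g_u(x)=\int g\,dF_{u^c}$ be the kernel with the arguments outside $u$ integrated out, let $h_\emptyset=0$ and recursively $h_u=g_u-\sum_{v\subsetneq u}h_v$, and set $\delta_u^2=\mathrm{Var}(h_u)$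 and $R(t)=\sum_{|u|>t}\delta_u^2$. **Debiased ICUDO.** Let $L$ divide every $n_k$. Let $A_0$ be an orthogonal array $OA(m,d,L,t)$ with $m\ge1$, that is, an $m\times d$ array with entries in $\{1,\dots,L\}$ such that in any $t$ columns each of the $L^t$ tuples of levels appears in exactly $\lambda=m/L^t$ rows. Let $A_0$ have no coincidence defect: no two rows agree on any $t+1$ columns. 1. Apply independent uniformly random permutations of the levels to the columns of $A_0$, independently of the data; call the rows of the result $a^1,\dots,a^m$. 2. For each $k$ partition $\{1,\dots,n_k\}$ into groups $G^{(k)}_1,\dots,G^{(k)}_L$ of equal size $n_k/L$ such that $X^{(k)}_i\le X^{(k)}_{i'}$ whenever $i\in G^{(k)}_l$, $i'\in G^{(k)}_{l'}$, $l<l'$. For $a=(a_{k,j})$ put $\mathcal G_a=\prod_{k=1}^K\prod_{j=1}^{d_k}G^{(k)}_{a_{k,j}}$. 3. Let $S_0^*$ be the set of tuples $\eta=(\eta_1,\dots,\eta_K)$, $\eta_k\in\{1,\dots,n_k\}^{d_k}$, such that no $\eta_k$ has a repeated unit. Given all of the above, draw $\eta^1,\dots,\eta^m$ independently, $\eta^i$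 uniformly from $\mathcal G_{a^i}\cap S_0^*$ (these sets are assumed non-empty). The debiased ICUDO is $$\tilde U_{oa}=\frac1m\sum_{i=1}^m\omega_{\eta^i}\,g(\mathcal X_{\eta^i}),\qquad \omega_{\eta^i}=\frac{L^d\,|\mathcal G_{a^i}\cap S_0^*|}{|S_0^*|}.$$ **Theorem.** (a) $\tilde U_{oa}$ has a finite second moment and is exactly unbiased: $E\,\tilde U_{oa}=\Theta$. (b) With $K,d_k,F_k,g,t$ fixed, let $L\to\infty$ with $L=o(n_k)$ for every $k$, and, if $t<d$, with $\lambda=o(L)$ (for instance $\lambda$ bounded). Then $$\mathrm{MSE}(\tilde U_{oa})=\mathrm{MSE}(U_0)+\frac{R(t)}m+o\Big(\frac1m\Big),$$ where the MSEs are $E(\tilde U_{oa}-\Theta)^2$ and $E(U_0-\Theta)^2$. -/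

import Mathlib

open MeasureTheory ProbabilityTheory Filter Asymptotics
open scoped ENNReal Topology

universe u

noncomputable section

namespace ICUDO

/-- Pairs `(k, j)` with `k` one of the `K` samples and `j` one of `d k` positions in sample `k`.
With `d` the numbers of kernel arguments, this indexes the arguments of the kernel (and the columns
of the orthogonal array); with the sample sizes `n` in place of `d`, it indexes the data. -/
abbrev Pos {K : ℕ} (d : Fin K → ℕ) : Type := (k : Fin K) × Fin (d k)

/-- The law of a family of independent variables, those with first index `k` having law `F k`. -/
def productLaw {K : ℕ} (F : Fin K → Measure ℝ) (d : Fin K → ℕ) : Measure (Pos d → ℝ) :=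
  Measure.pi fun p => F p.1

/-- The kernel is symmetric in the arguments that belong to the same sample. -/
def SymmetricKernel {K : ℕ} {d : Fin K → ℕ} (g : (Pos d → ℝ) → ℝ) : Prop :=
  ∀ (σ : (k : Fin K) → Equiv.Perm (Fin (d k))) (x : Pos d → ℝ),
    g (fun p => x ⟨p.1, σ p.1 p.2⟩) = g x

/-- The parameter `Θ = ∫ g dF₁ ⋯ dF_K`. -/
def theta {K : ℕ} {d : Fin K → ℕ} (F : Fin K → Measure ℝ) (g : (Pos d → ℝ) → ℝ) : ℝ :=
  ∫ x, g x ∂(productLaw F d)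

/-- `g_u(x) = ∫ g(x) dF_{uᶜ}`: the arguments outside `u` are integrated out. -/
def gProj {K : ℕ} {d : Fin K → ℕ} (F : Fin K → Measure ℝ) (g : (Pos d → ℝ) → ℝ)
    (u : Finset (Pos d)) (x : Pos d → ℝ) : ℝ :=
  ∫ y, g (fun p => if p ∈ u then x p else y p) ∂(productLaw F d)

/-- The projections `h_u = g_u - ∑_{v ⊊ u} h_v`, with the convention `h_∅ = 0`. -/
def hProj {K : ℕ} {d : Fin K → ℕ} (F : Fin K → Measure ℝ) (g : (Pos d → ℝ) → ℝ)
    (u : Finset (Pos d)) (x : Pos d → ℝ) : ℝ :=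
  if u = ∅ then 0 else gProj F g u x - ∑ v ∈ u.ssubsets.attach, hProj F g v.1 x
termination_by u.card
decreasing_by exact Finset.card_lt_card (Finset.mem_ssubsets.mp v.2)

/-- `δ_u² = Var(h_u)`. -/
def deltaSq {K : ℕ} {d : Fin K → ℕ} (F : Fin K → Measure ℝ) (g : (Pos d → ℝ) → ℝ)
    (u : Finset (Pos d)) : ℝ :=
  variance (hProj F g u) (productLaw F d)

/-- `R(t) = ∑_{|u| > t} δ_u²`. -/
def R {K : ℕ} {d : Fin K → ℕ} (F : Fin K → Measure ℝ) (g : (Pos d → ℝ) → ℝ) (t : ℕ) : ℝ :=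
  ∑ u : Finset (Pos d) with t < u.card, deltaSq F g u

/-- Tuples of units `η = (η_1, …, η_K)` with `η_k ∈ {1, …, n_k}^{d_k}`. -/
abbrev Tuple {K : ℕ} (d n : Fin K → ℕ) : Type := (k : Fin K) → Fin (d k) → Fin (n k)

/-- The subsample `X_η` selected by the tuple `η`. -/
def select {K : ℕ} {d n : Fin K → ℕ} (x : Pos n → ℝ) (η : Tuple d n) : Pos d → ℝ :=
  fun p => x ⟨p.1, η p.1 p.2⟩

open scoped Classical in
/-- The product of the sets of strictly increasing tuples of units. -/
def increasingTuples {K : ℕ} (d n : Fin K → ℕ) : Finset (Tuple d n) :=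
  Finset.univ.filter fun η => ∀ k, StrictMono (η k)

/-- The complete (generalized) U-statistic `U₀`. -/
def U0 {K : ℕ} {d n : Fin K → ℕ} (g : (Pos d → ℝ) → ℝ) (x : Pos n → ℝ) : ℝ :=
  (∏ k, ((n k).choose (d k) : ℝ)⁻¹) * ∑ η ∈ increasingTuples d n, g (select x η)

open scoped Classical in
/-- `S₀*`: the tuples without repeated units within a sample. -/
def S0star {K : ℕ} (d n : Fin K → ℕ) : Finset (Tuple d n) :=
  Finset.univ.filter fun η => ∀ k, Function.Injective (η k)

/-- `A` is an orthogonal array with columns `J`, levels `1, …, L`, strength `t` and index `lam`: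
in any `t` columns every `t`-tuple of levels appears in exactly `lam` rows. -/
def IsOrthogonalArray {J : Type} [Fintype J] {m L : ℕ} (A : Fin m → J → Fin L)
    (t lam : ℕ) : Prop :=
  t ≤ Fintype.card J ∧
    ∀ T : Finset J, T.card = t → ∀ v : T → Fin L,
      Fintype.card {i : Fin m // ∀ j : T, A i j = v j} = lam

/-- No coincidence defect: no two rows agree on any `t + 1` columns. -/
def CoincidenceFree {J : Type} {m L : ℕ} (A : Fin m → J → Fin L) (t : ℕ) : Prop :=
  ∀ T : Finset J, T.card = t + 1 → ∀ i i' : Fin m, (∀ j ∈ T, A i j = A i' j) → i = i'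

/-- `c k i` is the label `l` of the group `G_l^{(k)}` that contains unit `i` of sample `k`.
The groups of each sample have equal size `n_k / L` and are ordered as the data are. -/
def IsOrderedPartition {K L : ℕ} {n : Fin K → ℕ} (x : Pos n → ℝ)
    (c : (k : Fin K) → Fin (n k) → Fin L) : Prop :=
  (∀ k l, Fintype.card {i : Fin (n k) // c k i = l} * L = n k) ∧
    ∀ k i i', c k i < c k i' → x ⟨k, i⟩ ≤ x ⟨k, i'⟩

/-- The array obtained by applying the level permutation `π p` to each column `p`. -/
def permuteLevels {J : Type} {m L : ℕ} (A : Fin m → J → Fin L) (π : J → Equiv.Perm (Fin L)) :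
    Fin m → J → Fin L :=
  fun i p => π p (A i p)

open scoped Classical in
/-- `𝒢_a ∩ S₀*`, where `𝒢_a = ∏_{k,j} G^{(k)}_{a_{k,j}}`. -/
def gridStar {K L : ℕ} {d n : Fin K → ℕ} (c : (k : Fin K) → Fin (n k) → Fin L)
    (a : Pos d → Fin L) : Finset (Tuple d n) :=
  (S0star d n).filter fun η => ∀ k j, c k (η k j) = a ⟨k, j⟩

open scoped Classical in
/-- The probability of the outcome `e` of a uniform draw from the finite set `S`. -/
def uniformProb {α : Type} (S : Finset α) (e : α) : ℝ≥0∞ :=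
  if e ∈ S then (S.card : ℝ≥0∞)⁻¹ else 0

/-- The mean squared error of the estimator `T` of the number `θ`. -/
def mse {Ω : Type u} [MeasurableSpace Ω] (P : Measure Ω) (T : Ω → ℝ) (θ : ℝ) : ℝ :=
  ∫ ω, (T ω - θ) ^ 2 ∂P

end ICUDO

open ICUDO in
/-- One run of the debiased ICUDO sampling algorithm, for kernels with `d k` arguments from sample
`k`, where sample `k` is drawn from `F k`, based on an orthogonal array of strength `t`. -/
structure DebiasedICUDO {K : ℕ} (d : Fin K → ℕ) (F : Fin K → Measure ℝ) (t : ℕ) where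
  /-- the sample sizes -/
  n : Fin K → ℕ
  /-- the number of groups (levels) -/
  L : ℕ
  /-- the number of sampled tuples (rows) -/
  m : ℕ
  m_pos : 0 < m
  /-- the index of the orthogonal array -/
  lam : ℕ
  /-- the initial orthogonal array -/
  A₀ : Fin m → Pos d → Fin L
  orthogonal : IsOrthogonalArray A₀ t lam
  coincidenceFree : CoincidenceFree A₀ t
  /-- the probability space -/
  Ω : Type u
  [mΩ : MeasurableSpace Ω]
  P : Measure Ω
  [isProb : IsProbabilityMeasure P]
  /-- the data -/
  X : Ω → Pos n → ℝ
  X_measurable : Measurable X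
  X_law : P.map X = productLaw F n
  /-- the random level permutations, one for each column -/
  π : Ω → Pos d → Equiv.Perm (Fin L)
  π_measurable : ∀ p, MeasurableSet {ω | π ω = p}
  /-- the group labels (ties in the data may be broken in any way, also at random) -/
  c : Ω → (k : Fin K) → Fin (n k) → Fin L
  c_measurable : ∀ c₀, MeasurableSet {ω | c ω = c₀}
  c_ordered : ∀ ω, IsOrderedPartition (X ω) (c ω)
  /-- the sampled tuples -/
  η : Ω → Fin m → Tuple d n
  η_measurable : ∀ e, MeasurableSet {ω | η ω = e}
  /-- The level permutations are independent and uniform, and independent of data and groups. -/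
  π_law : ∀ (B : Set (Pos n → ℝ)) (c₀ : (k : Fin K) → Fin (n k) → Fin L)
    (p : Pos d → Equiv.Perm (Fin L)), MeasurableSet B →
    P {ω | X ω ∈ B ∧ c ω = c₀ ∧ π ω = p} =
      P {ω | X ω ∈ B ∧ c ω = c₀} * (Fintype.card (Pos d → Equiv.Perm (Fin L)) : ℝ≥0∞)⁻¹
  /-- Given data, groups and permutations, the tuples `η¹, …, ηᵐ` are independent, and `ηⁱ` is
  uniform on `𝒢_{aⁱ} ∩ S₀*`, where `aⁱ` is row `i` of the permuted array. -/
  η_law : ∀ (B : Set (Pos n → ℝ)) (c₀ : (k : Fin K) → Fin (n k) → Fin L)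
    (p : Pos d → Equiv.Perm (Fin L)) (e : Fin m → Tuple d n), MeasurableSet B →
    P {ω | X ω ∈ B ∧ c ω = c₀ ∧ π ω = p ∧ η ω = e} =
      P {ω | X ω ∈ B ∧ c ω = c₀ ∧ π ω = p} *
        ∏ i, uniformProb (gridStar c₀ (permuteLevels A₀ p i)) (e i)

namespace DebiasedICUDO

open ICUDO

attribute [instance] DebiasedICUDO.mΩ DebiasedICUDO.isProb

variable {K : ℕ} {d : Fin K → ℕ} {F : Fin K → Measure ℝ} {t : ℕ}

/-- The weight `L^d |𝒢_{aⁱ} ∩ S₀*| / |S₀*|` of the `i`-th sampled tuple, `d = d_1 + ⋯ + d_K`. -/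
def weight (D : DebiasedICUDO.{u} d F t) (ω : D.Ω) (i : Fin D.m) : ℝ :=
  (D.L : ℝ) ^ (∑ k, d k) *
    ((gridStar (D.c ω) (permuteLevels D.A₀ (D.π ω) i)).card : ℝ) / ((S0star d D.n).card : ℝ)

/-- The debiased ICUDO statistic. -/
def Utilde (D : DebiasedICUDO.{u} d F t) (g : (Pos d → ℝ) → ℝ) (ω : D.Ω) : ℝ :=
  (1 / (D.m : ℝ)) * ∑ i, D.weight ω i * g (select (D.X ω) (D.η ω i))

end DebiasedICUDO

end

/-! Condition on the data and the groups. The remaining randomness, level permutations and draws, is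
finite, so conditional moments are exact algebraic identities. A permuted row is uniform over the
L^d cells and the weight of a draw cancels the size of its cell; hence the conditional mean is the
average of g over tuples without repeated units, which is U₀ (`conditional_mean`).

For the second moment, write ε for L times the indicator that two levels agree. In each column the
permuted levels of two rows have joint law L⁻²(1 + (ε - 1)(ε' - 1)/(L - 1)), with ε for the original
and ε' for the permuted levels (`average_perm_pair`). Multiplying over columns and expanding gives a
sum over sets u of positions, in which an array coefficient `tau A u` multiplies a data quantity,
the Möbius transform of `blockForm` (`conditional_second_moment`). The term u = ∅ reproduces the
second moment of U₀. Strength t kills the terms with 1 ≤ |u| ≤ t. For |u| > t, each row paired with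
itself makes `tau` equal to 1, and distinct rows, which have at most t coincidences, contribute
O(λ/L) (`abs_tau_sub_one_le`). So m times the excess MSE is a within-cell variance plus a sum over
|u| > t (`mse_sub_mse`).

It remains to find the limits of the expected block forms (`tendsto_meanBlock`). The form at v
averages g(X_η) g(X_η') over pairs of tuples with equal groups at the positions v. Groups are
ordered, so units of one group have nearly equal values, and the limit is the moment of g at two
arguments that share the coordinates v (`crossMoment`). For a continuous kernel of compact support
this is quantitative: after a bounded monotone clamping of the data, only boundedly many of the L
groups of a sample spread by more than δ (`card_isWide_le`), and repeated units cost O(1/L). General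
g follows by density in L², thanks to a bound of Schur type that is uniform in the design
(`abs_blockForm_le`).

The Möbius transform of the cross moments is δ_u² (`deltaSq_eq`), which produces R(t). For v the
full set the limit is E g², which also bounds the second moment of a draw asymptotically, so the
within-cell variance vanishes (`tendsto_meanDraw_sub_meanBlock`). -/

namespace ICUDO

/-! ### Alternating sums over the subsets of a finite set -/

/-- The Möbius transform `∑_{v ⊆ u} (-1)^{|u \ v|} f(v)`. -/
def moebiusSum {ι : Type*} (f : Finset ι → ℝ) (u : Finset ι) : ℝ :=
  ∑ v ∈ u.powerset, (-1) ^ (u.card + v.card) * f v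

theorem moebiusSum_insert {ι : Type*} [DecidableEq ι] (f : Finset ι → ℝ) {u : Finset ι} {p : ι}
    (hp : p ∉ u) :
    moebiusSum f (insert p u) = moebiusSum (fun w => f (insert p w) - f w) u := by
  unfold moebiusSum
  rw [Finset.sum_powerset_insert hp, ← Finset.sum_add_distrib]
  refine Finset.sum_congr rfl fun v hv => ?_
  have hpv : p ∉ v := fun h => hp (Finset.mem_powerset.mp hv h)
  rw [Finset.card_insert_of_notMem hp, Finset.card_insert_of_notMem hpv]
  ring

theorem moebiusSum_sub {ι : Type*} (f f' : Finset ι → ℝ) (u : Finset ι) :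
    moebiusSum (fun v => f v - f' v) u = moebiusSum f u - moebiusSum f' u := by
  simp [moebiusSum, mul_sub]

/-- Möbius inversion on the subset lattice; it solves the recursion that defines `hProj`. -/
theorem sum_powerset_moebiusSum {ι : Type*} [DecidableEq ι] (f : Finset ι → ℝ) (u : Finset ι) :
    ∑ v ∈ u.powerset, moebiusSum f v = f u := by
  induction u using Finset.induction_on generalizing f with
  | empty => simp [moebiusSum]
  | insert p u hp ih =>
    rw [Finset.sum_powerset_insert hp, ← Finset.sum_add_distrib, ← ih fun w => f (insert p w)]
    refine Finset.sum_congr rfl fun v hv => ?_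
    rw [moebiusSum_insert f fun h => hp (Finset.mem_powerset.mp hv h), moebiusSum_sub]
    ring

/-- When a position p is added to u, the four choices of p in or out of v and w carry the signs +,
-, -, +, and only the choice of p in both changes the intersection; what remains is the difference
f(insert p ·) - f. The lemma evaluates the variance of an alternating sum of projections, whose
product moments depend on v ∩ w only. -/
theorem sum_sum_moebius_inter {ι : Type*} [DecidableEq ι] (f : Finset ι → ℝ) (u : Finset ι) :
    ∑ v ∈ u.powerset, ∑ w ∈ u.powerset,
      ((-1) ^ (u.card + v.card) * (-1) ^ (u.card + w.card)) * f (v ∩ w) = moebiusSum f u := by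
  induction u using Finset.induction_on generalizing f with
  | empty => simp [moebiusSum]
  | insert p u hp ih =>
    rw [moebiusSum_insert f hp, ← ih, Finset.sum_powerset_insert hp, ← Finset.sum_add_distrib]
    refine Finset.sum_congr rfl fun v hv => ?_
    have hpv : p ∉ v := fun h => hp (Finset.mem_powerset.mp hv h)
    rw [Finset.sum_powerset_insert hp, Finset.sum_powerset_insert hp, ← Finset.sum_add_distrib,
      ← Finset.sum_add_distrib, ← Finset.sum_add_distrib]
    refine Finset.sum_congr rfl fun w hw => ?_
    have hpw : p ∉ w := fun h => hp (Finset.mem_powerset.mp hw h)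
    rw [Finset.card_insert_of_notMem hp, Finset.card_insert_of_notMem hpv,
      Finset.card_insert_of_notMem hpw, Finset.insert_inter_of_notMem hpw,
      Finset.inter_insert_of_notMem hpv, ← Finset.insert_inter_distrib]
    ring

theorem sum_powerset_neg_one {ι : Type*} [DecidableEq ι] {u : Finset ι} (hu : u ≠ ∅) :
    ∑ v ∈ u.powerset, (-1 : ℝ) ^ v.card = 0 := by
  have h := Finset.sum_powerset_neg_one_pow_card (x := u)
  rw [if_neg hu] at h
  exact_mod_cast h

/-! ### Families of independent variables -/

theorem measurePreserving_pi_comp {ι ι' : Type*} [Fintype ι] [Fintype ι'] (μ : ι → Measure ℝ)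
    [∀ i, IsProbabilityMeasure (μ i)] {f : ι' → ι} (hf : Function.Injective f) :
    MeasurePreserving (fun (x : ι → ℝ) j => x (f j)) (Measure.pi μ)
      (Measure.pi fun j => μ (f j)) := by
  refine ⟨by fun_prop, ?_⟩
  have h : iIndepFun (fun i (x : ι → ℝ) => x i) (Measure.pi μ) :=
    iIndepFun_pi (X := fun _ => id) fun i => aemeasurable_id
  have h' := (iIndepFun_iff_map_fun_eq_pi_map fun j =>
    (measurable_pi_apply (f j)).aemeasurable).mp (h.precomp hf)
  rw [h']
  congr 1
  funext j
  exact (measurePreserving_eval μ (f j)).map_eq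

instance {K : ℕ} (F : Fin K → Measure ℝ) [∀ k, IsProbabilityMeasure (F k)] (d : Fin K → ℕ) :
    IsProbabilityMeasure (productLaw F d) := by
  unfold productLaw; infer_instance

variable {K : ℕ} {d n : Fin K → ℕ}

/-- The units selected by a tuple. -/
def units (η : Tuple d n) (p : Pos d) : Pos n := ⟨p.1, η p.1 p.2⟩

theorem units_injective {η : Tuple d n} :
    Function.Injective (units η) ↔ ∀ k, Function.Injective (η k) := by
  constructor
  · intro h k j j' hj
    have : (⟨k, j⟩ : Pos d) = ⟨k, j'⟩ := h (by simp [units, hj])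
    simpa using this
  · rintro h ⟨k, j⟩ ⟨k', j'⟩ hj
    simp only [units, Sigma.mk.injEq] at hj
    obtain ⟨rfl, hj⟩ := hj
    rw [h k (eq_of_heq hj)]

/-- The argument with the coordinates in `v` from `x` and the others from `y`. -/
def mix {ι : Type*} [DecidableEq ι] {β : ι → Type*} (v : Finset ι) (x y : (p : ι) → β p) (p : ι) :
    β p :=
  if p ∈ v then x p else y p

theorem gProj_eq (F : Fin K → Measure ℝ) (g : (Pos d → ℝ) → ℝ) (v : Finset (Pos d))
    (x : Pos d → ℝ) : gProj F g v x = ∫ y, g (mix v x y) ∂(productLaw F d) := by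
  unfold gProj mix
  refine integral_congr_ae (Eventually.of_forall fun y => ?_)
  simp only

theorem gProj_empty (F : Fin K → Measure ℝ) (g : (Pos d → ℝ) → ℝ) (x : Pos d → ℝ) :
    gProj F g ∅ x = theta F g := by
  simp [gProj, theta]

/-- With h_∅ = 0 instead of θ, the Möbius inverse lacks its v = ∅ term; the added constant removes
that term and is invisible to the variance. -/
theorem hProj_eq (F : Fin K → Measure ℝ) (g : (Pos d → ℝ) → ℝ) (u : Finset (Pos d)) (x : Pos d → ℝ) :
    hProj F g u x = moebiusSum (fun v => gProj F g v x) u + -(-1) ^ u.card * theta F g := by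
  induction u using Finset.strongInduction with
  | H u ih =>
    rw [hProj]
    split_ifs with hu
    · subst hu
      simp [moebiusSum, gProj_empty]
    · rw [Finset.sum_attach u.ssubsets fun v => hProj F g v x,
        Finset.sum_congr rfl fun v hv => ih v (Finset.mem_ssubsets.mp hv)]
      have h1 := sum_powerset_moebiusSum (fun v => gProj F g v x) u
      have h2 := sum_powerset_neg_one hu
      have hmem : u ∉ u.ssubsets := by simp
      have hins : u.powerset = insert u u.ssubsets := by
        ext w
        simp [Finset.mem_ssubsets, Finset.ssubset_iff_subset_ne]
        constructor
        · intro h; by_cases hw : w = u <;> simp [hw, h]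
        · rintro (rfl | h)
          · exact subset_rfl
          · exact h.1
      rw [hins, Finset.sum_insert hmem] at h1 h2
      rw [Finset.sum_add_distrib, ← Finset.sum_mul, Finset.sum_neg_distrib]
      linear_combination -h1 + theta F g * h2

variable (F : Fin K → Measure ℝ) [∀ k, IsProbabilityMeasure (F k)]

theorem measurePreserving_select {η : Tuple d n} (hη : ∀ k, Function.Injective (η k)) :
    MeasurePreserving (fun x : Pos n → ℝ => select x η) (productLaw F n) (productLaw F d) :=
  measurePreserving_pi_comp (fun p : Pos n => F p.1) (units_injective.mpr hη)

theorem measurable_mix {ι : Type*} [DecidableEq ι] (v : Finset ι) :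
    Measurable fun z : (ι → ℝ) × (ι → ℝ) => mix v z.1 z.2 := by
  refine measurable_pi_lambda _ fun p => ?_
  unfold mix
  split_ifs <;> fun_prop

/-- Injectivity of `Sum.elim f₁ f₂` means that both selections are injective and have disjoint
ranges, so the two subvectors are independent. -/
theorem measurePreserving_pi_comp_sum {ι ι₁ ι₂ : Type*} [Fintype ι] [Fintype ι₁] [Fintype ι₂]
    (μ : ι → Measure ℝ) [∀ i, IsProbabilityMeasure (μ i)] {f₁ : ι₁ → ι} {f₂ : ι₂ → ι}
    (hf : Function.Injective (Sum.elim f₁ f₂)) :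
    MeasurePreserving (fun x : ι → ℝ => ((fun j => x (f₁ j)), fun j => x (f₂ j))) (Measure.pi μ)
      ((Measure.pi fun j => μ (f₁ j)).prod (Measure.pi fun j => μ (f₂ j))) :=
  (measurePreserving_sumPiEquivProdPi fun j => μ (Sum.elim f₁ f₂ j)).comp
    (measurePreserving_pi_comp μ hf)

theorem measurePreserving_select_pair {η η' : Tuple d n}
    (h : Function.Injective (Sum.elim (units η) (units η'))) :
    MeasurePreserving (fun x : Pos n → ℝ => (select x η, select x η')) (productLaw F n)
      ((productLaw F d).prod (productLaw F d)) :=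
  measurePreserving_pi_comp_sum (fun p : Pos n => F p.1) h

/-- Rearranging three independent copies: for `v ∩ w` shared coordinates. -/
theorem measurePreserving_three (v w : Finset (Pos d)) :
    MeasurePreserving (fun z : (Pos d → ℝ) × (Pos d → ℝ) × (Pos d → ℝ) =>
        (mix v z.1 z.2.1, mix (w \ v) z.1 z.2.2))
      ((productLaw F d).prod ((productLaw F d).prod (productLaw F d)))
      ((productLaw F d).prod (productLaw F d)) := by
  have e₂ := (measurePreserving_sumPiEquivProdPi_symm
    (fun j : Pos d ⊕ Pos d => F (Sum.elim Sigma.fst Sigma.fst j)))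
  have e₃ := (measurePreserving_sumPiEquivProdPi_symm
    (fun j : Pos d ⊕ (Pos d ⊕ Pos d) =>
      F (Sum.elim Sigma.fst (Sum.elim Sigma.fst Sigma.fst) j)))
  have e := e₃.comp ((MeasurePreserving.id (productLaw F d)).prod e₂)
  -- The first vector reads copy one on `v` and copy two elsewhere; the second reads copy one on `w
  -- \ v` and copy three elsewhere. No variable is read twice.
  let f₁ : Pos d → Pos d ⊕ (Pos d ⊕ Pos d) :=
    fun p => if p ∈ v then Sum.inl p else Sum.inr (Sum.inl p)
  let f₂ : Pos d → Pos d ⊕ (Pos d ⊕ Pos d) :=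
    fun p => if p ∈ w \ v then Sum.inl p else Sum.inr (Sum.inr p)
  have hf : Function.Injective (Sum.elim f₁ f₂) := by
    rintro (p | p) (q | q) h
    all_goals
      simp only [Sum.elim_inl, Sum.elim_inr, f₁, f₂] at h
      split_ifs at h <;> simp_all
  have key := (measurePreserving_pi_comp_sum
    (fun j : Pos d ⊕ (Pos d ⊕ Pos d) =>
      F (Sum.elim Sigma.fst (Sum.elim Sigma.fst Sigma.fst) j)) hf).comp e
  have h₁ : (fun j => F (Sum.elim Sigma.fst (Sum.elim Sigma.fst Sigma.fst) (f₁ j))) =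
      fun p : Pos d => F p.1 := by
    funext p; simp only [f₁]; split_ifs <;> rfl
  have h₂ : (fun j => F (Sum.elim Sigma.fst (Sum.elim Sigma.fst Sigma.fst) (f₂ j))) =
      fun p : Pos d => F p.1 := by
    funext p; simp only [f₂]; split_ifs <;> rfl
  rw [h₁, h₂] at key
  refine Eq.mp ?_ key
  congr 1
  funext z
  refine Prod.ext ?_ ?_
  · funext p
    simp only [mix, Function.comp, f₁]
    split_ifs <;> rfl
  · funext p
    simp only [mix, Function.comp, f₂]
    split_ifs <;> rfl

/-! ### Cross moments -/

/-- `E a(X) b(Y)` for arguments `X`, `Y` that share the coordinates in `v` and are otherwise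
independent. -/
noncomputable def crossMoment (v : Finset (Pos d)) (a b : (Pos d → ℝ) → ℝ) : ℝ :=
  ∫ z, a z.1 * b (mix v z.1 z.2) ∂((productLaw F d).prod (productLaw F d))

theorem measurePreserving_mix (v : Finset (Pos d)) :
    MeasurePreserving (fun z : (Pos d → ℝ) × (Pos d → ℝ) => mix v z.1 z.2)
      ((productLaw F d).prod (productLaw F d)) (productLaw F d) := by
  have h := (measurePreserving_fst (μ := productLaw F d) (ν := productLaw F d)).comp
    (measurePreserving_three F v ∅)
  refine ⟨measurable_mix v, ?_⟩
  have hp : MeasurePreserving (fun z : (Pos d → ℝ) × (Pos d → ℝ) × (Pos d → ℝ) => (z.1, z.2.1))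
      ((productLaw F d).prod ((productLaw F d).prod (productLaw F d)))
      ((productLaw F d).prod (productLaw F d)) :=
    (MeasurePreserving.id _).prod measurePreserving_fst
  rw [← hp.map_eq, Measure.map_map (measurable_mix v) hp.measurable]
  exact h.map_eq

variable {F} in
theorem memLp_fst_prod {a : (Pos d → ℝ) → ℝ} (ha : MemLp a 2 (productLaw F d)) :
    MemLp (fun z : (Pos d → ℝ) × (Pos d → ℝ) => a z.1) 2
      ((productLaw F d).prod (productLaw F d)) :=
  ha.comp_measurePreserving measurePreserving_fst

variable {F} in
theorem memLp_mix {a : (Pos d → ℝ) → ℝ} (ha : MemLp a 2 (productLaw F d)) (v : Finset (Pos d)) :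
    MemLp (fun z : (Pos d → ℝ) × (Pos d → ℝ) => a (mix v z.1 z.2)) 2
      ((productLaw F d).prod (productLaw F d)) :=
  ha.comp_measurePreserving (measurePreserving_mix F v)

theorem integral_comp_of_measurePreserving {α β : Type*} [MeasurableSpace α] [MeasurableSpace β]
    {μ : Measure α} {ν : Measure β} {f : α → β} (hf : MeasurePreserving f μ ν) {h : β → ℝ}
    (hh : AEStronglyMeasurable h ν) : ∫ x, h (f x) ∂μ = ∫ y, h y ∂ν := by
  rw [← hf.map_eq] at hh ⊢
  exact (integral_map hf.measurable.aemeasurable hh).symm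

variable {F} {g : (Pos d → ℝ) → ℝ}

/-- Integrating out with separate fresh copies y and y' turns g_v(x) g_w(x) into the mean of g at
two arguments that share the coordinates in v ∩ w and are otherwise independent. -/
theorem integral_gProj_mul_gProj (hg : MemLp g 2 (productLaw F d)) (v w : Finset (Pos d)) :
    Integrable (fun x => gProj F g v x * gProj F g w x) (productLaw F d) ∧
    ∫ x, gProj F g v x * gProj F g w x ∂(productLaw F d) = crossMoment F (v ∩ w) g g := by
  have h3 := measurePreserving_three F v w
  -- On `v ∩ w` the first vector supplies x, on `w \ v` the second supplies x, and off `w` the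
  -- second supplies the fresh copy.
  have hmix : ∀ z : (Pos d → ℝ) × (Pos d → ℝ) × (Pos d → ℝ),
      mix (v ∩ w) (mix v z.1 z.2.1) (mix (w \ v) z.1 z.2.2) = mix w z.1 z.2.2 := by
    intro z
    funext p
    simp only [mix, Finset.mem_inter, Finset.mem_sdiff]
    split_ifs <;> simp_all
  have hint : Integrable (fun z : (Pos d → ℝ) × (Pos d → ℝ) => g z.1 * g (mix (v ∩ w) z.1 z.2))
      ((productLaw F d).prod (productLaw F d)) :=
    (memLp_fst_prod hg).integrable_mul (memLp_mix hg _)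
  have hint3 := h3.integrable_comp_of_integrable hint
  have hcomp : ((fun z : (Pos d → ℝ) × (Pos d → ℝ) => g z.1 * g (mix (v ∩ w) z.1 z.2)) ∘
      fun z : (Pos d → ℝ) × (Pos d → ℝ) × (Pos d → ℝ) =>
        (mix v z.1 z.2.1, mix (w \ v) z.1 z.2.2)) =
      fun z => g (mix v z.1 z.2.1) * g (mix w z.1 z.2.2) := by
    funext z
    simp only [Function.comp, hmix]
  rw [hcomp] at hint3
  have hx : ∀ x, ∫ z : (Pos d → ℝ) × (Pos d → ℝ), g (mix v x z.1) * g (mix w x z.2)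
      ∂((productLaw F d).prod (productLaw F d)) = gProj F g v x * gProj F g w x := by
    intro x
    rw [gProj_eq, gProj_eq, ← integral_prod_mul]
  constructor
  · have := hint3.integral_prod_left
    simpa only [hx] using this
  · have h4 := integral_comp_of_measurePreserving h3 hint.aestronglyMeasurable
    rw [crossMoment, ← h4]
    simp only [hmix]
    rw [integral_prod _ hint3]
    simp only [hx]

theorem integral_gProj (hg : MemLp g 2 (productLaw F d)) (v : Finset (Pos d)) :
    Integrable (gProj F g v) (productLaw F d) ∧
    ∫ x, gProj F g v x ∂(productLaw F d) = theta F g := by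
  have hint : Integrable (fun z : (Pos d → ℝ) × (Pos d → ℝ) => g (mix v z.1 z.2))
      ((productLaw F d).prod (productLaw F d)) := (memLp_mix hg v).integrable one_le_two
  have hx : gProj F g v = fun x => ∫ y, g (mix v x y) ∂(productLaw F d) :=
    funext fun x => gProj_eq F g v x
  constructor
  · rw [hx]; exact hint.integral_prod_left
  · have := integral_comp_of_measurePreserving (measurePreserving_mix F v)
      hg.aestronglyMeasurable
    rw [theta, ← this, integral_prod _ hint, hx]

theorem memLp_gProj (hg : MemLp g 2 (productLaw F d)) (v : Finset (Pos d)) :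
    MemLp (gProj F g v) 2 (productLaw F d) := by
  rw [memLp_two_iff_integrable_sq (integral_gProj hg v).1.aestronglyMeasurable]
  simpa only [sq] using (integral_gProj_mul_gProj hg v v).1

/-! ### The variances of the projections -/

/-- The constant in `hProj_eq` drops out, the alternating sum of the projections has mean zero
because u is non-empty, and its expanded square is the double sum of `sum_sum_moebius_inter`. -/
theorem deltaSq_eq (hg : MemLp g 2 (productLaw F d)) {u : Finset (Pos d)} (hu : u ≠ ∅) :
    deltaSq F g u = moebiusSum (fun v => crossMoment F v g g) u := by
  have hL : MemLp (fun x => moebiusSum (fun v => gProj F g v x) u) 2 (productLaw F d) := by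
    unfold moebiusSum
    exact memLp_finsetSum _ fun v _ => (memLp_gProj hg v).const_mul _
  have hE : ∫ x, moebiusSum (fun v => gProj F g v x) u ∂(productLaw F d) = 0 := by
    unfold moebiusSum
    rw [integral_finsetSum _ fun v _ => ((integral_gProj hg v).1.const_mul _)]
    simp_rw [integral_const_mul, (integral_gProj hg _).2, pow_add, mul_assoc]
    rw [← Finset.mul_sum, ← Finset.sum_mul, sum_powerset_neg_one hu]
    simp
  have hfun : hProj F g u = fun x => moebiusSum (fun v => gProj F g v x) u +
      -(-1) ^ u.card * theta F g := funext fun x => hProj_eq F g u x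
  rw [deltaSq, hfun, variance_add_const hL.aestronglyMeasurable, variance_eq_sub hL, hE,
    ← sum_sum_moebius_inter]
  simp only [Pi.pow_apply]
  have hsq : ∀ x, moebiusSum (fun v => gProj F g v x) u ^ 2 =
      ∑ v ∈ u.powerset, ∑ w ∈ u.powerset,
      ((-1) ^ (u.card + v.card) * (-1) ^ (u.card + w.card)) *
        (gProj F g v x * gProj F g w x) := by
    intro x
    rw [sq, moebiusSum, Finset.sum_mul_sum]
    refine Finset.sum_congr rfl fun v _ => Finset.sum_congr rfl fun w _ => ?_
    ring
  simp_rw [hsq]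
  rw [integral_finsetSum _ fun v _ => integrable_finsetSum _ fun w _ =>
    (integral_gProj_mul_gProj hg v w).1.const_mul _]
  simp_rw [integral_finsetSum _ fun w _ => (integral_gProj_mul_gProj hg _ w).1.const_mul _,
    integral_const_mul, (integral_gProj_mul_gProj hg _ _).2]
  simp

/-! ### Random permutations of the levels -/

/-- `L` times the indicator of `a = b`. -/
def eps {L : ℕ} (a b : Fin L) : ℝ := if a = b then (L : ℝ) else 0

theorem sum_eps {L : ℕ} (a : Fin L) : ∑ b, eps a b = L := by simp [eps]

theorem eps_comm {L : ℕ} (a b : Fin L) : eps a b = eps b a := by simp [eps, eq_comm]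

theorem eps_nonneg {L : ℕ} (a b : Fin L) : 0 ≤ eps a b := by
  unfold eps; split_ifs <;> positivity

/-- Right multiplication by a transposition shows that the sum does not depend on the point `a`;
averaging over all points then sums f over all levels. -/
theorem sum_perm_apply {L : ℕ} (a : Fin L) (f : Fin L → ℝ) :
    (L : ℝ) * ∑ σ : Equiv.Perm (Fin L), f (σ a) =
      Fintype.card (Equiv.Perm (Fin L)) * ∑ b, f b := by
  have h : ∀ c : Fin L, ∑ σ : Equiv.Perm (Fin L), f (σ c) = ∑ σ : Equiv.Perm (Fin L), f (σ a) := by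
    intro c
    refine Fintype.sum_equiv (Equiv.mulRight (Equiv.swap c a)) _ _ fun σ => ?_
    simp
  calc (L : ℝ) * ∑ σ : Equiv.Perm (Fin L), f (σ a)
      = ∑ c : Fin L, ∑ σ : Equiv.Perm (Fin L), f (σ c) := by simp [h]
    _ = ∑ σ : Equiv.Perm (Fin L), ∑ c : Fin L, f (σ c) := Finset.sum_comm
    _ = _ := by
      simp_rw [Equiv.sum_comp]
      simp

theorem exists_perm_pair {α : Type*} [DecidableEq α] {a a' c c' : α} (h : a ≠ a') (h' : c ≠ c') :
    ∃ τ : Equiv.Perm α, τ a = c ∧ τ a' = c' := by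
  refine ⟨Equiv.swap (Equiv.swap a c a') c' * Equiv.swap a c, ?_, ?_⟩
  · have h1 : c ≠ Equiv.swap a c a' := by
      intro hc
      have := congrArg (Equiv.swap a c) hc
      simp at this
      exact h this
    simp [Equiv.swap_apply_of_ne_of_ne h1 h']
  · simp

/-- The same averaging over ordered pairs of distinct points, by 2-transitivity of the symmetric
group. -/
theorem sum_perm_apply_pair {L : ℕ} {a a' : Fin L} (h : a ≠ a') (f : Fin L → Fin L → ℝ) :
    ((L : ℝ) * (L - 1)) * ∑ σ : Equiv.Perm (Fin L), f (σ a) (σ a') =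
      Fintype.card (Equiv.Perm (Fin L)) *
        ∑ b, ∑ b', if b = b' then 0 else f b b' := by
  have key : ∀ c c' : Fin L, (if c = c' then 0 else ∑ σ : Equiv.Perm (Fin L), f (σ c) (σ c')) =
      if c = c' then 0 else ∑ σ : Equiv.Perm (Fin L), f (σ a) (σ a') := by
    intro c c'
    split_ifs with hc
    · rfl
    obtain ⟨τ, h1, h2⟩ := exists_perm_pair h hc
    refine Fintype.sum_equiv (Equiv.mulRight τ) _ _ fun σ => ?_
    simp [h1, h2]
  have hcount : ∀ x : ℝ, (∑ c : Fin L, ∑ c' : Fin L, if c = c' then 0 else x) =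
      ((L : ℝ) * (L - 1)) * x := by
    intro x
    have : ∀ c c' : Fin L, (if c = c' then 0 else x) = x - if c = c' then x else 0 := by
      intro c c'; split_ifs <;> simp
    simp only [this, Finset.sum_sub_distrib, Finset.sum_const, Finset.sum_ite_eq,
      Finset.mem_univ, if_true, Finset.card_univ, Fintype.card_fin, nsmul_eq_mul]
    ring
  rw [← hcount]
  calc _ = ∑ c : Fin L, ∑ c' : Fin L,
        if c = c' then 0 else ∑ σ : Equiv.Perm (Fin L), f (σ c) (σ c') :=
        Finset.sum_congr rfl fun c _ => Finset.sum_congr rfl fun c' _ => (key c c').symm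
    _ = ∑ c : Fin L, ∑ c' : Fin L,
        ∑ σ : Equiv.Perm (Fin L), if σ c = σ c' then 0 else f (σ c) (σ c') := by
        refine Finset.sum_congr rfl fun c _ => Finset.sum_congr rfl fun c' _ => ?_
        simp only [EmbeddingLike.apply_eq_iff_eq]
        split_ifs <;> simp
    _ = ∑ σ : Equiv.Perm (Fin L), ∑ c : Fin L, ∑ c' : Fin L,
        if σ c = σ c' then 0 else f (σ c) (σ c') := by
        simp_rw [Finset.sum_comm (s := (Finset.univ : Finset (Fin L)))
          (t := (Finset.univ : Finset (Equiv.Perm (Fin L))))]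
    _ = _ := by
        have : ∀ σ : Equiv.Perm (Fin L), (∑ c : Fin L, ∑ c' : Fin L,
            if σ c = σ c' then 0 else f (σ c) (σ c')) =
            ∑ b, ∑ b', if b = b' then 0 else f b b' := by
          intro σ
          rw [← Equiv.sum_comp σ fun b => ∑ b', if b = b' then 0 else f b b']
          refine Finset.sum_congr rfl fun c _ => ?_
          rw [← Equiv.sum_comp σ fun b' => if σ c = b' then 0 else f (σ c) b']
        rw [Finset.sum_congr rfl fun σ _ => this σ, Finset.sum_const, Finset.card_univ,
          nsmul_eq_mul]

/-- Since `eps - 1` is L - 1 on equal levels and -1 otherwise, the bracket gives all cases at once: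
probability 1/L if both pairs are equal, 1/(L(L - 1)) if neither is, and 0 otherwise. The shape "one
plus a product" is what lets the product over columns be expanded over sets of columns. -/
theorem average_perm_pair {L : ℕ} (hL : 2 ≤ L) (a a' : Fin L) (f : Fin L → Fin L → ℝ) :
    (Fintype.card (Equiv.Perm (Fin L)) : ℝ)⁻¹ * ∑ σ : Equiv.Perm (Fin L), f (σ a) (σ a') =
      ∑ b, ∑ b', f b b' *
        (((L : ℝ) ^ 2)⁻¹ * (1 + (eps a a' - 1) * (eps b b' - 1) / ((L : ℝ) - 1))) := by
  have hL2 : (2 : ℝ) ≤ L := by exact_mod_cast hL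
  have hL0 : (L : ℝ) ≠ 0 := by positivity
  have hL1 : (L : ℝ) - 1 ≠ 0 := by linarith
  have hN : (Fintype.card (Equiv.Perm (Fin L)) : ℝ) ≠ 0 := by
    exact_mod_cast Fintype.card_ne_zero
  by_cases h : a = a'
  · subst h
    have h1 := sum_perm_apply a fun b => f b b
    rw [inv_mul_eq_iff_eq_mul₀ hN, ← mul_right_inj' hL0, h1]
    have : ∀ b b', f b b' * (((L : ℝ) ^ 2)⁻¹ * (1 + (eps a a - 1) * (eps b b' - 1) /
        ((L : ℝ) - 1))) = if b = b' then f b b' * (L : ℝ)⁻¹ else 0 := by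
      intro b b'
      simp only [eps, if_true]
      split_ifs <;> field_simp <;> ring
    simp only [this, Finset.sum_ite_eq, Finset.mem_univ, if_true, ← Finset.sum_mul]
    field_simp
  · have h1 := sum_perm_apply_pair h f
    have hLL : ((L : ℝ) * (L - 1)) ≠ 0 := mul_ne_zero hL0 hL1
    rw [inv_mul_eq_iff_eq_mul₀ hN, ← mul_right_inj' hLL, h1]
    have : ∀ b b', f b b' * (((L : ℝ) ^ 2)⁻¹ * (1 + (eps a a' - 1) * (eps b b' - 1) /
        ((L : ℝ) - 1))) = (if b = b' then 0 else f b b') * ((L : ℝ) * (L - 1))⁻¹ := by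
      intro b b'
      simp only [eps, if_neg h]
      split_ifs <;> field_simp <;> ring
    simp only [this, ← Finset.sum_mul]
    field_simp

variable {J : Type*} [Fintype J] [DecidableEq J]

theorem average_columns {L : ℕ} (a : J → Fin L) (f : (J → Fin L) → ℝ) (hL : IsEmpty J ∨ L ≠ 0) :
    (Fintype.card (J → Equiv.Perm (Fin L)) : ℝ)⁻¹ *
        ∑ π : J → Equiv.Perm (Fin L), f (fun p => π p (a p)) =
      ((L : ℝ) ^ Fintype.card J)⁻¹ * ∑ b, f b := by
  -- Written with indicators of single columns, the sum over the permutations factors over the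
  -- columns.
  have hf : ∀ π : J → Equiv.Perm (Fin L), f (fun p => π p (a p)) =
      ∑ b, f b * ∏ p, if π p (a p) = b p then (1 : ℝ) else 0 := by
    intro π
    rw [Finset.sum_eq_single fun p => π p (a p)]
    · simp
    · intro b _ hb
      obtain ⟨p, hp⟩ := Function.ne_iff.mp hb
      rw [Finset.prod_eq_zero (Finset.mem_univ p) (if_neg (Ne.symm hp)), mul_zero]
    · simp
  have hN : (Fintype.card (Equiv.Perm (Fin L)) : ℝ) ≠ 0 := by
    exact_mod_cast Fintype.card_ne_zero
  have hs : ∀ (p : J) (b : Fin L), (∑ σ : Equiv.Perm (Fin L), if σ (a p) = b then (1 : ℝ) else 0) =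
      Fintype.card (Equiv.Perm (Fin L)) * (L : ℝ)⁻¹ := by
    intro p b
    have hL0 : (L : ℝ) ≠ 0 := by
      rcases hL with h | h
      · exact h.elim p
      · exact_mod_cast h
    have := sum_perm_apply (a p) fun c => if c = b then (1 : ℝ) else 0
    simp only [Finset.sum_ite_eq', Finset.mem_univ, if_true, mul_one] at this
    field_simp
    linarith
  simp_rw [hf]
  rw [Finset.sum_comm]
  simp_rw [← Finset.mul_sum]
  have hp : ∀ b : J → Fin L, (∑ π : J → Equiv.Perm (Fin L), ∏ p,
      if π p (a p) = b p then (1 : ℝ) else 0) =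
      (Fintype.card (Equiv.Perm (Fin L)) * (L : ℝ)⁻¹) ^ Fintype.card J := by
    intro b
    have := Finset.prod_univ_sum (fun _ : J => (Finset.univ : Finset (Equiv.Perm (Fin L))))
      fun p σ => if σ (a p) = b p then (1 : ℝ) else 0
    simp only [hs, Fintype.piFinset_univ, Finset.prod_const, Finset.card_univ] at this
    exact this.symm
  simp_rw [hp, ← Finset.sum_mul]
  simp only [Fintype.card_fun, Nat.cast_pow, mul_pow, inv_pow]
  field_simp

theorem average_columns_pair {L : ℕ} (hL : 2 ≤ L) (a a' : J → Fin L)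
    (f : (J → Fin L) → (J → Fin L) → ℝ) :
    (Fintype.card (J → Equiv.Perm (Fin L)) : ℝ)⁻¹ *
        ∑ π : J → Equiv.Perm (Fin L), f (fun p => π p (a p)) (fun p => π p (a' p)) =
      ((L : ℝ) ^ (2 * Fintype.card J))⁻¹ * ∑ b, ∑ b', f b b' *
        ∏ p, (1 + (eps (a p) (a' p) - 1) * (eps (b p) (b' p) - 1) / ((L : ℝ) - 1)) := by
  have hf : ∀ π : J → Equiv.Perm (Fin L), f (fun p => π p (a p)) (fun p => π p (a' p)) =
      ∑ b, ∑ b', f b b' * ∏ p, if π p (a p) = b p ∧ π p (a' p) = b' p then (1 : ℝ) else 0 := by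
    intro π
    rw [Finset.sum_eq_single fun p => π p (a p), Finset.sum_eq_single fun p => π p (a' p)]
    · simp
    · intro b _ hb
      obtain ⟨p, hp⟩ := Function.ne_iff.mp hb
      rw [Finset.prod_eq_zero (Finset.mem_univ p) (if_neg fun h => hp h.2.symm), mul_zero]
    · simp
    · intro b _ hb
      obtain ⟨p, hp⟩ := Function.ne_iff.mp hb
      refine Finset.sum_eq_zero fun b' _ => ?_
      rw [Finset.prod_eq_zero (Finset.mem_univ p) (if_neg fun h => hp h.1.symm), mul_zero]
    · simp
  have hs : ∀ (p : J) (b b' : Fin L), (Fintype.card (Equiv.Perm (Fin L)) : ℝ)⁻¹ *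
      (∑ σ : Equiv.Perm (Fin L), if σ (a p) = b ∧ σ (a' p) = b' then (1 : ℝ) else 0) =
      ((L : ℝ) ^ 2)⁻¹ * (1 + (eps (a p) (a' p) - 1) * (eps b b' - 1) / ((L : ℝ) - 1)) := by
    intro p b b'
    have := average_perm_pair hL (a p) (a' p) fun c c' => if c = b ∧ c' = b' then (1 : ℝ) else 0
    rw [this, Finset.sum_eq_single b, Finset.sum_eq_single b']
    · simp
    · intro c _ hc; simp [hc]
    · simp
    · intro c _ hc; simp [hc]
    · simp
  have hp : ∀ b b' : J → Fin L, (Fintype.card (J → Equiv.Perm (Fin L)) : ℝ)⁻¹ *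
      (∑ π : J → Equiv.Perm (Fin L), ∏ p,
        if π p (a p) = b p ∧ π p (a' p) = b' p then (1 : ℝ) else 0) =
      ((L : ℝ) ^ (2 * Fintype.card J))⁻¹ *
        ∏ p, (1 + (eps (a p) (a' p) - 1) * (eps (b p) (b' p) - 1) / ((L : ℝ) - 1)) := by
    intro b b'
    have h1 := Finset.prod_univ_sum (fun _ : J => (Finset.univ : Finset (Equiv.Perm (Fin L))))
      fun p σ => if σ (a p) = b p ∧ σ (a' p) = b' p then (1 : ℝ) else 0
    simp only [Fintype.piFinset_univ] at h1
    rw [← h1]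
    have h2 := Finset.prod_congr (rfl : (Finset.univ : Finset J) = _) fun p _ => hs p (b p) (b' p)
    rw [Finset.prod_mul_distrib, Finset.prod_mul_distrib] at h2
    simpa [pow_mul, Finset.prod_const] using h2
  simp_rw [hf]
  rw [Finset.sum_comm]
  simp_rw [Finset.sum_comm (s := (Finset.univ : Finset (J → Equiv.Perm (Fin L)))),
    ← Finset.mul_sum]
  rw [Finset.mul_sum, Finset.mul_sum]
  refine Finset.sum_congr rfl fun b _ => ?_
  rw [Finset.mul_sum, Finset.mul_sum]
  refine Finset.sum_congr rfl fun b' _ => ?_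
  rw [mul_left_comm, hp]
  ring

/-! ### Orthogonal arrays -/

section OrthogonalArray

variable {J : Type} [Fintype J] [DecidableEq J] {m L t lam : ℕ} {A : Fin m → J → Fin L}

/-- Extend u to t columns T: every tuple of levels on T occurs `lam` times, so the sum over rows
factors over T, and each of the t - |u| added columns contributes a factor L. -/
theorem IsOrthogonalArray.sum_prod (hA : IsOrthogonalArray A t lam) {u : Finset J}
    (hu : u.card ≤ t) (f : J → Fin L → ℝ) :
    ∃ T : Finset J, u ⊆ T ∧ T.card = t ∧
      ∑ i, ∏ p ∈ u, f p (A i p) = lam * (∏ p ∈ u, ∑ z, f p z) * (L : ℝ) ^ (t - u.card) := by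
  obtain ⟨T, huT, hT⟩ := Finset.exists_superset_card_eq hu hA.1
  refine ⟨T, huT, hT, ?_⟩
  let f' : J → Fin L → ℝ := fun p z => if p ∈ u then f p z else 1
  have h1 : ∀ a : J → Fin L, ∏ p ∈ u, f p (a p) = ∏ p : T, f' p (a p) := by
    intro a
    rw [Finset.prod_coe_sort T fun p => f' p (a p)]
    simp only [f']
    rw [Finset.prod_ite_mem, Finset.inter_eq_right.mpr huT]
  have h2 := hA.2 T hT
  have h3 : ∀ i, ∏ p : T, f' p (A i p) =
      ∑ v : T → Fin L, if (∀ j : T, A i j = v j) then ∏ p : T, f' p (v p) else 0 := by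
    intro i
    rw [Finset.sum_eq_single fun j : T => A i j]
    · simp
    · intro v _ hv
      rw [if_neg]
      intro h
      exact hv (funext fun j => (h j).symm)
    · simp
  simp_rw [h1, h3]
  rw [Finset.sum_comm]
  have h4 : ∀ v : T → Fin L, (∑ i, if (∀ j : T, A i j = v j) then ∏ p : T, f' p (v p) else 0) =
      lam * ∏ p : T, f' p (v p) := by
    intro v
    rw [← Finset.sum_filter, Finset.sum_const, nsmul_eq_mul, ← h2 v, Fintype.card_subtype]
  simp_rw [h4]
  rw [← Finset.mul_sum]
  have h5 := Finset.prod_univ_sum (fun _ : T => (Finset.univ : Finset (Fin L))) fun p z => f' p z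
  simp only [Fintype.piFinset_univ] at h5
  rw [← h5, Finset.prod_coe_sort T fun p => ∑ z, f' p z, mul_assoc]
  congr 1
  rw [← Finset.prod_sdiff huT, mul_comm]
  congr 1
  · refine Finset.prod_congr rfl fun p hp => ?_
    simp [f', hp]
  · rw [← hT, ← Finset.card_sdiff_of_subset huT, ← Finset.prod_const]
    refine Finset.prod_congr rfl fun p hp => ?_
    simp [f', (Finset.mem_sdiff.mp hp).2]

theorem IsOrthogonalArray.card_eq (hA : IsOrthogonalArray A t lam) :
    (m : ℝ) = lam * (L : ℝ) ^ t := by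
  obtain ⟨T, -, -, h⟩ := hA.sum_prod (u := ∅) (by simp) fun _ _ => 1
  simpa using h

theorem IsOrthogonalArray.sum_prod_eps (hA : IsOrthogonalArray A t lam) {u : Finset J}
    (hu : u.card ≤ t) (a : J → Fin L) : ∑ i, ∏ p ∈ u, eps (a p) (A i p) = m := by
  obtain ⟨T, -, -, h⟩ := hA.sum_prod hu fun p z => eps (a p) z
  rw [h, hA.card_eq]
  simp_rw [sum_eps, Finset.prod_const]
  rw [mul_assoc, ← pow_add, Nat.add_sub_cancel' hu]

/-- Each factor `eps (a p) · - 1` sums to zero over the levels. This is how strength t removes the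
components of order 1 to t. -/
theorem IsOrthogonalArray.sum_prod_eps_sub_one (hA : IsOrthogonalArray A t lam) {u : Finset J}
    (hu : u.card ≤ t) (hu0 : u ≠ ∅) (a : J → Fin L) :
    ∑ i, ∏ p ∈ u, (eps (a p) (A i p) - 1) = 0 := by
  obtain ⟨T, -, -, h⟩ := hA.sum_prod hu fun p z => eps (a p) z - 1
  rw [h]
  simp [Finset.sum_sub_distrib, sum_eps, hu0]

/-- The average coefficient of the component `u` in the conditional variance. -/
noncomputable def tau (A : Fin m → J → Fin L) (u : Finset J) : ℝ :=
  (m : ℝ)⁻¹ * ∑ i, ∑ i', (((L : ℝ) - 1) ^ u.card)⁻¹ * ∏ p ∈ u, (eps (A i p) (A i' p) - 1)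

theorem tau_empty {J : Type} {m L : ℕ} (A : Fin m → J → Fin L) : tau A ∅ = m := by
  simp only [tau, Finset.prod_empty, Finset.card_empty, pow_zero, inv_one, mul_one,
    Finset.sum_const, Finset.card_univ, Fintype.card_fin, nsmul_eq_mul]
  rcases eq_or_ne (m : ℝ) 0 with h | h
  · simp [h]
  · field_simp

theorem IsOrthogonalArray.tau_eq_zero (hA : IsOrthogonalArray A t lam) {u : Finset J}
    (hu : u.card ≤ t) (hu0 : u ≠ ∅) : tau A u = 0 := by
  simp only [tau, ← Finset.mul_sum, hA.sum_prod_eps_sub_one hu hu0]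
  simp

/-- Off the coincidence set the factors are -1, on it they are L - 1 ≤ L. So the product is at most
the single term of the right side that belongs to the coincidence set. The remaining nonnegative
terms are added because the sum over all small sets w, unlike that single term, can be summed over
rows by `sum_prod_eps`. -/
theorem abs_prod_eps_sub_one_le {J : Type} [DecidableEq J] {L t : ℕ} {u : Finset J} (hL : 2 ≤ L) (a b : J → Fin L)
    (h : (u.filter fun p => a p = b p).card ≤ t) :
    |∏ p ∈ u, (eps (a p) (b p) - 1)| ≤
      ∑ w ∈ u.powerset with w.card ≤ t, ∏ p ∈ w, eps (a p) (b p) := by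
  set S := u.filter fun p => a p = b p with hS
  have hSu : S ⊆ u := Finset.filter_subset _ _
  have hL2 : (2 : ℝ) ≤ L := by exact_mod_cast hL
  refine le_trans ?_ (Finset.single_le_sum (f := fun w => ∏ p ∈ w, eps (a p) (b p))
    (fun w _ => Finset.prod_nonneg fun p _ => eps_nonneg _ _)
    (Finset.mem_filter.mpr ⟨Finset.mem_powerset.mpr hSu, h⟩))
  rw [Finset.abs_prod, ← Finset.prod_sdiff hSu]
  have h1 : ∏ p ∈ u \ S, |eps (a p) (b p) - 1| = 1 := by
    refine Finset.prod_eq_one fun p hp => ?_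
    have : a p ≠ b p := by
      intro hab
      rw [Finset.mem_sdiff, hS, Finset.mem_filter] at hp
      exact hp.2 ⟨hp.1, hab⟩
    simp [eps, this]
  rw [h1, one_mul]
  refine Finset.prod_le_prod (fun p _ => abs_nonneg _) fun p hp => ?_
  have hab : a p = b p := (Finset.mem_filter.mp hp).2
  simp only [eps, hab, if_true]
  rw [abs_of_nonneg (by linarith)]
  linarith

/-- A row paired with itself contributes exactly 1. Distinct rows agree in at most t columns, so the
off-diagonal part of a row sum is at most 2^|u| m / (L - 1)^|u|. Then L - 1 ≥ L/2 costs a second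
factor 2^|u|, and m = λ L^t ≤ λ L^(|u| - 1) leaves λ/L. -/
theorem abs_tau_sub_one_le (hA : IsOrthogonalArray A t lam) (hA' : CoincidenceFree A t)
    (hm : 0 < m) (hL : 2 ≤ L) {u : Finset J} (hu : t < u.card) :
    |tau A u - 1| ≤ 2 ^ (u.card + u.card) * (lam / L : ℝ) := by
  have hL2 : (2 : ℝ) ≤ L := by exact_mod_cast hL
  have hL1 : (0 : ℝ) < (L : ℝ) - 1 := by linarith
  have hm0 : (0 : ℝ) < m := by exact_mod_cast hm
  have hdiag : ∀ i, (((L : ℝ) - 1) ^ u.card)⁻¹ * ∏ p ∈ u, (eps (A i p) (A i p) - 1) = 1 := by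
    intro i
    simp only [eps, if_true, Finset.prod_const]
    exact inv_mul_cancel₀ (by positivity)
  have hrow : ∀ i, |∑ i', (((L : ℝ) - 1) ^ u.card)⁻¹ * ∏ p ∈ u, (eps (A i p) (A i' p) - 1) - 1| ≤
      (((L : ℝ) - 1) ^ u.card)⁻¹ * (2 ^ u.card * m) := by
    intro i
    rw [← Finset.add_sum_erase _ _ (Finset.mem_univ i), hdiag i, add_sub_cancel_left,
      ← Finset.mul_sum, abs_mul, abs_of_pos (by positivity)]
    refine mul_le_mul_of_nonneg_left ?_ (by positivity)
    calc |∑ i' ∈ Finset.univ.erase i, ∏ p ∈ u, (eps (A i p) (A i' p) - 1)|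
        ≤ ∑ i' ∈ Finset.univ.erase i, |∏ p ∈ u, (eps (A i p) (A i' p) - 1)| :=
          Finset.abs_sum_le_sum_abs _ _
      _ ≤ ∑ i' ∈ Finset.univ.erase i,
          ∑ w ∈ u.powerset with w.card ≤ t, ∏ p ∈ w, eps (A i p) (A i' p) := by
          refine Finset.sum_le_sum fun i' hi' => abs_prod_eps_sub_one_le hL _ _ ?_
          by_contra hcon
          -- More than t coincidences would give t + 1 columns on which two distinct rows agree.
          obtain ⟨T, hT, hTc⟩ := Finset.exists_subset_card_eq (Nat.succ_le_of_lt (not_le.mp hcon))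
          refine (Finset.mem_erase.mp hi').1 (hA' T hTc i i' fun j hj => ?_).symm
          exact (Finset.mem_filter.mp (hT hj)).2
      _ ≤ ∑ i', ∑ w ∈ u.powerset with w.card ≤ t, ∏ p ∈ w, eps (A i p) (A i' p) :=
          Finset.sum_le_sum_of_subset_of_nonneg (Finset.subset_univ _) fun _ _ _ =>
            Finset.sum_nonneg fun w _ => Finset.prod_nonneg fun p _ => eps_nonneg _ _
      _ = ∑ w ∈ u.powerset with w.card ≤ t, (m : ℝ) := by
          rw [Finset.sum_comm]
          exact Finset.sum_congr rfl fun w hw => hA.sum_prod_eps (Finset.mem_filter.mp hw).2 _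
      _ ≤ ∑ w ∈ u.powerset, (m : ℝ) :=
          Finset.sum_le_sum_of_subset_of_nonneg (Finset.filter_subset _ _) fun _ _ _ => hm0.le
      _ = 2 ^ u.card * m := by simp [Finset.card_powerset]
  have htau : tau A u - 1 = (m : ℝ)⁻¹ * ∑ i,
      (∑ i', (((L : ℝ) - 1) ^ u.card)⁻¹ * ∏ p ∈ u, (eps (A i p) (A i' p) - 1) - 1) := by
    rw [Finset.sum_sub_distrib, mul_sub, tau]
    simp [hm0.ne']
  rw [htau, abs_mul, abs_of_pos (by positivity : (0 : ℝ) < (m : ℝ)⁻¹)]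
  calc _ ≤ (m : ℝ)⁻¹ * ∑ _i : Fin m, (((L : ℝ) - 1) ^ u.card)⁻¹ * (2 ^ u.card * m) :=
        mul_le_mul_of_nonneg_left ((Finset.abs_sum_le_sum_abs _ _).trans
          (Finset.sum_le_sum fun i _ => hrow i)) (by positivity)
    _ = (((L : ℝ) - 1) ^ u.card)⁻¹ * (2 ^ u.card * (lam * (L : ℝ) ^ t)) := by
        simp only [Finset.sum_const, Finset.card_univ, Fintype.card_fin, nsmul_eq_mul]
        rw [inv_mul_cancel_left₀ hm0.ne', ← hA.card_eq]
    _ ≤ ((((L : ℝ) / 2)) ^ u.card)⁻¹ * (2 ^ u.card * (lam * (L : ℝ) ^ (u.card - 1))) := by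
        gcongr
        · linarith
        · linarith
        · omega
    _ = _ := by
        obtain ⟨k, hk⟩ : ∃ k, u.card = k + 1 := ⟨u.card - 1, by omega⟩
        rw [hk]
        have : (L : ℝ) ≠ 0 := by positivity
        simp only [Nat.add_sub_cancel, div_pow, pow_add]
        field_simp

end OrthogonalArray

/-! ### Independent draws from finite sets -/

section Draws

variable {m : ℕ} {T : Type*} [Fintype T] (w : Fin m → T → ℝ)

theorem sum_prod_draws (φ : Fin m → T → ℝ) :
    ∑ e : Fin m → T, (∏ i, w i (e i)) * ∏ i, φ i (e i) = ∏ i, ∑ z, w i z * φ i z := by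
  have h := Finset.prod_univ_sum (fun _ : Fin m => (Finset.univ : Finset T))
    fun i z => w i z * φ i z
  rw [h, Fintype.piFinset_univ]
  exact Finset.sum_congr rfl fun e _ => Finset.prod_mul_distrib.symm

variable {w}

theorem sum_draws_one (hw : ∀ i, ∑ z, w i z = 1) (i : Fin m) (h : T → ℝ) :
    ∑ e : Fin m → T, (∏ j, w j (e j)) * h (e i) = ∑ z, w i z * h z := by
  have := sum_prod_draws w fun j z => if j = i then h z else 1
  simp only [Finset.prod_ite_eq', Finset.mem_univ, if_true] at this
  rw [this, Finset.prod_eq_single i]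
  · simp
  · intro j _ hj; simp [hj, hw]
  · simp

theorem sum_draws_two (hw : ∀ i, ∑ z, w i z = 1) {i i' : Fin m} (hi : i ≠ i') (h h' : T → ℝ) :
    ∑ e : Fin m → T, (∏ j, w j (e j)) * (h (e i) * h' (e i')) =
      (∑ z, w i z * h z) * ∑ z, w i' z * h' z := by
  have := sum_prod_draws w fun j z => (if j = i then h z else 1) * if j = i' then h' z else 1
  simp only [Finset.prod_mul_distrib, Finset.prod_ite_eq', Finset.mem_univ, if_true] at this
  rw [this, ← Finset.mul_prod_erase _ _ (Finset.mem_univ i),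
    ← Finset.mul_prod_erase _ _ (Finset.mem_erase.mpr ⟨hi.symm, Finset.mem_univ i'⟩)]
  rw [Finset.prod_eq_one (s := (Finset.univ.erase i).erase i')]
  · simp [hi, hi.symm]
  · intro j hj
    simp only [Finset.mem_erase, Finset.mem_univ, and_true] at hj
    simp [hj.1, hj.2, hw]

theorem sum_draws_sum (hw : ∀ i, ∑ z, w i z = 1) (h : Fin m → T → ℝ) :
    ∑ e : Fin m → T, (∏ j, w j (e j)) * ∑ i, h i (e i) = ∑ i, ∑ z, w i z * h i z := by
  simp_rw [Finset.mul_sum]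
  rw [Finset.sum_comm]
  exact Finset.sum_congr rfl fun i _ => sum_draws_one hw i (h i)

/-- Distinct draws are independent, so only the individual variances are added to the products of
the means; the double sum of products includes the diagonal. -/
theorem sum_draws_sum_sq (hw : ∀ i, ∑ z, w i z = 1) (h : Fin m → T → ℝ) :
    ∑ e : Fin m → T, (∏ j, w j (e j)) * (∑ i, h i (e i)) ^ 2 =
      ∑ i, ((∑ z, w i z * h i z ^ 2) - (∑ z, w i z * h i z) ^ 2) +
        ∑ i, ∑ i', (∑ z, w i z * h i z) * ∑ z, w i' z * h i' z := by
  have key : ∀ i i', ∑ e : Fin m → T, (∏ j, w j (e j)) * (h i (e i) * h i' (e i')) =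
      (if i = i' then (∑ z, w i z * h i z ^ 2) - (∑ z, w i z * h i z) ^ 2 else 0) +
        (∑ z, w i z * h i z) * ∑ z, w i' z * h i' z := by
    intro i i'
    split_ifs with hi
    · subst hi
      have := sum_draws_one hw i fun z => h i z ^ 2
      simp only [sq] at this ⊢
      rw [this]
      ring
    · rw [sum_draws_two hw hi, zero_add]
  calc _ = ∑ i, ∑ i', ∑ e : Fin m → T, (∏ j, w j (e j)) * (h i (e i) * h i' (e i')) := by
        simp_rw [sq, Finset.sum_mul_sum, Finset.mul_sum]
        rw [Finset.sum_comm]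
        exact Finset.sum_congr rfl fun i _ => Finset.sum_comm
    _ = _ := by
        simp_rw [key, Finset.sum_add_distrib]
        simp

end Draws

/-! ### The conditional moments given the data and the groups -/

section Conditional

variable {K L : ℕ} {d n : Fin K → ℕ}

/-- The levels of the units of a tuple. -/
def levels (c : (k : Fin K) → Fin (n k) → Fin L) (η : Tuple d n) (p : Pos d) : Fin L :=
  c p.1 (η p.1 p.2)

theorem mem_gridStar {c : (k : Fin K) → Fin (n k) → Fin L} {a : Pos d → Fin L} {η : Tuple d n} :
    η ∈ gridStar c a ↔ η ∈ S0star d n ∧ levels c η = a := by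
  simp only [gridStar, Finset.mem_filter, and_congr_right_iff]
  intro _
  constructor
  · intro h; funext p; exact h p.1 p.2
  · rintro rfl k j; rfl

theorem card_pos_eq : Fintype.card (Pos d) = ∑ k, d k := by simp

theorem sum_gridStar (c : (k : Fin K) → Fin (n k) → Fin L) (f : (Pos d → Fin L) → Tuple d n → ℝ) :
    ∑ b, ∑ η ∈ gridStar c b, f b η = ∑ η ∈ S0star d n, f (levels c η) η := by
  classical
  rw [← Finset.sum_fiberwise (S0star d n) (levels c)]
  refine Finset.sum_congr rfl fun b _ => ?_
  have : gridStar c b = (S0star d n).filter fun η => levels c η = b := by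
    ext η; rw [mem_gridStar, Finset.mem_filter]
  rw [this]
  refine Finset.sum_congr rfl fun η hη => ?_
  rw [(Finset.mem_filter.mp hη).2]

/-- The quadratic form comparing pairs of tuples that share their groups at the positions `v`. -/
noncomputable def blockForm (c : (k : Fin K) → Fin (n k) → Fin L) (v : Finset (Pos d))
    (h h' : Tuple d n → ℝ) : ℝ :=
  (((S0star d n).card : ℝ) ^ 2)⁻¹ * ∑ η ∈ S0star d n, ∑ η' ∈ S0star d n,
    h η * h' η' * ∏ p ∈ v, eps (levels c η p) (levels c η' p)

/-- The average over the cells of the second moment of a weighted draw from the cell. -/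
noncomputable def drawForm (c : (k : Fin K) → Fin (n k) → Fin L) (h : Tuple d n → ℝ) : ℝ :=
  (L : ℝ) ^ Fintype.card (Pos d) * (((S0star d n).card : ℝ) ^ 2)⁻¹ *
    ∑ η ∈ S0star d n, ((gridStar c (levels c η)).card : ℝ) * h η ^ 2

/-- The conditional mean of a weighted draw from the cell `b`. -/
noncomputable def cellMean (c : (k : Fin K) → Fin (n k) → Fin L) (h : Tuple d n → ℝ)
    (b : Pos d → Fin L) : ℝ :=
  (L : ℝ) ^ Fintype.card (Pos d) / (S0star d n).card * ∑ η ∈ gridStar c b, h η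

theorem sum_cellMean_mul (c : (k : Fin K) → Fin (n k) → Fin L) (h : Tuple d n → ℝ)
    (φ : (Pos d → Fin L) → ℝ) :
    ∑ b, cellMean c h b * φ b = (L : ℝ) ^ Fintype.card (Pos d) / (S0star d n).card *
      ∑ η ∈ S0star d n, h η * φ (levels c η) := by
  rw [← sum_gridStar c fun b η => h η * φ b, Finset.mul_sum]
  refine Finset.sum_congr rfl fun b _ => ?_
  rw [cellMean, mul_assoc, Finset.sum_mul]

theorem sum_cellMean_mul_cellMean (hL : Fintype.card (Pos d) = 0 ∨ L ≠ 0)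
    (c : (k : Fin K) → Fin (n k) → Fin L) (h : Tuple d n → ℝ)
    (φ : (Pos d → Fin L) → (Pos d → Fin L) → ℝ) :
    ((L : ℝ) ^ (2 * Fintype.card (Pos d)))⁻¹ *
      ∑ b, ∑ b', cellMean c h b * cellMean c h b' * φ b b' =
    (((S0star d n).card : ℝ) ^ 2)⁻¹ * ∑ η ∈ S0star d n, ∑ η' ∈ S0star d n,
      h η * h η' * φ (levels c η) (levels c η') := by
  have hL0 : (L : ℝ) ^ Fintype.card (Pos d) ≠ 0 := by
    rcases hL with h | h
    · simp [h]
    · exact pow_ne_zero _ (by exact_mod_cast h)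
  have h1 : ∀ b, ∑ b', cellMean c h b * cellMean c h b' * φ b b' = cellMean c h b *
      ((L : ℝ) ^ Fintype.card (Pos d) / (S0star d n).card *
        ∑ η ∈ S0star d n, h η * φ b (levels c η)) := by
    intro b
    rw [← sum_cellMean_mul, Finset.mul_sum]
    simp_rw [mul_assoc]
  simp_rw [h1, sum_cellMean_mul]
  have h2 : ∀ η, h η * ((L : ℝ) ^ Fintype.card (Pos d) / (S0star d n).card *
        ∑ η' ∈ S0star d n, h η' * φ (levels c η) (levels c η')) =
      ((L : ℝ) ^ Fintype.card (Pos d) / (S0star d n).card) *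
        ∑ η' ∈ S0star d n, h η * h η' * φ (levels c η) (levels c η') := by
    intro η
    rw [mul_left_comm, Finset.mul_sum]
    simp_rw [mul_assoc]
  simp_rw [h2, ← Finset.mul_sum]
  rw [← mul_assoc, ← mul_assoc, mul_comm 2, pow_mul]
  congr 1
  field_simp

/-- Over all positions the product of the `eps` is L^d times the indicator that the two cells
coincide. -/
theorem inv_mul_sum_cellMean_sq (hL : Fintype.card (Pos d) = 0 ∨ L ≠ 0)
    (c : (k : Fin K) → Fin (n k) → Fin L) (h : Tuple d n → ℝ) :
    ((L : ℝ) ^ Fintype.card (Pos d))⁻¹ * ∑ b, cellMean c h b ^ 2 =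
      blockForm c Finset.univ h h := by
  have hL0 : (L : ℝ) ^ Fintype.card (Pos d) ≠ 0 := by
    rcases hL with h | h
    · simp [h]
    · exact pow_ne_zero _ (by exact_mod_cast h)
  have hprod : ∀ b b' : Pos d → Fin L, ∏ p, eps (b p) (b' p) =
      if b = b' then (L : ℝ) ^ Fintype.card (Pos d) else 0 := by
    intro b b'
    split_ifs with hb
    · subst hb; simp [eps]
    · obtain ⟨p, hp⟩ := Function.ne_iff.mp hb
      exact Finset.prod_eq_zero (Finset.mem_univ p) (if_neg hp)
  rw [blockForm, ← sum_cellMean_mul_cellMean hL c h fun b b' => ∏ p, eps (b p) (b' p)]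
  simp only [hprod, mul_ite, mul_zero, Finset.sum_ite_eq, Finset.mem_univ, if_true,
    ← Finset.sum_mul, mul_comm 2, pow_mul]
  field_simp

theorem inv_mul_sum_cell_sq (hL : Fintype.card (Pos d) = 0 ∨ L ≠ 0)
    (c : (k : Fin K) → Fin (n k) → Fin L) (h : Tuple d n → ℝ) :
    ((L : ℝ) ^ Fintype.card (Pos d))⁻¹ * ∑ b, ((L : ℝ) ^ Fintype.card (Pos d) /
      (S0star d n).card) ^ 2 * ((gridStar c b).card * ∑ η ∈ gridStar c b, h η ^ 2) =
      drawForm c h := by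
  have hL0 : (L : ℝ) ^ Fintype.card (Pos d) ≠ 0 := by
    rcases hL with h | h
    · simp [h]
    · exact pow_ne_zero _ (by exact_mod_cast h)
  rw [drawForm, ← sum_gridStar c fun b η => ((gridStar c b).card : ℝ) * h η ^ 2]
  simp_rw [← Finset.mul_sum]
  rw [← mul_assoc]
  congr 1
  field_simp

/-- Expanding the product of the `eps - 1` over subsets of u produces the Möbius signs. The right
side is the form in which this quantity arises from the joint law of two rows. -/
theorem moebiusSum_blockForm (c : (k : Fin K) → Fin (n k) → Fin L) (u : Finset (Pos d))
    (h : Tuple d n → ℝ) :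
    moebiusSum (fun v => blockForm c v h h) u =
      (((S0star d n).card : ℝ) ^ 2)⁻¹ * ∑ η ∈ S0star d n, ∑ η' ∈ S0star d n,
        h η * h η' * ∏ p ∈ u, (eps (levels c η p) (levels c η' p) - 1) := by
  have hprod : ∀ η η' : Tuple d n, ∏ p ∈ u, (eps (levels c η p) (levels c η' p) - 1) =
      ∑ v ∈ u.powerset, (-1) ^ (u.card + v.card) *
        ∏ p ∈ v, eps (levels c η p) (levels c η' p) := by
    intro η η'
    simp_rw [sub_eq_add_neg]
    rw [Finset.prod_add]
    refine Finset.sum_congr rfl fun v hv => ?_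
    have hvu := Finset.mem_powerset.mp hv
    rw [Finset.prod_const, Finset.card_sdiff_of_subset hvu, mul_comm]
    congr 1
    obtain ⟨k, hk⟩ := Nat.exists_eq_add_of_le (Finset.card_le_card hvu)
    rw [hk, Nat.add_sub_cancel_left, add_right_comm, pow_add, ← two_mul, pow_mul]
    simp
  simp_rw [hprod, Finset.mul_sum, moebiusSum, blockForm, Finset.mul_sum]
  rw [Finset.sum_comm]
  refine Finset.sum_congr rfl fun η _ => ?_
  rw [Finset.sum_comm]
  refine Finset.sum_congr rfl fun η' _ => Finset.sum_congr rfl fun v _ => ?_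
  ring

variable {m : ℕ}

/-- The conditional probability of the drawn tuples. -/
noncomputable def drawWeight (c : (k : Fin K) → Fin (n k) → Fin L) (b : Pos d → Fin L)
    (η : Tuple d n) : ℝ :=
  (uniformProb (gridStar c b) η).toReal

theorem sum_drawWeight_mul (c : (k : Fin K) → Fin (n k) → Fin L) (b : Pos d → Fin L)
    (h : Tuple d n → ℝ) :
    ∑ η, drawWeight c b η * h η = ((gridStar c b).card : ℝ)⁻¹ * ∑ η ∈ gridStar c b, h η := by
  classical
  have : ∀ η, drawWeight c b η * h η =
      if η ∈ gridStar c b then ((gridStar c b).card : ℝ)⁻¹ * h η else 0 := by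
    intro η
    unfold drawWeight uniformProb
    split_ifs <;> simp
  simp_rw [this, Finset.mul_sum]
  rw [Finset.sum_ite_mem, Finset.univ_inter]

theorem sum_drawWeight {c : (k : Fin K) → Fin (n k) → Fin L} {b : Pos d → Fin L}
    (hb : (gridStar c b).Nonempty) : ∑ η, drawWeight c b η = 1 := by
  have := sum_drawWeight_mul c b fun _ => 1
  simp only [mul_one, Finset.sum_const, nsmul_eq_mul] at this
  rw [this]
  exact inv_mul_cancel₀ (by exact_mod_cast hb.card_pos.ne')

/-- The statistic for given groups, rows `a` and drawn tuples `e`. -/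
noncomputable def drawStatistic (c : (k : Fin K) → Fin (n k) → Fin L) (a : Fin m → Pos d → Fin L)
    (e : Fin m → Tuple d n) (h : Tuple d n → ℝ) : ℝ :=
  (1 / (m : ℝ)) * ∑ i, ((L : ℝ) ^ (∑ k, d k) * ((gridStar c (a i)).card : ℝ) /
    ((S0star d n).card : ℝ)) * h (e i)

/-- The factor |𝒢 ∩ S₀*| in the weight cancels the probability of the uniform draw from that cell.
-/
theorem sum_drawWeight_statistic {c : (k : Fin K) → Fin (n k) → Fin L}
    (hc : ∀ b : Pos d → Fin L, (gridStar c b).Nonempty) (a : Fin m → Pos d → Fin L)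
    (h : Tuple d n → ℝ) :
    ∑ e : Fin m → Tuple d n, (∏ i, drawWeight c (a i) (e i)) * drawStatistic c a e h =
      (m : ℝ)⁻¹ * ∑ i, cellMean c h (a i) := by
  simp_rw [drawStatistic, one_div, mul_left_comm _ (m : ℝ)⁻¹, ← Finset.mul_sum]
  rw [sum_draws_sum (fun i => sum_drawWeight (hc (a i)))
    fun i z => (L : ℝ) ^ (∑ k, d k) * ((gridStar c (a i)).card : ℝ) / (S0star d n).card * h z]
  congr 1
  refine Finset.sum_congr rfl fun i _ => ?_
  have h0 : ((gridStar c (a i)).card : ℝ) ≠ 0 := by exact_mod_cast (hc (a i)).card_pos.ne'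
  rw [sum_drawWeight_mul, ← Finset.mul_sum, cellMean, card_pos_eq]
  field_simp

theorem sum_drawWeight_statistic_sq {c : (k : Fin K) → Fin (n k) → Fin L}
    (hc : ∀ b : Pos d → Fin L, (gridStar c b).Nonempty) (a : Fin m → Pos d → Fin L)
    (h : Tuple d n → ℝ) :
    ∑ e : Fin m → Tuple d n, (∏ i, drawWeight c (a i) (e i)) * drawStatistic c a e h ^ 2 =
      ((m : ℝ) ^ 2)⁻¹ * (∑ i, (((L : ℝ) ^ Fintype.card (Pos d) / (S0star d n).card) ^ 2 *
          ((gridStar c (a i)).card * ∑ η ∈ gridStar c (a i), h η ^ 2) - cellMean c h (a i) ^ 2) +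
        ∑ i, ∑ i', cellMean c h (a i) * cellMean c h (a i')) := by
  simp_rw [drawStatistic, mul_pow, one_div, inv_pow, mul_left_comm _ ((m : ℝ) ^ 2)⁻¹,
    ← Finset.mul_sum]
  have hmean : ∀ i, ∑ z, drawWeight c (a i) z *
      ((L : ℝ) ^ (∑ k, d k) * ((gridStar c (a i)).card : ℝ) / (S0star d n).card * h z) =
      cellMean c h (a i) := by
    intro i
    have h0 : ((gridStar c (a i)).card : ℝ) ≠ 0 := by exact_mod_cast (hc (a i)).card_pos.ne'
    rw [sum_drawWeight_mul, ← Finset.mul_sum, cellMean, card_pos_eq]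
    field_simp
  have hsq : ∀ i, ∑ z, drawWeight c (a i) z *
      ((L : ℝ) ^ (∑ k, d k) * ((gridStar c (a i)).card : ℝ) / (S0star d n).card * h z) ^ 2 =
      ((L : ℝ) ^ Fintype.card (Pos d) / (S0star d n).card) ^ 2 *
          ((gridStar c (a i)).card * ∑ η ∈ gridStar c (a i), h η ^ 2) := by
    intro i
    have h0 : ((gridStar c (a i)).card : ℝ) ≠ 0 := by exact_mod_cast (hc (a i)).card_pos.ne'
    rw [sum_drawWeight_mul]
    simp_rw [mul_pow]
    rw [← Finset.mul_sum, card_pos_eq]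
    field_simp
  rw [sum_draws_sum_sq (fun i => sum_drawWeight (hc (a i)))
    fun i z => (L : ℝ) ^ (∑ k, d k) * ((gridStar c (a i)).card : ℝ) / (S0star d n).card * h z]
  congr 2
  · exact Finset.sum_congr rfl fun i _ => by rw [hmean, hsq]
  · exact Finset.sum_congr rfl fun i _ => by
      rw [Finset.mul_sum]
      exact Finset.sum_congr rfl fun i' _ => by rw [hmean, hmean]

/-- The average of `h` over the tuples without repeated units. -/
noncomputable def tupleMean (h : Tuple d n → ℝ) : ℝ :=
  ((S0star d n).card : ℝ)⁻¹ * ∑ η ∈ S0star d n, h η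

theorem blockForm_empty (c : (k : Fin K) → Fin (n k) → Fin L) (h : Tuple d n → ℝ) :
    blockForm c ∅ h h = tupleMean h ^ 2 := by
  simp only [blockForm, Finset.prod_empty, mul_one, tupleMean, mul_pow, inv_pow, sq (∑ η ∈ _, _),
    Finset.sum_mul_sum]

/-- Each permuted row is uniform over the cells and the cells partition S₀*, so averaging the cell
means gives the plain average over S₀*. -/
theorem conditional_mean {c : (k : Fin K) → Fin (n k) → Fin L}
    (hc : ∀ b : Pos d → Fin L, (gridStar c b).Nonempty)
    (hL : Fintype.card (Pos d) = 0 ∨ L ≠ 0) (hm : 0 < m)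
    (A : Fin m → Pos d → Fin L) (h : Tuple d n → ℝ) :
    (Fintype.card (Pos d → Equiv.Perm (Fin L)) : ℝ)⁻¹ * ∑ π : Pos d → Equiv.Perm (Fin L),
      ∑ e : Fin m → Tuple d n, (∏ i, drawWeight c (permuteLevels A π i) (e i)) *
        drawStatistic c (permuteLevels A π) e h = tupleMean h := by
  have hm0 : (m : ℝ) ≠ 0 := by exact_mod_cast hm.ne'
  have hL0 : (L : ℝ) ^ Fintype.card (Pos d) ≠ 0 := by
    rcases hL with h | h
    · simp [h]
    · exact pow_ne_zero _ (by exact_mod_cast h)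
  simp_rw [sum_drawWeight_statistic hc]
  rw [← Finset.mul_sum, Finset.sum_comm, mul_left_comm, Finset.mul_sum]
  have h1 := sum_cellMean_mul c h fun _ => 1
  simp only [mul_one] at h1
  have h2 : ∀ i, (Fintype.card (Pos d → Equiv.Perm (Fin L)) : ℝ)⁻¹ *
      ∑ π : Pos d → Equiv.Perm (Fin L), cellMean c h (permuteLevels A π i) = tupleMean h := by
    intro i
    rw [show (fun π : Pos d → Equiv.Perm (Fin L) => cellMean c h (permuteLevels A π i)) =
      fun π => cellMean c h (fun p => π p (A i p)) from rfl,
      average_columns (A i) (cellMean c h) (hL.imp Fintype.card_eq_zero_iff.mp id), h1, tupleMean]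
    field_simp
  simp_rw [h2]
  simp [hm0]

/-- The variance of a draw within a cell, averaged over cells, is `drawForm` minus the full block
form. The products of cell means are averaged with the joint law of two permuted rows. -/
theorem conditional_second_moment {c : (k : Fin K) → Fin (n k) → Fin L}
    (hc : ∀ b : Pos d → Fin L, (gridStar c b).Nonempty) (hL : 2 ≤ L) (hm : 0 < m)
    (A : Fin m → Pos d → Fin L) (h : Tuple d n → ℝ) :
    (Fintype.card (Pos d → Equiv.Perm (Fin L)) : ℝ)⁻¹ * ∑ π : Pos d → Equiv.Perm (Fin L),
      ∑ e : Fin m → Tuple d n, (∏ i, drawWeight c (permuteLevels A π i) (e i)) *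
        drawStatistic c (permuteLevels A π) e h ^ 2 =
      (m : ℝ)⁻¹ * (drawForm c h - blockForm c Finset.univ h h +
        ∑ u, tau A u * moebiusSum (fun v => blockForm c v h h) u) := by
  have hm0 : (m : ℝ) ≠ 0 := by exact_mod_cast hm.ne'
  have hL0 : L ≠ 0 := by omega
  have h1 : ∀ i, (Fintype.card (Pos d → Equiv.Perm (Fin L)) : ℝ)⁻¹ *
      ∑ π : Pos d → Equiv.Perm (Fin L),
        (((L : ℝ) ^ Fintype.card (Pos d) / (S0star d n).card) ^ 2 *
          ((gridStar c (permuteLevels A π i)).card *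
            ∑ η ∈ gridStar c (permuteLevels A π i), h η ^ 2) -
          cellMean c h (permuteLevels A π i) ^ 2) =
      drawForm c h - blockForm c Finset.univ h h := by
    intro i
    have := average_columns (A i) (fun b => ((L : ℝ) ^ Fintype.card (Pos d) /
        (S0star d n).card) ^ 2 * ((gridStar c b).card * ∑ η ∈ gridStar c b, h η ^ 2) -
          cellMean c h b ^ 2) (Or.inr hL0)
    rw [Finset.sum_sub_distrib (f := fun b => ((L : ℝ) ^ Fintype.card (Pos d) /
        (S0star d n).card) ^ 2 * ((gridStar c b).card * ∑ η ∈ gridStar c b, h η ^ 2)), mul_sub,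
        inv_mul_sum_cell_sq (Or.inr hL0), inv_mul_sum_cellMean_sq (Or.inr hL0)] at this
    exact this
  have h2 : ∀ i i', (Fintype.card (Pos d → Equiv.Perm (Fin L)) : ℝ)⁻¹ *
      ∑ π : Pos d → Equiv.Perm (Fin L),
        cellMean c h (permuteLevels A π i) * cellMean c h (permuteLevels A π i') =
      ∑ u, ((((L : ℝ) - 1) ^ u.card)⁻¹ * ∏ p ∈ u, (eps (A i p) (A i' p) - 1)) *
        moebiusSum (fun v => blockForm c v h h) u := by
    intro i i'
    have := average_columns_pair hL (A i) (A i') fun b b' => cellMean c h b * cellMean c h b'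
    refine this.trans ?_
    rw [sum_cellMean_mul_cellMean (Or.inr hL0) c h fun b b' => ∏ p, (1 + (eps (A i p) (A i' p) - 1)
      * (eps (b p) (b' p) - 1) / ((L : ℝ) - 1))]
    -- Expanding the product separates the array, which is collected into `tau`, from the data.
    have hx : ∀ b b' : Pos d → Fin L, ∏ p, (1 + (eps (A i p) (A i' p) - 1) *
        (eps (b p) (b' p) - 1) / ((L : ℝ) - 1)) =
        ∑ u, ((((L : ℝ) - 1) ^ u.card)⁻¹ * ∏ p ∈ u, (eps (A i p) (A i' p) - 1)) *
          ∏ p ∈ u, (eps (b p) (b' p) - 1) := by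
      intro b b'
      rw [Finset.prod_one_add, Finset.powerset_univ]
      refine Finset.sum_congr rfl fun u _ => ?_
      rw [Finset.prod_div_distrib, Finset.prod_mul_distrib, Finset.prod_const]
      ring
    simp_rw [moebiusSum_blockForm, hx, Finset.mul_sum]
    symm
    rw [Finset.sum_comm]
    refine Finset.sum_congr rfl fun η _ => ?_
    rw [Finset.sum_comm]
    refine Finset.sum_congr rfl fun η' _ => Finset.sum_congr rfl fun u _ => ?_
    ring
  have h3 : (Fintype.card (Pos d → Equiv.Perm (Fin L)) : ℝ)⁻¹ *
      ∑ π : Pos d → Equiv.Perm (Fin L), ∑ i, ∑ i',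
        cellMean c h (permuteLevels A π i) * cellMean c h (permuteLevels A π i') =
      m * ∑ u, tau A u * moebiusSum (fun v => blockForm c v h h) u := by
    calc _ = ∑ i, ∑ i', (Fintype.card (Pos d → Equiv.Perm (Fin L)) : ℝ)⁻¹ *
        ∑ π : Pos d → Equiv.Perm (Fin L),
          cellMean c h (permuteLevels A π i) * cellMean c h (permuteLevels A π i') := by
          rw [Finset.sum_comm, Finset.mul_sum]
          refine Finset.sum_congr rfl fun i _ => ?_
          rw [Finset.sum_comm, Finset.mul_sum]
      _ = ∑ u, (∑ i, ∑ i', (((L : ℝ) - 1) ^ u.card)⁻¹ * ∏ p ∈ u, (eps (A i p) (A i' p) - 1)) *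
            moebiusSum (fun v => blockForm c v h h) u := by
          simp_rw [h2, Finset.sum_mul]
          symm
          rw [Finset.sum_comm]
          refine Finset.sum_congr rfl fun i _ => ?_
          rw [Finset.sum_comm]
      _ = _ := by
          rw [Finset.mul_sum]
          refine Finset.sum_congr rfl fun u _ => ?_
          rw [tau, ← mul_assoc, mul_inv_cancel_left₀ hm0]
  have h4 : (Fintype.card (Pos d → Equiv.Perm (Fin L)) : ℝ)⁻¹ *
      ∑ π : Pos d → Equiv.Perm (Fin L), ∑ i,
        (((L : ℝ) ^ Fintype.card (Pos d) / (S0star d n).card) ^ 2 *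
          ((gridStar c (permuteLevels A π i)).card *
            ∑ η ∈ gridStar c (permuteLevels A π i), h η ^ 2) -
          cellMean c h (permuteLevels A π i) ^ 2) =
      m * (drawForm c h - blockForm c Finset.univ h h) := by
    rw [Finset.sum_comm, Finset.mul_sum]
    simp_rw [h1]
    simp [mul_sub]
  simp_rw [sum_drawWeight_statistic_sq hc]
  rw [← Finset.mul_sum, Finset.sum_add_distrib, mul_left_comm, mul_add, h4, h3]
  field_simp

end Conditional

/-! ### The complete U-statistic as an average over tuples -/

section Complete

variable {K : ℕ} {d n : Fin K → ℕ}

theorem mem_S0star {η : Tuple d n} : η ∈ S0star d n ↔ ∀ k, Function.Injective (η k) := by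
  simp [S0star]

theorem card_S0star : (S0star d n).card = ∏ k, (n k).descFactorial (d k) := by
  classical
  have h : S0star d n = Fintype.piFinset fun k =>
      Finset.univ.filter fun f : Fin (d k) → Fin (n k) => Function.Injective f := by
    ext η; simp [mem_S0star]
  rw [h, Fintype.card_piFinset]
  refine Finset.prod_congr rfl fun k _ => ?_
  rw [← Fintype.card_subtype, Fintype.card_congr (Equiv.subtypeInjectiveEquivEmbedding _ _),
    Fintype.card_embedding_eq, Fintype.card_fin, Fintype.card_fin]

/-- A tuple without repeated units is put into increasing order by exactly one permutation within
each sample. -/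
theorem sum_S0star_eq (f : Tuple d n → ℝ)
    (hf : ∀ (σ : (k : Fin K) → Equiv.Perm (Fin (d k))) (η : Tuple d n),
      f (fun k => η k ∘ σ k) = f η) :
    ∑ η ∈ S0star d n, f η = (∏ k, ((d k).factorial : ℝ)) * ∑ η ∈ increasingTuples d n, f η := by
  classical
  have h1 : ∀ η ∈ S0star d n, f η = ∑ σ : (k : Fin K) → Equiv.Perm (Fin (d k)),
      if ∀ k, StrictMono (η k ∘ σ k) then f (fun k => η k ∘ σ k) else 0 := by
    intro η hη
    have hinj := mem_S0star.mp hη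
    rw [Finset.sum_eq_single fun k => Tuple.sort (η k)]
    · rw [if_pos, hf]
      exact fun k => (Tuple.monotone_sort (η k)).strictMono_of_injective
        ((hinj k).comp (Tuple.sort (η k)).injective)
    · intro σ _ hσ
      rw [if_neg]
      intro h
      refine hσ (funext fun k => Equiv.ext fun j => hinj k ?_)
      exact congrFun (Tuple.unique_monotone (h k).monotone (Tuple.monotone_sort (η k))) j
    · simp
  have h2 : ∀ σ : (k : Fin K) → Equiv.Perm (Fin (d k)),
      (∑ η ∈ S0star d n, if ∀ k, StrictMono (η k ∘ σ k) then f (fun k => η k ∘ σ k) else 0) =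
      ∑ η ∈ increasingTuples d n, f η := by
    intro σ
    have hinc : increasingTuples d n = (S0star d n).filter fun η => ∀ k, StrictMono (η k) := by
      ext η
      simp only [increasingTuples, Finset.mem_filter, Finset.mem_univ, true_and, mem_S0star]
      exact ⟨fun h => ⟨fun k => (h k).injective, h⟩, fun h => h.2⟩
    rw [hinc, Finset.sum_filter]
    refine Finset.sum_bij' (fun η _ k => η k ∘ σ k) (fun η _ k => η k ∘ (σ k).symm) ?_ ?_ ?_ ?_ ?_
    · exact fun η hη => mem_S0star.mpr fun k => (mem_S0star.mp hη k).comp (σ k).injective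
    · exact fun η hη => mem_S0star.mpr fun k => (mem_S0star.mp hη k).comp (σ k).symm.injective
    · intro η _; funext k j; simp
    · intro η _; funext k j; simp
    · intro η _; rfl
  rw [Finset.sum_congr rfl h1, Finset.sum_comm, Finset.sum_congr rfl fun σ _ => h2 σ,
    Finset.sum_const, Finset.card_univ, nsmul_eq_mul, Fintype.card_pi]
  simp [Fintype.card_perm]

theorem U0_eq_tupleMean {g : (Pos d → ℝ) → ℝ} (hg : SymmetricKernel g) (x : Pos n → ℝ) :
    U0 g x = tupleMean fun η : Tuple d n => g (select x η) := by
  rw [U0, tupleMean, sum_S0star_eq, card_S0star]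
  · simp_rw [Nat.descFactorial_eq_factorial_mul_choose, Nat.cast_prod, Nat.cast_mul,
      Finset.prod_mul_distrib]
    have : (∏ k, ((d k).factorial : ℝ)) ≠ 0 :=
      Finset.prod_ne_zero_iff.mpr fun k _ => by exact_mod_cast (d k).factorial_ne_zero
    rw [mul_inv, ← mul_assoc, mul_right_comm _ _ (∏ k, ((d k).factorial : ℝ)),
      inv_mul_cancel₀ this, one_mul, Finset.prod_inv_distrib]
  · intro σ η
    exact hg σ (select x η)

end Complete

/-! ### Functions of a variable with finitely many values -/

section FiniteValued

variable {Ω α : Type*} [MeasurableSpace Ω] [Fintype α] {P : Measure Ω} {Y : Ω → α}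

theorem eq_sum_indicator {Ω α : Type*} [Fintype α] (Y : Ω → α) (ψ : α → Ω → ℝ) :
    (fun ω => ψ (Y ω) ω) = fun ω => ∑ a, {ω | Y ω = a}.indicator (ψ a) ω := by
  classical
  funext ω
  simp [Set.indicator_apply]

/-- The condition is on restricted measures, so values taken with probability zero impose nothing.
-/
theorem memLp_finite_valued (hY : ∀ a, MeasurableSet {ω | Y ω = a}) {p : ℝ≥0∞} {ψ : α → Ω → ℝ}
    (hψ : ∀ a, MemLp (ψ a) p (P.restrict {ω | Y ω = a})) : MemLp (fun ω => ψ (Y ω) ω) p P := by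
  rw [eq_sum_indicator]
  exact memLp_finsetSum _ fun a _ => (memLp_indicator_iff_restrict (hY a)).mpr (hψ a)

theorem integrable_finite_valued (hY : ∀ a, MeasurableSet {ω | Y ω = a}) {ψ : α → Ω → ℝ}
    (hψ : ∀ a, IntegrableOn (ψ a) {ω | Y ω = a} P) : Integrable (fun ω => ψ (Y ω) ω) P :=
  memLp_one_iff_integrable.mp (memLp_finite_valued hY fun a => memLp_one_iff_integrable.mpr (hψ a))

theorem integral_finite_valued (hY : ∀ a, MeasurableSet {ω | Y ω = a}) {ψ : α → Ω → ℝ}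
    (hψ : ∀ a, IntegrableOn (ψ a) {ω | Y ω = a} P) :
    ∫ ω, ψ (Y ω) ω ∂P = ∑ a, ∫ ω in {ω | Y ω = a}, ψ a ω ∂P := by
  rw [eq_sum_indicator, integral_finsetSum _ fun a _ => (integrable_indicator_iff (hY a)).mpr (hψ a)]
  exact Finset.sum_congr rfl fun a _ => integral_indicator (hY a)

end FiniteValued

end ICUDO

/-! ### Law of the sampling outcome given data and groups; unbiasedness -/

namespace DebiasedICUDO

open ICUDO

variable {K : ℕ} {d : Fin K → ℕ} {F : Fin K → Measure ℝ} {t : ℕ} (D : DebiasedICUDO.{u} d F t)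

/-- The groups, the level permutations and the drawn tuples. -/
abbrev Outcome : Type :=
  ((k : Fin K) → Fin (D.n k) → Fin D.L) × (Pos d → Equiv.Perm (Fin D.L)) × (Fin D.m → Tuple d D.n)

/-- The realized groups, level permutations and drawn tuples. -/
def outcome (ω : D.Ω) : D.Outcome := (D.c ω, D.π ω, D.η ω)

theorem setOf_outcome_eq (y : D.Outcome) :
    {ω | D.outcome ω = y} = {ω | D.c ω = y.1} ∩ ({ω | D.π ω = y.2.1} ∩ {ω | D.η ω = y.2.2}) := by
  ext ω
  simp [outcome, Prod.ext_iff]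

theorem measurableSet_outcome (y : D.Outcome) : MeasurableSet {ω | D.outcome ω = y} := by
  rw [D.setOf_outcome_eq]
  exact (D.c_measurable _).inter ((D.π_measurable _).inter (D.η_measurable _))

/-- The conditional probability of the level permutations and the drawn tuples. -/
noncomputable def outcomeWeight (y : D.Outcome) : ℝ≥0∞ :=
  (Fintype.card (Pos d → Equiv.Perm (Fin D.L)) : ℝ≥0∞)⁻¹ *
    ∏ i, uniformProb (gridStar y.1 (permuteLevels D.A₀ y.2.1 i)) (y.2.2 i)

/-- Conditional independence as an identity of measures: once the groups are fixed, permutations and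
draws have a law that does not depend on the data. -/
theorem map_restrict_outcome (y : D.Outcome) :
    (D.P.restrict {ω | D.outcome ω = y}).map D.X =
      D.outcomeWeight y • (D.P.restrict {ω | D.c ω = y.1}).map D.X := by
  ext B hB
  have hX := D.X_measurable hB
  rw [Measure.smul_apply, Measure.map_apply D.X_measurable hB, Measure.map_apply D.X_measurable hB,
    Measure.restrict_apply hX, Measure.restrict_apply hX]
  have h1 := D.η_law B y.1 y.2.1 y.2.2 hB
  rw [D.π_law B y.1 y.2.1 hB] at h1
  have h2 : D.X ⁻¹' B ∩ {ω | D.outcome ω = y} =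
      {ω | D.X ω ∈ B ∧ D.c ω = y.1 ∧ D.π ω = y.2.1 ∧ D.η ω = y.2.2} := by
    rw [D.setOf_outcome_eq]; rfl
  have h3 : D.X ⁻¹' B ∩ {ω | D.c ω = y.1} = {ω | D.X ω ∈ B ∧ D.c ω = y.1} := rfl
  rw [h2, h3, h1, outcomeWeight, smul_eq_mul]
  ring

theorem setIntegral_outcome (y : D.Outcome) {f : (Pos D.n → ℝ) → ℝ} (hf : Measurable f) :
    ∫ ω in {ω | D.outcome ω = y}, f (D.X ω) ∂D.P =
      (D.outcomeWeight y).toReal * ∫ ω in {ω | D.c ω = y.1}, f (D.X ω) ∂D.P := by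
  rw [← integral_map D.X_measurable.aemeasurable hf.aestronglyMeasurable,
    ← integral_map D.X_measurable.aemeasurable hf.aestronglyMeasurable, D.map_restrict_outcome,
    integral_smul_measure, smul_eq_mul]

theorem uniformProb_eq_zero {α : Type} {S : Finset α} {e : α} (h : e ∉ S) :
    uniformProb S e = 0 := if_neg h

theorem outcomeWeight_eq_zero {y : D.Outcome} {i : Fin D.m} (h : y.2.2 i ∉ S0star d D.n) :
    D.outcomeWeight y = 0 := by
  rw [outcomeWeight, Finset.prod_eq_zero (Finset.mem_univ i), mul_zero]
  exact uniformProb_eq_zero fun h' => h (mem_gridStar.mp h').1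

theorem measure_outcome (y : D.Outcome) :
    D.P {ω | D.outcome ω = y} = D.outcomeWeight y * D.P {ω | D.c ω = y.1} := by
  have h := congrArg (fun μ => μ Set.univ) (D.map_restrict_outcome y)
  simpa [Measure.map_apply D.X_measurable MeasurableSet.univ] using h

/-- Square integrability of g says nothing about arguments with a repeated unit; such outcomes are
null and can be discarded. -/
theorem restrict_outcome_eq_zero {y : D.Outcome} {i : Fin D.m} (h : y.2.2 i ∉ S0star d D.n) :
    D.P.restrict {ω | D.outcome ω = y} = 0 := by
  rw [Measure.restrict_eq_zero, measure_outcome, D.outcomeWeight_eq_zero h, zero_mul]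

theorem toReal_outcomeWeight (y : D.Outcome) : (D.outcomeWeight y).toReal =
    (Fintype.card (Pos d → Equiv.Perm (Fin D.L)) : ℝ)⁻¹ *
      ∏ i, drawWeight y.1 (permuteLevels D.A₀ y.2.1 i) (y.2.2 i) := by
  simp [outcomeWeight, drawWeight, ENNReal.toReal_mul, ENNReal.toReal_prod]

theorem levels_ne_zero : Fintype.card (Pos d) = 0 ∨ D.L ≠ 0 := by
  by_cases h : IsEmpty (Pos d)
  · exact Or.inl (Fintype.card_eq_zero_iff.mpr h)
  · right
    obtain ⟨p⟩ := not_isEmpty_iff.mp h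
    have := (D.A₀ ⟨0, D.m_pos⟩ p).pos
    omega

/-- The groups that occur with positive probability leave no cell empty. -/
theorem gridStar_nonempty {c₀ : (k : Fin K) → Fin (D.n k) → Fin D.L}
    (hc : D.P {ω | D.c ω = c₀} ≠ 0) (b : Pos d → Fin D.L) : (gridStar c₀ b).Nonempty := by
  by_contra hb
  rw [Finset.not_nonempty_iff_eq_empty] at hb
  let i₀ : Fin D.m := ⟨0, D.m_pos⟩
  -- These swaps move row `i₀` into the cell `b`. If that cell were empty, `uniformProb` would
  -- vanish on it and the event c = c₀, π = p₀ would be null, although it has a positive fraction of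
  -- the probability of c = c₀.
  let p₀ : Pos d → Equiv.Perm (Fin D.L) := fun p => Equiv.swap (D.A₀ i₀ p) (b p)
  have hrow : permuteLevels D.A₀ p₀ i₀ = b := by
    funext p; simp [permuteLevels, p₀]
  have h1 := D.π_law Set.univ c₀ p₀ MeasurableSet.univ
  have h2 : {ω | D.X ω ∈ Set.univ ∧ D.c ω = c₀ ∧ D.π ω = p₀} =
      ⋃ e, {ω | D.outcome ω = (c₀, p₀, e)} := by
    ext ω
    simp [outcome, Prod.ext_iff]
  have h3 : D.P {ω | D.X ω ∈ Set.univ ∧ D.c ω = c₀ ∧ D.π ω = p₀} = 0 := by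
    rw [h2, measure_iUnion_null_iff]
    intro e
    rw [measure_outcome, outcomeWeight, Finset.prod_eq_zero (Finset.mem_univ i₀), mul_zero,
      zero_mul]
    refine uniformProb_eq_zero ?_
    simp [hrow, hb]
  rw [h3] at h1
  have h4 : (Fintype.card (Pos d → Equiv.Perm (Fin D.L)) : ℝ≥0∞)⁻¹ ≠ 0 :=
    ENNReal.inv_ne_zero.mpr (ENNReal.natCast_ne_top _)
  have h5 := (mul_eq_zero.mp h1.symm).resolve_right h4
  simp only [Set.mem_univ, true_and] at h5
  exact hc h5

theorem card_S0star_ne_zero : ((S0star d D.n).card : ℝ) ≠ 0 := by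
  by_contra h
  have hS : S0star d D.n = ∅ := by simpa using h
  have hc : ∀ c₀, D.P {ω | D.c ω = c₀} = 0 := by
    intro c₀
    by_contra hc₀
    have b : Pos d → Fin D.L := D.A₀ ⟨0, D.m_pos⟩
    obtain ⟨η, hη⟩ := D.gridStar_nonempty hc₀ b
    have := (mem_gridStar.mp hη).1
    simp [hS] at this
  have h1 : D.P Set.univ = 0 := by
    have : (Set.univ : Set D.Ω) = ⋃ c₀, {ω | D.c ω = c₀} := by ext; simp
    rw [this, measure_iUnion_null_iff]
    exact hc
  simp at h1

/-- Averages over permutations and draws are taken inside, with groups and data fixed, so that the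
exact conditional identities apply. Integrability is needed only along tuples without repeated
units. -/
theorem integral_outcome (φ : D.Outcome → (Pos D.n → ℝ) → ℝ) (hφ : ∀ y, Measurable (φ y))
    (hint : ∀ y : D.Outcome, (∀ i, y.2.2 i ∈ S0star d D.n) →
      Integrable (fun ω => φ y (D.X ω)) D.P) :
    ∫ ω, φ (D.outcome ω) (D.X ω) ∂D.P = ∑ c₀, ∫ ω in {ω | D.c ω = c₀},
      (Fintype.card (Pos d → Equiv.Perm (Fin D.L)) : ℝ)⁻¹ * ∑ π : Pos d → Equiv.Perm (Fin D.L),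
        ∑ e : Fin D.m → Tuple d D.n, (∏ i, drawWeight c₀ (permuteLevels D.A₀ π i) (e i)) *
          φ (c₀, π, e) (D.X ω) ∂D.P := by
  rw [integral_finite_valued (Y := D.outcome) (ψ := fun y ω => φ y (D.X ω))
    D.measurableSet_outcome, Fintype.sum_prod_type]
  · refine Finset.sum_congr rfl fun c₀ _ => ?_
    have hterm : ∀ (π : Pos d → Equiv.Perm (Fin D.L)) (e : Fin D.m → Tuple d D.n),
        Integrable (fun ω => (∏ i, drawWeight c₀ (permuteLevels D.A₀ π i) (e i)) *
          φ (c₀, π, e) (D.X ω)) (D.P.restrict {ω | D.c ω = c₀}) := by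
      intro π e
      by_cases he : ∀ i, e i ∈ S0star d D.n
      · exact ((hint (c₀, π, e) he).const_mul _).integrableOn
      · push Not at he
        obtain ⟨i, hi⟩ := he
        have : ∏ i, drawWeight c₀ (permuteLevels D.A₀ π i) (e i) = 0 := by
          refine Finset.prod_eq_zero (Finset.mem_univ i) ?_
          rw [drawWeight, uniformProb_eq_zero fun h' => hi (mem_gridStar.mp h').1]
          simp
        simp [this]
    rw [integral_const_mul, integral_finsetSum _ fun π _ =>
      integrable_finsetSum _ fun e _ => hterm π e, Fintype.sum_prod_type, Finset.mul_sum]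
    refine Finset.sum_congr rfl fun π _ => ?_
    rw [integral_finsetSum _ fun e _ => hterm π e, Finset.mul_sum]
    refine Finset.sum_congr rfl fun e _ => ?_
    rw [D.setIntegral_outcome _ (hφ _), toReal_outcomeWeight, integral_const_mul, mul_assoc]
  · intro y
    by_cases hy : ∀ i, y.2.2 i ∈ S0star d D.n
    · exact (hint y hy).integrableOn
    · push Not at hy
      obtain ⟨i, hi⟩ := hy
      simp [IntegrableOn, D.restrict_outcome_eq_zero hi]

theorem measurable_select {n : Fin K → ℕ} (η : Tuple d n) :
    Measurable fun x : Pos n → ℝ => select x η := by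
  unfold select; fun_prop

/-- The statistic as a function of the data and the outcome of the sampling. -/
noncomputable def statistic (g : (Pos d → ℝ) → ℝ) (y : D.Outcome) (x : Pos D.n → ℝ) : ℝ :=
  drawStatistic y.1 (permuteLevels D.A₀ y.2.1) y.2.2 fun η => g (select x η)

theorem Utilde_eq (g : (Pos d → ℝ) → ℝ) (ω : D.Ω) :
    D.Utilde g ω = D.statistic g (D.outcome ω) (D.X ω) := rfl

theorem measurable_statistic {g : (Pos d → ℝ) → ℝ} (hg : Measurable g) (y : D.Outcome) :
    Measurable (D.statistic g y) := by
  unfold statistic drawStatistic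
  refine Measurable.const_mul (Finset.measurable_sum _ fun i _ => Measurable.const_mul ?_ _) _
  exact hg.comp (measurable_select _)

theorem sum_setIntegral_groups {ψ : ((k : Fin K) → Fin (D.n k) → Fin D.L) → D.Ω → ℝ}
    (hψ : ∀ c₀, Integrable (ψ c₀) D.P) :
    ∑ c₀, ∫ ω in {ω | D.c ω = c₀}, ψ c₀ ω ∂D.P = ∫ ω, ψ (D.c ω) ω ∂D.P :=
  (integral_finite_valued D.c_measurable fun c₀ => (hψ c₀).integrableOn).symm

/-- The conditional identities need non-empty cells; groups with an empty cell form a null event. -/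
theorem setIntegral_groups_congr {c₀ : (k : Fin K) → Fin (D.n k) → Fin D.L} {φ ψ : D.Ω → ℝ}
    (h : (∀ b, (gridStar (d := d) c₀ b).Nonempty) → ∀ ω, φ ω = ψ ω) :
    ∫ ω in {ω | D.c ω = c₀}, φ ω ∂D.P = ∫ ω in {ω | D.c ω = c₀}, ψ ω ∂D.P := by
  by_cases hc : D.P {ω | D.c ω = c₀} = 0
  · rw [Measure.restrict_eq_zero.mpr hc]; simp
  · simp_rw [h (D.gridStar_nonempty hc)]

theorem mse_eq {T : D.Ω → ℝ} (hT : MemLp T 2 D.P) {θ : ℝ} (h : ∫ ω, T ω ∂D.P = θ) :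
    mse D.P T θ = ∫ ω, T ω ^ 2 ∂D.P - θ ^ 2 := by
  have hi := hT.integrable one_le_two
  have : ∀ ω, (T ω - θ) ^ 2 = T ω ^ 2 - (2 * θ * T ω - θ ^ 2) := fun ω => by ring
  simp_rw [mse, this]
  have hi2 : Integrable (fun ω => 2 * θ * T ω - θ ^ 2) D.P :=
    (hi.const_mul _).sub (integrable_const _)
  rw [integral_sub hT.integrable_sq hi2,
    integral_sub (hi.const_mul _) (integrable_const _), integral_const_mul, h]
  simp
  ring

variable [∀ k, IsProbabilityMeasure (F k)] {g : (Pos d → ℝ) → ℝ}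

theorem measurePreserving_select_X {η : Tuple d D.n} (hη : η ∈ S0star d D.n) :
    MeasurePreserving (fun ω => select (D.X ω) η) D.P (productLaw F d) :=
  (measurePreserving_select F (mem_S0star.mp hη)).comp ⟨D.X_measurable, D.X_law⟩

theorem memLp_select {a : (Pos d → ℝ) → ℝ} (ha : MemLp a 2 (productLaw F d)) {η : Tuple d D.n}
    (hη : η ∈ S0star d D.n) : MemLp (fun ω => a (select (D.X ω) η)) 2 D.P :=
  ha.comp_measurePreserving (D.measurePreserving_select_X hη)

theorem memLp_statistic (hg : MemLp g 2 (productLaw F d)) {y : D.Outcome}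
    (hy : ∀ i, y.2.2 i ∈ S0star d D.n) : MemLp (fun ω => D.statistic g y (D.X ω)) 2 D.P := by
  unfold statistic drawStatistic
  exact (memLp_finsetSum _ fun i _ => (D.memLp_select hg (hy i)).const_mul _).const_mul _

theorem memLp_Utilde (hg : MemLp g 2 (productLaw F d)) : MemLp (D.Utilde g) 2 D.P := by
  refine memLp_finite_valued (Y := D.outcome) (ψ := fun y ω => D.statistic g y (D.X ω))
    D.measurableSet_outcome fun y => ?_
  by_cases hy : ∀ i, y.2.2 i ∈ S0star d D.n
  · exact (D.memLp_statistic hg hy).restrict _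
  · push Not at hy
    obtain ⟨i, hi⟩ := hy
    simp [D.restrict_outcome_eq_zero hi]

theorem integral_select (hg : MemLp g 2 (productLaw F d)) {η : Tuple d D.n}
    (hη : η ∈ S0star d D.n) : ∫ ω, g (select (D.X ω) η) ∂D.P = theta F g :=
  integral_comp_of_measurePreserving (D.measurePreserving_select_X hη) hg.aestronglyMeasurable

theorem memLp_tupleMean (hg : MemLp g 2 (productLaw F d)) :
    MemLp (fun ω => tupleMean fun η : Tuple d D.n => g (select (D.X ω) η)) 2 D.P :=
  (memLp_finsetSum _ fun _ hη => D.memLp_select hg hη).const_mul _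

theorem integral_tupleMean (hg : MemLp g 2 (productLaw F d)) :
    ∫ ω, tupleMean (fun η : Tuple d D.n => g (select (D.X ω) η)) ∂D.P = theta F g := by
  unfold tupleMean
  rw [integral_const_mul, integral_finsetSum _ fun η hη =>
    (D.memLp_select hg hη).integrable one_le_two,
    Finset.sum_congr rfl fun η hη => D.integral_select hg hη, Finset.sum_const, nsmul_eq_mul,
    inv_mul_cancel_left₀ D.card_S0star_ne_zero]

theorem integral_Utilde (hgm : Measurable g) (hg : MemLp g 2 (productLaw F d)) :
    ∫ ω, D.Utilde g ω ∂D.P = theta F g := by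
  simp_rw [Utilde_eq]
  rw [D.integral_outcome _ (D.measurable_statistic hgm) fun y hy =>
    (D.memLp_statistic hg hy).integrable one_le_two]
  simp only [statistic]
  rw [Finset.sum_congr rfl fun c₀ _ => D.setIntegral_groups_congr fun hc ω =>
    conditional_mean hc D.levels_ne_zero D.m_pos D.A₀ fun η => g (select (D.X ω) η)]
  rw [D.sum_setIntegral_groups (ψ := fun _ ω => tupleMean fun η => g (select (D.X ω) η))
    fun _ => (D.memLp_tupleMean hg).integrable one_le_two, D.integral_tupleMean hg]

/-! ### The second moment -/

/-- The expected quadratic form. -/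
noncomputable def meanBlock (v : Finset (Pos d)) (a b : (Pos d → ℝ) → ℝ) : ℝ :=
  ∫ ω, blockForm (D.c ω) v (fun η => a (select (D.X ω) η)) (fun η => b (select (D.X ω) η)) ∂D.P

/-- The expected second moment of one weighted draw. -/
noncomputable def meanDraw (a : (Pos d → ℝ) → ℝ) : ℝ :=
  ∫ ω, drawForm (D.c ω) (fun η => a (select (D.X ω) η)) ∂D.P

theorem integrable_blockForm {a b : (Pos d → ℝ) → ℝ} (ha : MemLp a 2 (productLaw F d))
    (hb : MemLp b 2 (productLaw F d)) (v : Finset (Pos d))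
    (c₀ : (k : Fin K) → Fin (D.n k) → Fin D.L) :
    Integrable (fun ω => blockForm c₀ v (fun η => a (select (D.X ω) η))
      (fun η => b (select (D.X ω) η))) D.P := by
  unfold blockForm
  exact (integrable_finsetSum _ fun η hη => integrable_finsetSum _ fun η' hη' =>
    ((D.memLp_select ha hη).integrable_mul (D.memLp_select hb hη')).mul_const _).const_mul _

theorem integrable_blockForm_c {a b : (Pos d → ℝ) → ℝ} (ha : MemLp a 2 (productLaw F d))
    (hb : MemLp b 2 (productLaw F d)) (v : Finset (Pos d)) :
    Integrable (fun ω => blockForm (D.c ω) v (fun η => a (select (D.X ω) η))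
      (fun η => b (select (D.X ω) η))) D.P :=
  integrable_finite_valued (ψ := fun c₀ ω => blockForm c₀ v (fun η => a (select (D.X ω) η))
      (fun η => b (select (D.X ω) η))) D.c_measurable
    fun c₀ => (D.integrable_blockForm ha hb v c₀).integrableOn

theorem integrable_drawForm {a : (Pos d → ℝ) → ℝ} (ha : MemLp a 2 (productLaw F d))
    (c₀ : (k : Fin K) → Fin (D.n k) → Fin D.L) :
    Integrable (fun ω => drawForm c₀ (fun η => a (select (D.X ω) η))) D.P := by
  unfold drawForm
  exact (integrable_finsetSum _ fun η hη => ((D.memLp_select ha hη).integrable_sq).const_mul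
    _).const_mul _

theorem integrable_drawForm_c {a : (Pos d → ℝ) → ℝ} (ha : MemLp a 2 (productLaw F d)) :
    Integrable (fun ω => drawForm (D.c ω) (fun η => a (select (D.X ω) η))) D.P :=
  integrable_finite_valued (ψ := fun c₀ ω => drawForm c₀ fun η => a (select (D.X ω) η))
    D.c_measurable fun c₀ => (D.integrable_drawForm ha c₀).integrableOn

theorem integral_Utilde_sq (hgm : Measurable g) (hg : MemLp g 2 (productLaw F d))
    (hL : 2 ≤ D.L) :
    ∫ ω, D.Utilde g ω ^ 2 ∂D.P = (D.m : ℝ)⁻¹ * (D.meanDraw g - D.meanBlock Finset.univ g g +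
      ∑ u, tau D.A₀ u * moebiusSum (fun v => D.meanBlock v g g) u) := by
  have hM : ∀ (c₀ : (k : Fin K) → Fin (D.n k) → Fin D.L) u, Integrable (fun ω =>
      moebiusSum (fun v => blockForm c₀ v (fun η => g (select (D.X ω) η))
        fun η => g (select (D.X ω) η)) u) D.P := by
    intro c₀ u
    unfold moebiusSum
    exact integrable_finsetSum _ fun v _ => (D.integrable_blockForm hg hg v c₀).const_mul _
  have hMc : ∀ u, Integrable (fun ω => moebiusSum (fun v => blockForm (D.c ω) v
      (fun η => g (select (D.X ω) η)) fun η => g (select (D.X ω) η)) u) D.P := by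
    intro u
    unfold moebiusSum
    exact integrable_finsetSum _ fun v _ => (D.integrable_blockForm_c hg hg v).const_mul _
  simp_rw [Utilde_eq]
  rw [D.integral_outcome (fun y x => D.statistic g y x ^ 2)
    (fun y => (D.measurable_statistic hgm y).pow_const 2)
    fun y hy => (D.memLp_statistic hg hy).integrable_sq]
  simp only [statistic]
  rw [Finset.sum_congr rfl fun c₀ _ => D.setIntegral_groups_congr fun hc ω =>
    conditional_second_moment hc hL D.m_pos D.A₀ fun η => g (select (D.X ω) η)]
  rw [D.sum_setIntegral_groups (ψ := fun c₀ ω => (D.m : ℝ)⁻¹ *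
      (drawForm c₀ (fun η => g (select (D.X ω) η)) - blockForm c₀ Finset.univ
        (fun η => g (select (D.X ω) η)) (fun η => g (select (D.X ω) η)) +
        ∑ u, tau D.A₀ u * moebiusSum (fun v => blockForm c₀ v (fun η => g (select (D.X ω) η))
        fun η => g (select (D.X ω) η)) u))]
  · rw [integral_const_mul, integral_add, integral_sub, integral_finsetSum]
    · congr 2
      refine Finset.sum_congr rfl fun u _ => ?_
      rw [integral_const_mul]
      congr 1
      unfold moebiusSum
      rw [integral_finsetSum _ fun v _ => (D.integrable_blockForm_c hg hg v).const_mul _]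
      simp_rw [integral_const_mul]
      rfl
    · exact fun u _ => (hMc u).const_mul _
    · exact D.integrable_drawForm_c hg
    · exact D.integrable_blockForm_c hg hg _
    · exact (D.integrable_drawForm_c hg).sub (D.integrable_blockForm_c hg hg _)
    · exact integrable_finsetSum _ fun u _ => (hMc u).const_mul _
  · intro c₀
    exact (((D.integrable_drawForm hg c₀).sub (D.integrable_blockForm hg hg _ c₀)).add
      (integrable_finsetSum _ fun u _ => (hM c₀ u).const_mul _)).const_mul _

/-- The scaled excess of the mean squared error over that of the complete U-statistic. -/
theorem mse_sub_mse (hgm : Measurable g) (hgs : SymmetricKernel g)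
    (hg : MemLp g 2 (productLaw F d)) (hL : 2 ≤ D.L) :
    (D.m : ℝ) * (mse D.P (D.Utilde g) (theta F g) -
        mse D.P (fun ω => U0 g (D.X ω)) (theta F g)) =
      D.meanDraw g - D.meanBlock Finset.univ g g +
      ∑ u : Finset (Pos d) with t < u.card,
        tau D.A₀ u * moebiusSum (fun v => D.meanBlock v g g) u := by
  have hm : (D.m : ℝ) ≠ 0 := by exact_mod_cast D.m_pos.ne'
  simp_rw [U0_eq_tupleMean hgs]
  rw [D.mse_eq (D.memLp_Utilde hg) (D.integral_Utilde hgm hg),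
    D.mse_eq (D.memLp_tupleMean hg) (D.integral_tupleMean hg), D.integral_Utilde_sq hgm hg hL]
  have h0 : ∫ ω, tupleMean (fun η : Tuple d D.n => g (select (D.X ω) η)) ^ 2 ∂D.P =
      D.meanBlock ∅ g g := by
    simp_rw [meanBlock, blockForm_empty]
  -- Since `tau` is m at ∅, that term is m times the second moment of U₀; the sets with 1 ≤ |u| ≤ t
  -- drop out by strength.
  have hsum : ∑ u, tau D.A₀ u * moebiusSum (fun v => D.meanBlock v g g) u =
      D.m * D.meanBlock ∅ g g + ∑ u : Finset (Pos d) with t < u.card,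
        tau D.A₀ u * moebiusSum (fun v => D.meanBlock v g g) u := by
    rw [Finset.sum_filter, ← Finset.add_sum_erase _ _ (Finset.mem_univ (∅ : Finset (Pos d))),
      ← Finset.add_sum_erase Finset.univ (fun u : Finset (Pos d) => if t < u.card then
        tau D.A₀ u * moebiusSum (fun v => D.meanBlock v g g) u else 0)
        (Finset.mem_univ (∅ : Finset (Pos d))), tau_empty]
    simp only [Finset.card_empty, Nat.not_lt_zero, if_false, zero_add]
    congr 1
    · simp [moebiusSum]
    · refine Finset.sum_congr rfl fun u hu => ?_
      split_ifs with hut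
      · rfl
      · rw [D.orthogonal.tau_eq_zero (not_lt.mp hut) (Finset.mem_erase.mp hu).1, zero_mul]
  rw [h0, hsum]
  field_simp
  ring

end DebiasedICUDO

namespace ICUDO

/-! ### Counting tuples -/

section Counting

/-- Resampling one coordinate reaches every tuple once for each old value of that coordinate. -/
theorem sum_update {ι : Type*} [Fintype ι] [DecidableEq ι] {α : ι → Type*} [∀ i, Fintype (α i)]
    (p : ι) (f : (∀ i, α i) → ℝ) :
    ∑ e, ∑ z, f (Function.update e p z) = Fintype.card (α p) * ∑ e, f e := by
  have h1 : ∀ F : (∀ i, α i) → ℝ, ∑ e, F e =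
      ∑ q : α p × (∀ j : {j // j ≠ p}, α j), F ((Equiv.piSplitAt p α).symm q) :=
    fun F => (Equiv.sum_comp (Equiv.piSplitAt p α).symm F).symm
  have h2 : ∀ (q : α p × (∀ j : {j // j ≠ p}, α j)) (z : α p),
      Function.update ((Equiv.piSplitAt p α).symm q) p z = (Equiv.piSplitAt p α).symm (z, q.2) := by
    intro q z
    funext j
    by_cases hj : j = p
    · subst hj; simp
    · simp [hj]
  rw [h1, h1 f, Fintype.sum_prod_type, Fintype.sum_prod_type]
  simp_rw [h2]
  rw [Finset.sum_comm (γ := α p)]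
  simp_rw [Finset.sum_const, Finset.card_univ, nsmul_eq_mul]
  rw [← Finset.mul_sum, Finset.sum_comm]

theorem sum_mul_of_sum_eq_card {ι : Type*} [Fintype ι] [DecidableEq ι] {α : ι → Type*}
    [∀ i, Fintype (α i)] {p : ι} {φ : α p → ℝ} (hφ : ∑ z, φ z = Fintype.card (α p))
    {f : (∀ i, α i) → ℝ} (hf : ∀ e z, f (Function.update e p z) = f e) :
    ∑ e, φ (e p) * f e = ∑ e, f e := by
  rcases isEmpty_or_nonempty (α p) with h | h
  · have : IsEmpty (∀ i, α i) := ⟨fun e => h.elim (e p)⟩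
    simp
  · have h0 : (Fintype.card (α p) : ℝ) ≠ 0 := by exact_mod_cast Fintype.card_ne_zero
    rw [← mul_right_inj' h0, ← sum_update p fun e => φ (e p) * f e]
    simp_rw [Function.update_self, hf, ← Finset.sum_mul, hφ, ← Finset.mul_sum]

variable {K L : ℕ} {d n : Fin K → ℕ}

theorem sum_tuple (f : Tuple d n → ℝ) :
    ∑ η, f η = ∑ e : (p : Pos d) → Fin (n p.1), f fun k j => e ⟨k, j⟩ :=
  (Equiv.sum_comp (Equiv.piCurry fun (k : Fin K) (_ : Fin (d k)) => Fin (n k)) f).symm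

theorem sum_eps_group {c : (k : Fin K) → Fin (n k) → Fin L}
    (hc : ∀ k l, Fintype.card {i : Fin (n k) // c k i = l} * L = n k) (k : Fin K) (l : Fin L) :
    ∑ z, eps l (c k z) = n k := by
  simp only [eps, eq_comm (a := l)]
  rw [← Finset.sum_filter, Finset.sum_const, ← Fintype.card_subtype, nsmul_eq_mul]
  exact_mod_cast hc k l

/-- Summing out positions whose group is prescribed. -/
theorem sum_prod_eps_mul {c : (k : Fin K) → Fin (n k) → Fin L}
    (hc : ∀ k l, Fintype.card {i : Fin (n k) // c k i = l} * L = n k) (v : Finset (Pos d))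
    (a : Pos d → Fin L) {f : Tuple d n → ℝ}
    (hf : ∀ η η' : Tuple d n, (∀ p ∉ v, η p.1 p.2 = η' p.1 p.2) → f η = f η') :
    ∑ η, (∏ p ∈ v, eps (a p) (levels c η p)) * f η = ∑ η, f η := by
  rw [sum_tuple, sum_tuple]
  obtain ⟨f', hf'⟩ : ∃ f' : ((p : Pos d) → Fin (n p.1)) → ℝ, ∀ e,
      f' e = f fun k j => e ⟨k, j⟩ := ⟨_, fun _ => rfl⟩
  have hind : ∀ p ∈ v, ∀ e z, f' (Function.update e p z) = f' e := by
    intro p hp e z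
    rw [hf', hf']
    refine hf _ _ fun q hq => ?_
    exact Function.update_of_ne (fun h : q = p => hq (h ▸ hp)) _ _
  simp_rw [← hf', levels]
  clear hf' hf
  induction v using Finset.induction_on with
  | empty => simp
  | insert p v hp ih =>
    rw [← ih fun q hq => hind q (Finset.mem_insert_of_mem hq)]
    simp_rw [Finset.prod_insert hp, mul_assoc]
    refine sum_mul_of_sum_eq_card (α := fun p : Pos d => Fin (n p.1)) (p := p)
      (φ := fun z : Fin (n p.1) => eps (a p) (c p.1 z)) ?_ ?_
    · rw [sum_eps_group hc, Fintype.card_fin]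
    · intro e z
      rw [hind p (Finset.mem_insert_self _ _)]
      congr 1
      refine Finset.prod_congr rfl fun q hq => ?_
      rw [Function.update_of_ne fun h : q = p => hp (h ▸ hq)]

theorem sum_prod_eps {c : (k : Fin K) → Fin (n k) → Fin L}
    (hc : ∀ k l, Fintype.card {i : Fin (n k) // c k i = l} * L = n k) (v : Finset (Pos d))
    (a : Pos d → Fin L) :
    ∑ η : Tuple d n, ∏ p ∈ v, eps (a p) (levels c η p) = Fintype.card (Tuple d n) := by
  have := sum_prod_eps_mul hc v a (f := fun _ => 1) fun _ _ _ => rfl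
  simpa using this

open scoped Classical in
/-- Union bound for repeated units. -/
theorem card_collisions_le {ι : Type*} [Fintype ι] [DecidableEq ι] (κ : ι → Fin K) {M : ℕ} (hM : ∀ k, M ≤ n k) :
    (M : ℝ) * ∑ e : (j : ι) → Fin (n (κ j)),
      (if Function.Injective fun j => (⟨κ j, e j⟩ : Pos n) then (0 : ℝ) else 1) ≤
      (Fintype.card ι : ℝ) ^ 2 * Fintype.card ((j : ι) → Fin (n (κ j))) := by
  have h1 : ∀ e : (j : ι) → Fin (n (κ j)),
      (if Function.Injective fun j => (⟨κ j, e j⟩ : Pos n) then (0 : ℝ) else 1) ≤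
      ∑ j, ∑ j', if j ≠ j' ∧ (⟨κ j, e j⟩ : Pos n) = ⟨κ j', e j'⟩ then (1 : ℝ) else 0 := by
    intro e
    have hnn : ∀ j j', (0 : ℝ) ≤ if j ≠ j' ∧ (⟨κ j, e j⟩ : Pos n) = ⟨κ j', e j'⟩
        then (1 : ℝ) else 0 := by intro j j'; split_ifs <;> norm_num
    split_ifs with h
    · exact Finset.sum_nonneg fun j _ => Finset.sum_nonneg fun j' _ => hnn j j'
    · simp only [Function.Injective] at h
      push Not at h
      obtain ⟨j, j', he, hj⟩ := h
      refine le_trans ?_ (Finset.single_le_sum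
        (fun j _ => Finset.sum_nonneg fun j' _ => hnn j j') (Finset.mem_univ j))
      refine le_trans ?_ (Finset.single_le_sum (fun j' _ => hnn j j') (Finset.mem_univ j'))
      rw [if_pos ⟨hj, he⟩]
  have h2 : ∀ j j', (M : ℝ) * ∑ e : (j : ι) → Fin (n (κ j)),
      (if j ≠ j' ∧ (⟨κ j, e j⟩ : Pos n) = ⟨κ j', e j'⟩ then (1 : ℝ) else 0) ≤
      Fintype.card ((j : ι) → Fin (n (κ j))) := by
    intro j j'
    by_cases hj : j = j'
    · simpa [hj] using Finset.prod_nonneg fun i _ => Nat.cast_nonneg _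
    -- Resample unit j: at most one of its n values equals the unit at j'.
    calc (M : ℝ) * ∑ e : (j : ι) → Fin (n (κ j)),
        (if j ≠ j' ∧ (⟨κ j, e j⟩ : Pos n) = ⟨κ j', e j'⟩ then (1 : ℝ) else 0)
        ≤ (Fintype.card (Fin (n (κ j))) : ℝ) * ∑ e : (j : ι) → Fin (n (κ j)),
        (if j ≠ j' ∧ (⟨κ j, e j⟩ : Pos n) = ⟨κ j', e j'⟩ then (1 : ℝ) else 0) := by
          refine mul_le_mul_of_nonneg_right ?_ (Finset.sum_nonneg fun e _ => ?_)
          · rw [Fintype.card_fin]; exact_mod_cast hM _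
          · split_ifs <;> norm_num
      _ = ∑ e : (j : ι) → Fin (n (κ j)), ∑ z : Fin (n (κ j)),
          (if (⟨κ j, z⟩ : Pos n) = ⟨κ j', e j'⟩ then (1 : ℝ) else 0) := by
          rw [← sum_update (α := fun j => Fin (n (κ j))) j]
          refine Finset.sum_congr rfl fun e _ => Finset.sum_congr rfl fun z _ => ?_
          simp [hj, Function.update_of_ne (Ne.symm hj)]
      _ ≤ ∑ e : (j : ι) → Fin (n (κ j)), 1 := by
          refine Finset.sum_le_sum fun e _ => ?_
          rw [← Finset.sum_filter, Finset.sum_const, nsmul_eq_mul, mul_one]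
          have : (Finset.univ.filter fun z : Fin (n (κ j)) =>
              (⟨κ j, z⟩ : Pos n) = ⟨κ j', e j'⟩).card ≤ 1 := by
            rw [Finset.card_le_one]
            intro z hz z' hz'
            have := (Finset.mem_filter.mp hz).2.trans (Finset.mem_filter.mp hz').2.symm
            simpa using this
          exact_mod_cast this
      _ = _ := by simp
  calc _ ≤ (M : ℝ) * ∑ e : (j : ι) → Fin (n (κ j)),
        ∑ j, ∑ j', (if j ≠ j' ∧ (⟨κ j, e j⟩ : Pos n) = ⟨κ j', e j'⟩ then (1 : ℝ) else 0) :=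
        mul_le_mul_of_nonneg_left (Finset.sum_le_sum fun e _ => h1 e) (by positivity)
    _ = ∑ j, ∑ j', (M : ℝ) * ∑ e : (j : ι) → Fin (n (κ j)),
        (if j ≠ j' ∧ (⟨κ j, e j⟩ : Pos n) = ⟨κ j', e j'⟩ then (1 : ℝ) else 0) := by
        rw [Finset.sum_comm, Finset.mul_sum]
        refine Finset.sum_congr rfl fun j _ => ?_
        rw [Finset.sum_comm, Finset.mul_sum]
    _ ≤ ∑ _j : ι, ∑ _j' : ι, (Fintype.card ((j : ι) → Fin (n (κ j))) : ℝ) :=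
        Finset.sum_le_sum fun j _ => Finset.sum_le_sum fun j' _ => h2 j j'
    _ = _ := by simp; ring

theorem card_tuple_eq : Fintype.card (Tuple d n) = Fintype.card ((p : Pos d) → Fin (n p.1)) :=
  (Fintype.card_congr (Equiv.piCurry fun (k : Fin K) (_ : Fin (d k)) => Fin (n k))).symm

open scoped Classical in
theorem card_sub_card_S0star_le {M : ℕ} (hM : ∀ k, M ≤ n k) :
    (M : ℝ) * (Fintype.card (Tuple d n) - (S0star d n).card) ≤
      (Fintype.card (Pos d) : ℝ) ^ 2 * Fintype.card (Tuple d n) := by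
  have h := card_collisions_le (fun p : Pos d => p.1) hM
  rw [← card_tuple_eq] at h
  refine le_trans (le_of_eq ?_) h
  congr 1
  have h1 : ((Fintype.card (Tuple d n) : ℝ) - (S0star d n).card) =
      ∑ η : Tuple d n, if η ∈ S0star d n then (0 : ℝ) else 1 := by
    have : ∀ η : Tuple d n, (if η ∈ S0star d n then (0 : ℝ) else 1) =
        1 - if η ∈ S0star d n then 1 else 0 := by intro η; split_ifs <;> norm_num
    simp [this]
  rw [h1, sum_tuple]
  refine Finset.sum_congr rfl fun e _ => ?_
  refine if_congr ?_ rfl rfl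
  rw [mem_S0star, ← units_injective]
  rfl

-- A pair of tuples is one tuple indexed by two copies of the positions; the constant is (2d)² =
-- 4d².
open scoped Classical in
theorem card_pair_collisions_le {M : ℕ} (hM : ∀ k, M ≤ n k) :
    (M : ℝ) * ∑ η : Tuple d n, ∑ η' : Tuple d n,
      (if Function.Injective (Sum.elim (units η) (units η')) then (0 : ℝ) else 1) ≤
      4 * (Fintype.card (Pos d) : ℝ) ^ 2 * (Fintype.card (Tuple d n) : ℝ) ^ 2 := by
  have h := card_collisions_le (Sum.elim (fun p : Pos d => p.1) fun p : Pos d => p.1) hM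
  let E := Equiv.sumPiEquivProdPi fun j : Pos d ⊕ Pos d =>
    Fin (n (Sum.elim (fun p : Pos d => p.1) (fun p : Pos d => p.1) j))
  let C := Equiv.piCurry fun (k : Fin K) (_ : Fin (d k)) => Fin (n k)
  rw [Fintype.card_congr (E.trans (C.prodCongr C)), Fintype.card_prod, Fintype.card_sum] at h
  rw [← Equiv.sum_comp E.symm, Fintype.sum_prod_type] at h
  simp_rw [sum_tuple]
  refine le_trans (le_of_eq ?_) (h.trans (le_of_eq ?_))
  · congr 1
    refine Finset.sum_congr rfl fun e _ => Finset.sum_congr rfl fun e' _ => ?_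
    have : (Sum.elim (units (d := d) (n := n) fun k j => e ⟨k, j⟩) (units fun k j => e' ⟨k, j⟩)) =
        fun j => (⟨Sum.elim (fun p : Pos d => p.1) (fun p : Pos d => p.1) j,
          E.symm (e, e') j⟩ : Pos n) := by
      funext j
      cases j <;> rfl
    rw [this]
  · push_cast
    ring

end Counting

/-! ### Bounds for the quadratic forms, given the data and the groups -/

section Bounds

variable {K L : ℕ} {d n : Fin K → ℕ}

/-- The values of `φ` at the data in group `l` of sample `k` spread over a range of at least
`δ`. -/
def IsWide (x : Pos n → ℝ) (c : (k : Fin K) → Fin (n k) → Fin L) (φ : ℝ → ℝ) (δ : ℝ) (k : Fin K)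
    (l : Fin L) : Prop :=
  ∃ i i', c k i = l ∧ c k i' = l ∧ δ ≤ φ (x ⟨k, i'⟩) - φ (x ⟨k, i⟩)

-- Groups are ordered and φ is monotone, so the ranges of φ over different groups do not overlap.
-- Each wide group therefore raises the integer part of its upper value, in units of δ, by at least
-- one, and |φ| ≤ B leaves boundedly many such integers, however large L is.
open scoped Classical in
theorem card_isWide_le {x : Pos n → ℝ} {c : (k : Fin K) → Fin (n k) → Fin L}
    (hx : IsOrderedPartition x c) {φ : ℝ → ℝ} (hφ : Monotone φ) {B : ℝ} (hB : ∀ y, |φ y| ≤ B)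
    {δ : ℝ} (hδ : 0 < δ) (k : Fin K) :
    (Finset.univ.filter fun l => IsWide x c φ δ k l).card ≤
      (Finset.Icc ⌊-B / δ⌋ ⌊B / δ⌋).card := by
  -- The value 0 at levels that are not wide plays no role: injectivity is needed on wide levels
  -- only.
  let top : Fin L → ℤ := fun l => if h : IsWide x c φ δ k l
    then ⌊φ (x ⟨k, h.choose_spec.choose⟩) / δ⌋ else 0
  refine Finset.card_le_card_of_injOn top ?_ ?_
  · intro l hl
    have h := (Finset.mem_filter.mp hl).2
    simp only [top, dif_pos h, Finset.coe_Icc, Set.mem_Icc]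
    have h1 := abs_le.mp (hB (x ⟨k, h.choose_spec.choose⟩))
    constructor
    · exact Int.floor_le_floor (by gcongr; exact h1.1)
    · exact Int.floor_le_floor (by gcongr; exact h1.2)
  · have key : ∀ l l' : Fin L, IsWide x c φ δ k l → IsWide x c φ δ k l' → l < l' →
        top l < top l' := by
      intro l l' h h' hl
      simp only [top, dif_pos h, dif_pos h']
      obtain ⟨-, h2, -⟩ := h.choose_spec.choose_spec
      obtain ⟨h3, -, h5⟩ := h'.choose_spec.choose_spec
      have h6 : x ⟨k, h.choose_spec.choose⟩ ≤ x ⟨k, h'.choose⟩ :=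
        hx.2 k _ _ (by rw [h2, h3]; exact hl)
      have h7 := hφ h6
      rw [← Int.add_one_le_iff, Int.le_floor]
      push_cast
      calc (⌊φ (x ⟨k, h.choose_spec.choose⟩) / δ⌋ : ℝ) + 1
          ≤ φ (x ⟨k, h.choose_spec.choose⟩) / δ + 1 := by gcongr; exact Int.floor_le _
        _ = (φ (x ⟨k, h.choose_spec.choose⟩) + δ) / δ := by field_simp
        _ ≤ _ := by gcongr; linarith
    intro l hl l' hl' heq
    have h := (Finset.mem_filter.mp hl).2
    have h' := (Finset.mem_filter.mp hl').2
    rcases lt_trichotomy l l' with hlt | rfl | hgt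
    · exact absurd heq (key l l' h h' hlt).ne
    · rfl
    · exact absurd heq.symm (key l' l h' h hgt).ne

/-- The block form over all tuples, with or without repeated units. -/
noncomputable def fullForm (c : (k : Fin K) → Fin (n k) → Fin L) (v : Finset (Pos d))
    (h : Tuple d n → ℝ) : ℝ :=
  ((Fintype.card (Tuple d n) : ℝ) ^ 2)⁻¹ * ∑ η : Tuple d n, ∑ η' : Tuple d n,
    h η * h η' * ∏ p ∈ v, eps (levels c η p) (levels c η' p)

/-- The average of `f(x_η) f(y)` over all pairs of tuples, where `y` has the coordinates in `v` from
the first and the others from the second tuple. -/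
noncomputable def mixedForm (v : Finset (Pos d)) (f : (Pos d → ℝ) → ℝ) (x : Pos n → ℝ) : ℝ :=
  ((Fintype.card (Tuple d n) : ℝ) ^ 2)⁻¹ * ∑ η : Tuple d n, ∑ η' : Tuple d n,
    f (select x η) * f (mix v (select x η) (select x η'))

theorem prod_eps_nonneg (c : (k : Fin K) → Fin (n k) → Fin L) (v : Finset (Pos d))
    (η η' : Tuple d n) : 0 ≤ ∏ p ∈ v, eps (levels c η p) (levels c η' p) :=
  Finset.prod_nonneg fun _ _ => eps_nonneg _ _

theorem sum_prod_eps' {c : (k : Fin K) → Fin (n k) → Fin L}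
    (hc : ∀ k l, Fintype.card {i : Fin (n k) // c k i = l} * L = n k) (v : Finset (Pos d))
    (η' : Tuple d n) :
    ∑ η : Tuple d n, ∏ p ∈ v, eps (levels c η p) (levels c η' p) =
      Fintype.card (Tuple d n) := by
  rw [← sum_prod_eps hc v (levels c η')]
  exact Finset.sum_congr rfl fun η _ => Finset.prod_congr rfl fun p _ => eps_comm _ _

-- At each position every level carries a fraction 1/L of the tuples, so the boundedly many wide
-- levels carry O(1/L).
open scoped Classical in
theorem sum_isWide_le {x : Pos n → ℝ} {c : (k : Fin K) → Fin (n k) → Fin L}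
    (hx : IsOrderedPartition x c) {φ : ℝ → ℝ} (hφ : Monotone φ) {B : ℝ} (hB : ∀ y, |φ y| ≤ B)
    {δ : ℝ} (hδ : 0 < δ) (p : Pos d) :
    (L : ℝ) * ∑ η : Tuple d n, (if IsWide x c φ δ p.1 (levels c η p) then (1 : ℝ) else 0) ≤
      (Finset.Icc ⌊-B / δ⌋ ⌊B / δ⌋).card * Fintype.card (Tuple d n) := by
  have h1 : ∀ η : Tuple d n, (L : ℝ) *
      (if IsWide x c φ δ p.1 (levels c η p) then (1 : ℝ) else 0) =
      ∑ l : Fin L with IsWide x c φ δ p.1 l, eps l (levels c η p) := by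
    intro η
    simp [eps, Finset.sum_ite_eq']
  rw [Finset.mul_sum]
  simp_rw [h1]
  rw [Finset.sum_comm]
  have h2 : ∀ l : Fin L, ∑ η : Tuple d n, eps l (levels c η p) = Fintype.card (Tuple d n) := by
    intro l
    have := sum_prod_eps (d := d) hx.1 {p} fun _ => l
    simpa using this
  simp_rw [h2]
  rw [Finset.sum_const, nsmul_eq_mul]
  gcongr
  exact card_isWide_le hx hφ hB hδ p.1

/-- Where two tuples share their groups on v, replacing the v-coordinates of the second argument by
those of the first moves φ by less than δ, unless a group is wide. Wide groups are rare and cost at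
most 2M each time. -/
theorem abs_fullForm_sub_mixedForm_le {x : Pos n → ℝ} {c : (k : Fin K) → Fin (n k) → Fin L}
    (hx : IsOrderedPartition x c) {φ : ℝ → ℝ} (hφ : Monotone φ) {B : ℝ} (hB : ∀ y, |φ y| ≤ B)
    {δ : ℝ} (hδ : 0 < δ) {f : (Pos d → ℝ) → ℝ} {M : ℝ} (hM : ∀ y, |f y| ≤ M) {ε : ℝ}
    (hε : ∀ y z : Pos d → ℝ, (∀ p, |φ (y p) - φ (z p)| < δ) → |f y - f z| ≤ ε) (hε0 : 0 ≤ ε)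
    (hL : 0 < L) (hN : 0 < Fintype.card (Tuple d n)) (v : Finset (Pos d)) :
    |fullForm c v (fun η => f (select x η)) - mixedForm v f x| ≤
      M * (ε + 2 * M * (Fintype.card (Pos d) * (Finset.Icc ⌊-B / δ⌋ ⌊B / δ⌋).card / L)) := by
  classical
  have hM0 : 0 ≤ M := (abs_nonneg _).trans (hM 0)
  have hN0 : (0 : ℝ) < Fintype.card (Tuple d n) := by exact_mod_cast hN
  have hL0 : (0 : ℝ) < L := by exact_mod_cast hL
  set N : ℝ := (Fintype.card (Tuple d n) : ℝ) with hNdef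
  set W : Tuple d n → ℝ := fun η =>
    ∑ p, if IsWide x c φ δ p.1 (levels c η p) then (1 : ℝ) else 0 with hW
  have hW0 : ∀ η, 0 ≤ W η := fun η => Finset.sum_nonneg fun p _ => by split_ifs <;> norm_num
  -- The summand does not see the units of η' at the positions v, and for equal group sizes the
  -- product of the `eps` averages to one over those units. Hence both forms can be compared under
  -- the same weights.
  have hmix : ∀ η : Tuple d n, ∑ η' : Tuple d n,
      f (select x η) * f (mix v (select x η) (select x η')) =
      ∑ η' : Tuple d n, (∏ p ∈ v, eps (levels c η p) (levels c η' p)) *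
        (f (select x η) * f (mix v (select x η) (select x η'))) := by
    intro η
    refine (sum_prod_eps_mul hx.1 v (levels c η)
      (f := fun η' => f (select x η) * f (mix v (select x η) (select x η'))) ?_).symm
    intro η₁ η₂ h
    congr 2
    funext p
    unfold mix
    split_ifs with hp
    · rfl
    · simp only [select, h p hp]
  have hpt : ∀ η η' : Tuple d n,
      |f (select x η) * f (select x η') * (∏ p ∈ v, eps (levels c η p) (levels c η' p)) -
        (∏ p ∈ v, eps (levels c η p) (levels c η' p)) *
        (f (select x η) * f (mix v (select x η) (select x η')))| ≤
      (∏ p ∈ v, eps (levels c η p) (levels c η' p)) * (M * (ε + 2 * M * W η)) := by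
    intro η η'
    have heq : f (select x η) * f (select x η') *
        (∏ p ∈ v, eps (levels c η p) (levels c η' p)) -
        (∏ p ∈ v, eps (levels c η p) (levels c η' p)) *
        (f (select x η) * f (mix v (select x η) (select x η'))) =
        (∏ p ∈ v, eps (levels c η p) (levels c η' p)) * (f (select x η) *
          (f (select x η') - f (mix v (select x η) (select x η')))) := by ring
    rw [heq, abs_mul, abs_of_nonneg (prod_eps_nonneg c v η η'), abs_mul]
    by_cases hagree : ∀ p ∈ v, levels c η p = levels c η' p
    swap
    · push Not at hagree
      obtain ⟨p, hp, hne⟩ := hagree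
      rw [Finset.prod_eq_zero hp (if_neg hne)]
      simp
    refine mul_le_mul_of_nonneg_left ?_ (prod_eps_nonneg c v η η')
    refine mul_le_mul (hM _) ?_ (abs_nonneg _) hM0
    -- With a wide group, `W η ≥ 1` and the trivial bound 2M is charged to it.
    by_cases hwide : ∃ p, IsWide x c φ δ p.1 (levels c η p)
    · obtain ⟨p, hp⟩ := hwide
      have h1 : 1 ≤ W η := by
        refine le_trans ?_ (Finset.single_le_sum
          (f := fun p : Pos d => if IsWide x c φ δ p.1 (levels c η p) then (1 : ℝ) else 0)
          (fun p _ => by split_ifs <;> norm_num) (Finset.mem_univ p))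
        rw [if_pos hp]
      have h2 := abs_sub (f (select x η')) (f (mix v (select x η) (select x η')))
      have h3 := hM (select x η')
      have h4 := hM (mix v (select x η) (select x η'))
      nlinarith
    · push Not at hwide
      have h1 : |f (select x η') - f (mix v (select x η) (select x η'))| ≤ ε := by
        refine hε _ _ fun p => ?_
        unfold mix
        split_ifs with hp
        · have hlev := hagree p hp
          have hw := hwide p
          by_contra hcon
          rw [not_lt, le_abs] at hcon
          refine hw ?_
          rcases hcon with hcon | hcon
          · exact ⟨η p.1 p.2, η' p.1 p.2, rfl, hlev.symm, hcon⟩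
          · exact ⟨η' p.1 p.2, η p.1 p.2, hlev.symm, rfl, by simpa [select] using hcon⟩
        · simpa using hδ
      have := mul_nonneg hM0 (hW0 η)
      linarith
  have hWsum : ∑ η, W η ≤ Fintype.card (Pos d) *
      ((Finset.Icc ⌊-B / δ⌋ ⌊B / δ⌋).card * N / L) := by
    rw [hW, Finset.sum_comm]
    calc _ ≤ ∑ _p : Pos d, ((Finset.Icc ⌊-B / δ⌋ ⌊B / δ⌋).card * N / L) := by
          refine Finset.sum_le_sum fun p _ => ?_
          rw [le_div_iff₀ hL0, mul_comm]
          exact sum_isWide_le hx hφ hB hδ p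
      _ = _ := by simp
  have htotal : |∑ η : Tuple d n, ∑ η' : Tuple d n,
      (f (select x η) * f (select x η') * (∏ p ∈ v, eps (levels c η p) (levels c η' p)) -
        (∏ p ∈ v, eps (levels c η p) (levels c η' p)) *
        (f (select x η) * f (mix v (select x η) (select x η'))))| ≤
      N * (M * (ε * N + 2 * M * ∑ η, W η)) := by
    calc _ ≤ ∑ η : Tuple d n, ∑ η' : Tuple d n,
        (∏ p ∈ v, eps (levels c η p) (levels c η' p)) * (M * (ε + 2 * M * W η)) :=
          (Finset.abs_sum_le_sum_abs _ _).trans (Finset.sum_le_sum fun η _ =>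
            (Finset.abs_sum_le_sum_abs _ _).trans (Finset.sum_le_sum fun η' _ => hpt η η'))
      _ = ∑ η : Tuple d n, N * (M * (ε + 2 * M * W η)) := by
          simp_rw [← Finset.sum_mul, sum_prod_eps hx.1 v, hNdef]
      _ = _ := by
          rw [← Finset.mul_sum, ← Finset.mul_sum, Finset.sum_add_distrib, ← Finset.mul_sum]
          simp [hNdef, mul_comm]
  rw [fullForm, mixedForm]
  simp_rw [hmix]
  rw [← mul_sub, ← Finset.sum_sub_distrib]
  simp_rw [← Finset.sum_sub_distrib]
  rw [abs_mul, abs_of_nonneg (by positivity), inv_mul_le_iff₀ (by positivity)]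
  refine htotal.trans ?_
  calc N * (M * (ε * N + 2 * M * ∑ η, W η))
      ≤ N * (M * (ε * N + 2 * M * (Fintype.card (Pos d) *
      ((Finset.Icc ⌊-B / δ⌋ ⌊B / δ⌋).card * N / L)))) := by gcongr
    _ = _ := by ring

open scoped Classical in
theorem sum_S0star_eq_sum_ite (f : Tuple d n → ℝ) :
    ∑ η ∈ S0star d n, f η = ∑ η, (if η ∈ S0star d n then (1 : ℝ) else 0) * f η := by
  simp

theorem card_S0star_le : ((S0star d n).card : ℝ) ≤ Fintype.card (Tuple d n) := by
  exact_mod_cast Finset.card_le_univ _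

/-- The two forms differ in normalisation and on tuples with repeated units. The product of the
`eps` averages to one over either tuple with the other fixed, so despite its size only the number of
excluded tuples matters. -/
theorem abs_blockForm_sub_fullForm_le {c : (k : Fin K) → Fin (n k) → Fin L}
    (hc : ∀ k l, Fintype.card {i : Fin (n k) // c k i = l} * L = n k) {h : Tuple d n → ℝ} {M : ℝ}
    (hM : ∀ η, |h η| ≤ M) (hs : 0 < (S0star d n).card) (v : Finset (Pos d)) :
    |blockForm c v h h - fullForm c v h| ≤
      M ^ 2 * (((Fintype.card (Tuple d n) : ℝ) ^ 2 / ((S0star d n).card : ℝ) ^ 2 - 1) +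
        2 * (Fintype.card (Tuple d n) - (S0star d n).card) / Fintype.card (Tuple d n)) := by
  classical
  have hs0 : (0 : ℝ) < (S0star d n).card := by exact_mod_cast hs
  have hsN := card_S0star_le (d := d) (n := n)
  set s : ℝ := ((S0star d n).card : ℝ) with hsdef
  set N : ℝ := (Fintype.card (Tuple d n) : ℝ) with hNdef
  have hN0 : 0 < N := hs0.trans_le hsN
  set I : Tuple d n → ℝ := fun η => if η ∈ S0star d n then 1 else 0 with hI
  have hI01 : ∀ η, I η = 0 ∨ I η = 1 := fun η => by
    simp only [hI]; split_ifs <;> simp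
  set E : Tuple d n → Tuple d n → ℝ := fun η η' => ∏ p ∈ v, eps (levels c η p) (levels c η' p)
    with hE
  have hE0 : ∀ η η', 0 ≤ E η η' := prod_eps_nonneg c v
  have hsumI : ∑ η, (1 - I η) = N - s := by
    rw [Finset.sum_sub_distrib]
    simp [hI, hNdef, hsdef]
  have hinv : (N ^ 2)⁻¹ ≤ (s ^ 2)⁻¹ := by gcongr
  have hblock : blockForm c v h h - fullForm c v h = ∑ η, ∑ η',
      (I η * I η' * (s ^ 2)⁻¹ - (N ^ 2)⁻¹) * (h η * h η' * E η η') := by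
    rw [blockForm, fullForm, sum_S0star_eq_sum_ite]
    simp_rw [sum_S0star_eq_sum_ite, Finset.mul_sum]
    rw [← Finset.sum_sub_distrib]
    refine Finset.sum_congr rfl fun η _ => ?_
    rw [← Finset.sum_sub_distrib]
    refine Finset.sum_congr rfl fun η' _ => ?_
    simp only [hI, hE]
    ring
  have hpt : ∀ η η', |(I η * I η' * (s ^ 2)⁻¹ - (N ^ 2)⁻¹) * (h η * h η' * E η η')| ≤
      M ^ 2 * ((s ^ 2)⁻¹ - (N ^ 2)⁻¹ + ((1 - I η) + (1 - I η')) * (N ^ 2)⁻¹) * E η η' := by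
    intro η η'
    rw [abs_mul, abs_mul, abs_mul, abs_of_nonneg (hE0 η η'), ← mul_assoc]
    refine mul_le_mul_of_nonneg_right ?_ (hE0 η η')
    rw [mul_comm (M ^ 2)]
    have hNi : (0 : ℝ) < (N ^ 2)⁻¹ := by positivity
    refine mul_le_mul ?_ ?_ (by positivity) ?_
    · rcases hI01 η with h1 | h1 <;> rcases hI01 η' with h2 | h2 <;> rw [h1, h2, abs_le] <;>
        constructor <;> linarith
    · rw [sq]
      exact mul_le_mul (hM _) (hM _) (abs_nonneg _) ((abs_nonneg _).trans (hM η))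
    · rcases hI01 η with h1 | h1 <;> rcases hI01 η' with h2 | h2 <;> rw [h1, h2] <;> linarith
  rw [hblock]
  calc _ ≤ ∑ η, ∑ η', M ^ 2 *
        ((s ^ 2)⁻¹ - (N ^ 2)⁻¹ + ((1 - I η) + (1 - I η')) * (N ^ 2)⁻¹) * E η η' :=
        (Finset.abs_sum_le_sum_abs _ _).trans (Finset.sum_le_sum fun η _ =>
          (Finset.abs_sum_le_sum_abs _ _).trans (Finset.sum_le_sum fun η' _ => hpt η η'))
    _ = M ^ 2 * ((s ^ 2)⁻¹ - (N ^ 2)⁻¹) * (∑ η, ∑ η', E η η') +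
        M ^ 2 * (N ^ 2)⁻¹ * ((∑ η, (1 - I η) * ∑ η', E η η') +
          ∑ η', (1 - I η') * ∑ η, E η η') := by
        simp_rw [Finset.mul_sum]
        rw [Finset.sum_comm (f := fun η' η => (1 - I η') * E η η'), ← Finset.sum_add_distrib,
          Finset.mul_sum, ← Finset.sum_add_distrib]
        refine Finset.sum_congr rfl fun η _ => ?_
        rw [← Finset.sum_add_distrib, Finset.mul_sum, ← Finset.sum_add_distrib]
        refine Finset.sum_congr rfl fun η' _ => ?_
        ring
    _ = _ := by
        have h1 : ∀ η, ∑ η', E η η' = N := fun η => sum_prod_eps hc v _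
        have h2 : ∀ η', ∑ η, E η η' = N := fun η' => sum_prod_eps' hc v η'
        simp_rw [h1, h2, ← Finset.sum_mul, hsumI]
        simp only [Finset.sum_const, Finset.card_univ, nsmul_eq_mul, ← hNdef]
        field_simp
        ring

/-- Schur test: the nonnegative kernel has row and column sums at most the number of tuples, and a
weighted arithmetic-geometric mean inequality separates h from h'. The free weight τ makes the bound
small as soon as one of the two is small in L². -/
theorem abs_blockForm_le {c : (k : Fin K) → Fin (n k) → Fin L}
    (hc : ∀ k l, Fintype.card {i : Fin (n k) // c k i = l} * L = n k) (h h' : Tuple d n → ℝ)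
    {τ : ℝ} (hτ : 0 < τ) (hs : 0 < (S0star d n).card) (v : Finset (Pos d)) :
    |blockForm c v h h'| ≤ Fintype.card (Tuple d n) / (S0star d n).card *
      ((τ * tupleMean (fun η => h η ^ 2) + τ⁻¹ * tupleMean fun η => h' η ^ 2) / 2) := by
  have hs0 : (0 : ℝ) < (S0star d n).card := by exact_mod_cast hs
  set s : ℝ := ((S0star d n).card : ℝ) with hsdef
  set N : ℝ := (Fintype.card (Tuple d n) : ℝ) with hNdef
  set E : Tuple d n → Tuple d n → ℝ := fun η η' => ∏ p ∈ v, eps (levels c η p) (levels c η' p)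
    with hE
  have hE0 : ∀ η η', 0 ≤ E η η' := prod_eps_nonneg c v
  have h1 : ∀ η, ∑ η' ∈ S0star d n, E η η' ≤ N := fun η =>
    (Finset.sum_le_sum_of_subset_of_nonneg (Finset.subset_univ _) fun η' _ _ => hE0 η η').trans
      (sum_prod_eps hc v _).le
  have h2 : ∀ η', ∑ η ∈ S0star d n, E η η' ≤ N := fun η' =>
    (Finset.sum_le_sum_of_subset_of_nonneg (Finset.subset_univ _) fun η _ _ => hE0 η η').trans
      (sum_prod_eps' hc v η').le
  have hpt : ∀ η η', |h η * h' η' * E η η'| ≤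
      (τ * h η ^ 2 / 2) * E η η' + (τ⁻¹ * h' η' ^ 2 / 2) * E η η' := by
    intro η η'
    rw [abs_mul, abs_of_nonneg (hE0 η η'), ← add_mul]
    refine mul_le_mul_of_nonneg_right ?_ (hE0 η η')
    have h3 : 0 ≤ τ⁻¹ * (τ * |h η| - |h' η'|) ^ 2 := by positivity
    have h4 : τ⁻¹ * (τ * |h η| - |h' η'|) ^ 2 =
        τ * h η ^ 2 - 2 * (|h η| * |h' η'|) + τ⁻¹ * h' η' ^ 2 := by
      rw [← sq_abs (h η), ← sq_abs (h' η')]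
      field_simp
      ring
    rw [abs_mul]
    linarith
  rw [blockForm, abs_mul, abs_of_nonneg (by positivity)]
  calc _ ≤ (s ^ 2)⁻¹ * ∑ η ∈ S0star d n, ∑ η' ∈ S0star d n,
        ((τ * h η ^ 2 / 2) * E η η' + (τ⁻¹ * h' η' ^ 2 / 2) * E η η') :=
        mul_le_mul_of_nonneg_left ((Finset.abs_sum_le_sum_abs _ _).trans
          (Finset.sum_le_sum fun η _ => (Finset.abs_sum_le_sum_abs _ _).trans
            (Finset.sum_le_sum fun η' _ => hpt η η'))) (by positivity)
    _ = (s ^ 2)⁻¹ * (∑ η ∈ S0star d n, (τ * h η ^ 2 / 2) * (∑ η' ∈ S0star d n, E η η') +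
        ∑ η' ∈ S0star d n, (τ⁻¹ * h' η' ^ 2 / 2) * ∑ η ∈ S0star d n, E η η') := by
        simp_rw [Finset.mul_sum]
        rw [Finset.sum_comm (f := fun η' η => (τ⁻¹ * h' η' ^ 2 / 2) * E η η'),
          ← Finset.sum_add_distrib]
        simp_rw [← Finset.sum_add_distrib]
        rw [Finset.mul_sum]
        simp_rw [Finset.mul_sum]
    _ ≤ (s ^ 2)⁻¹ * (∑ η ∈ S0star d n, (τ * h η ^ 2 / 2) * N +
        ∑ η' ∈ S0star d n, (τ⁻¹ * h' η' ^ 2 / 2) * N) := by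
        gcongr with η _ η' _
        · exact h1 η
        · exact h2 η'
    _ = _ := by
        simp_rw [tupleMean, ← Finset.sum_mul, ← Finset.sum_div, ← Finset.mul_sum, ← hsdef]
        field_simp

/-- With repeated units allowed, each cell would contain exactly a fraction L⁻ᵈ of all tuples. -/
theorem pow_mul_card_gridStar_le {c : (k : Fin K) → Fin (n k) → Fin L}
    (hc : ∀ k l, Fintype.card {i : Fin (n k) // c k i = l} * L = n k) (b : Pos d → Fin L) :
    (L : ℝ) ^ Fintype.card (Pos d) * (gridStar c b).card ≤ Fintype.card (Tuple d n) := by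
  classical
  rw [← sum_prod_eps hc Finset.univ b]
  have h : ∀ η ∈ gridStar c b, (L : ℝ) ^ Fintype.card (Pos d) =
      ∏ p, eps (b p) (levels c η p) := by
    intro η hη
    simp [eps, (mem_gridStar.mp hη).2]
  calc _ = ∑ η ∈ gridStar c b, (L : ℝ) ^ Fintype.card (Pos d) := by
        rw [Finset.sum_const, nsmul_eq_mul, mul_comm]
    _ = ∑ η ∈ gridStar c b, ∏ p, eps (b p) (levels c η p) := Finset.sum_congr rfl h
    _ ≤ _ := Finset.sum_le_sum_of_subset_of_nonneg (Finset.subset_univ _) fun η _ _ =>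
        Finset.prod_nonneg fun p _ => eps_nonneg _ _

theorem drawForm_le {c : (k : Fin K) → Fin (n k) → Fin L}
    (hc : ∀ k l, Fintype.card {i : Fin (n k) // c k i = l} * L = n k) (h : Tuple d n → ℝ) :
    drawForm c h ≤ Fintype.card (Tuple d n) / (S0star d n).card *
      tupleMean fun η => h η ^ 2 := by
  have h1 : drawForm c h = (((S0star d n).card : ℝ) ^ 2)⁻¹ * ∑ η ∈ S0star d n,
      ((L : ℝ) ^ Fintype.card (Pos d) * (gridStar c (levels c η)).card) * h η ^ 2 := by
    rw [drawForm, Finset.mul_sum, Finset.mul_sum]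
    exact Finset.sum_congr rfl fun η _ => by ring
  rw [h1]
  calc _ ≤ (((S0star d n).card : ℝ) ^ 2)⁻¹ * ∑ η ∈ S0star d n,
        (Fintype.card (Tuple d n) : ℝ) * h η ^ 2 := by
        gcongr with η _
        exact pow_mul_card_gridStar_le hc _
    _ = _ := by
        rw [tupleMean, ← Finset.mul_sum, sq, mul_inv]
        ring

/-- Cauchy–Schwarz in every cell: the within-cell variance is nonnegative. -/
theorem blockForm_univ_le_drawForm (hL : Fintype.card (Pos d) = 0 ∨ L ≠ 0)
    (c : (k : Fin K) → Fin (n k) → Fin L) (h : Tuple d n → ℝ) :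
    blockForm c Finset.univ h h ≤ drawForm c h := by
  rw [← inv_mul_sum_cellMean_sq hL, ← inv_mul_sum_cell_sq hL]
  gcongr with b _
  rw [cellMean, mul_pow]
  gcongr
  exact sq_sum_le_card_mul_sum_sq

end Bounds

/-! ### Bounds for the cross moments -/

section Cross

variable {K : ℕ} {d : Fin K → ℕ} {F : Fin K → Measure ℝ} [∀ k, IsProbabilityMeasure (F k)]

theorem abs_mul_le_weighted (a b : ℝ) {τ : ℝ} (hτ : 0 < τ) :
    |a * b| ≤ (τ * a ^ 2 + τ⁻¹ * b ^ 2) / 2 := by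
  have h3 : 0 ≤ τ⁻¹ * (τ * |a| - |b|) ^ 2 := by positivity
  have h4 : τ⁻¹ * (τ * |a| - |b|) ^ 2 = τ * a ^ 2 - 2 * (|a| * |b|) + τ⁻¹ * b ^ 2 := by
    rw [← sq_abs a, ← sq_abs b]
    field_simp
    ring
  rw [abs_mul]
  linarith

theorem integrable_cross {a b : (Pos d → ℝ) → ℝ} (ha : MemLp a 2 (productLaw F d))
    (hb : MemLp b 2 (productLaw F d)) (v : Finset (Pos d)) :
    Integrable (fun z : (Pos d → ℝ) × (Pos d → ℝ) => a z.1 * b (mix v z.1 z.2))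
      ((productLaw F d).prod (productLaw F d)) :=
  (memLp_fst_prod ha).integrable_mul (memLp_mix hb v)

theorem abs_crossMoment_le {a b : (Pos d → ℝ) → ℝ} (ha : MemLp a 2 (productLaw F d))
    (hb : MemLp b 2 (productLaw F d)) (v : Finset (Pos d)) {τ : ℝ} (hτ : 0 < τ) :
    |crossMoment F v a b| ≤
      (τ * ∫ x, a x ^ 2 ∂(productLaw F d) + τ⁻¹ * ∫ x, b x ^ 2 ∂(productLaw F d)) / 2 := by
  have ha2 := (memLp_fst_prod ha).integrable_sq
  have hb2 := (memLp_mix hb v).integrable_sq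
  have h1 := integral_comp_of_measurePreserving
    (measurePreserving_fst (μ := productLaw F d) (ν := productLaw F d))
    ha.integrable_sq.aestronglyMeasurable
  have h2 := integral_comp_of_measurePreserving (measurePreserving_mix F v)
    hb.integrable_sq.aestronglyMeasurable
  rw [← h1, ← h2, ← integral_const_mul, ← integral_const_mul,
    ← integral_add (ha2.const_mul _) (hb2.const_mul _), ← integral_div]
  refine (abs_integral_le_integral_abs).trans (integral_mono (integrable_cross ha hb v).abs
    (((ha2.const_mul _).add (hb2.const_mul _)).div_const 2) fun z => ?_)
  exact abs_mul_le_weighted _ _ hτ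

theorem integral_sub_eq_of_sub_eq {α : Type*} [MeasurableSpace α] {μ : Measure α}
    {f₁ f₂ f₃ f₄ f₅ : α → ℝ} (h₁ : Integrable f₁ μ) (h₂ : Integrable f₂ μ) (h₃ : Integrable f₃ μ)
    (h₄ : Integrable f₄ μ) (h₅ : Integrable f₅ μ)
    (h : ∀ x, f₁ x - f₂ x = f₃ x + f₄ x - f₅ x) :
    ∫ x, f₁ x ∂μ - ∫ x, f₂ x ∂μ = ∫ x, f₃ x ∂μ + ∫ x, f₄ x ∂μ - ∫ x, f₅ x ∂μ := by
  have e : f₁ - f₂ = f₃ + f₄ - f₅ := funext h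
  rw [← integral_sub' h₁ h₂, ← integral_add' h₃ h₄, ← integral_sub' (h₃.add h₄) h₅, e]

/-- Every term contains a - b and otherwise only a, so no bound on b is needed in the approximation
argument. -/
theorem crossMoment_sub_crossMoment {a b : (Pos d → ℝ) → ℝ} (ha : MemLp a 2 (productLaw F d))
    (hb : MemLp b 2 (productLaw F d)) (v : Finset (Pos d)) :
    crossMoment F v a a - crossMoment F v b b = crossMoment F v (a - b) a +
      crossMoment F v a (a - b) - crossMoment F v (a - b) (a - b) := by
  have hab := ha.sub hb
  refine integral_sub_eq_of_sub_eq (integrable_cross ha ha v) (integrable_cross hb hb v)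
    (integrable_cross hab ha v) (integrable_cross ha hab v) (integrable_cross hab hab v) fun z => ?_
  simp only [Pi.sub_apply]
  ring

theorem crossMoment_univ (a : (Pos d → ℝ) → ℝ) (ha : MemLp a 2 (productLaw F d)) :
    crossMoment F Finset.univ a a = ∫ x, a x ^ 2 ∂(productLaw F d) := by
  rw [crossMoment, ← integral_comp_of_measurePreserving
    (measurePreserving_fst (μ := productLaw F d) (ν := productLaw F d))
    ha.integrable_sq.aestronglyMeasurable]
  congr 1
  funext z
  have : mix Finset.univ z.1 z.2 = z.1 := by funext p; simp [mix]
  rw [this, sq]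

/-- Clamping every coordinate to [-B, B] leaves f unchanged: inside the box nothing moves, and
outside it f vanishes before and after clamping. Uniform continuity then gives the modulus, and the
bounded monotone φ is what the count of wide groups requires, the data being unbounded. -/
theorem exists_modulus {ι : Type*} [Fintype ι] {f : (ι → ℝ) → ℝ} (hf : Continuous f)
    (hs : HasCompactSupport f) :
    ∃ (φ : ℝ → ℝ) (B : ℝ), Monotone φ ∧ (∀ y, |φ y| ≤ B) ∧ ∀ ε > 0, ∃ δ > 0,
      ∀ y z : ι → ℝ, (∀ p, |φ (y p) - φ (z p)| < δ) → |f y - f z| ≤ ε := by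
  obtain ⟨B₀, hB₀⟩ := hs.isCompact.isBounded.subset_ball 0
  set B := max B₀ 1
  have hB0 : 0 < B := lt_of_lt_of_le one_pos (le_max_right _ _)
  have hsupp : ∀ x, B ≤ ‖x‖ → f x = 0 := by
    intro x hx
    by_contra hfx
    have := hB₀ (subset_tsupport f hfx)
    rw [mem_ball_zero_iff] at this
    exact absurd (this.trans_le (le_max_left _ _)) (not_lt.mpr hx)
  let φ : ℝ → ℝ := fun y => max (-B) (min B y)
  have hφB : ∀ y, |φ y| ≤ B := by
    intro y
    rw [abs_le]
    exact ⟨le_max_left _ _, max_le (by linarith) (min_le_left _ _)⟩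
  have hclamp : ∀ x, f x = f fun p => φ (x p) := by
    intro x
    by_cases hx : ∃ p, B < |x p|
    · obtain ⟨p, hp⟩ := hx
      have h1 : B ≤ ‖x‖ := hp.le.trans (norm_le_pi_norm x p)
      have h2 : B ≤ ‖fun p => φ (x p)‖ := by
        refine le_trans ?_ (norm_le_pi_norm (fun p => φ (x p)) p)
        rw [Real.norm_eq_abs, le_abs]
        rcases lt_abs.mp hp with h | h
        · left
          simp only [φ]
          rw [min_eq_left h.le]
          exact le_max_right _ _
        · right
          simp only [φ]
          rw [min_eq_right (by linarith), max_eq_left (by linarith)]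
          simp
      rw [hsupp _ h1, hsupp _ h2]
    · push Not at hx
      congr 1
      funext p
      have := abs_le.mp (hx p)
      simp only [φ]
      rw [min_eq_right this.2, max_eq_right this.1]
  refine ⟨φ, B, fun y z hyz => max_le_max le_rfl (min_le_min le_rfl hyz), hφB, ?_⟩
  intro ε hε
  obtain ⟨δ, hδ, h⟩ := Metric.uniformContinuous_iff.mp
    (hs.uniformContinuous_of_continuous hf) ε hε
  refine ⟨δ, hδ, fun y z hyz => ?_⟩
  rw [hclamp y, hclamp z]
  exact (h ((dist_pi_lt_iff hδ).mpr hyz)).le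

end Cross

end ICUDO

/-! ### Bounds for the expected forms, uniform in the design -/

namespace DebiasedICUDO

open ICUDO

variable {K : ℕ} {d : Fin K → ℕ} {F : Fin K → Measure ℝ} {t : ℕ} (D : DebiasedICUDO.{u} d F t)

theorem card_S0star_pos : 0 < (S0star d D.n).card :=
  Nat.pos_of_ne_zero fun h => D.card_S0star_ne_zero (by exact_mod_cast h)

/-- The ratio of the number of tuples to that of tuples without repeated units. -/
noncomputable def ratio : ℝ := Fintype.card (Tuple d D.n) / (S0star d D.n).card

/-- With N tuples, s of them without repeats, the union bound is L(N - s) ≤ d² N; L ≥ 2d² turns it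
into N ≤ 2s, which gives the other bounds. -/
theorem ratio_le (hn : ∀ k, D.L ≤ D.n k) (hL : 0 < D.L)
    (hLd : 2 * Fintype.card (Pos d) ^ 2 ≤ D.L) :
    D.ratio ≤ 1 + 2 * (Fintype.card (Pos d) : ℝ) ^ 2 / D.L ∧ D.ratio ≤ 2 ∧
    (Fintype.card (Tuple d D.n) - (S0star d D.n).card : ℝ) / Fintype.card (Tuple d D.n) ≤
      (Fintype.card (Pos d) : ℝ) ^ 2 / D.L := by
  have h := card_sub_card_S0star_le (d := d) hn
  have hs : (0 : ℝ) < (S0star d D.n).card := by exact_mod_cast D.card_S0star_pos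
  have hsN := card_S0star_le (d := d) (n := D.n)
  rw [ratio]
  set s : ℝ := ((S0star d D.n).card : ℝ)
  set N : ℝ := (Fintype.card (Tuple d D.n) : ℝ)
  set J : ℝ := (Fintype.card (Pos d) : ℝ)
  have hN : 0 < N := hs.trans_le hsN
  have hL0 : (0 : ℝ) < D.L := by exact_mod_cast hL
  have hLd' : 2 * (Fintype.card (Pos d) : ℝ) ^ 2 ≤ D.L := by exact_mod_cast hLd
  change 2 * J ^ 2 ≤ _ at hLd'
  have h2 : N ≤ 2 * s := by
    have : (D.L : ℝ) * (2 * (N - s)) ≤ D.L * N := by nlinarith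
    have := le_of_mul_le_mul_left this hL0
    linarith
  refine ⟨?_, ?_, ?_⟩
  · rw [div_le_iff₀ hs, add_mul, one_mul, ← sub_le_iff_le_add', div_mul_eq_mul_div,
      le_div_iff₀ hL0]
    nlinarith [sq_nonneg J]
  · rw [div_le_iff₀ hs]; exact h2
  · rw [div_le_div_iff₀ hN hL0]
    linarith

variable [∀ k, IsProbabilityMeasure (F k)] {g : (Pos d → ℝ) → ℝ}

theorem integral_tupleMean_sq {a : (Pos d → ℝ) → ℝ} (ha : MemLp a 2 (productLaw F d)) :
    Integrable (fun ω => tupleMean fun η : Tuple d D.n => a (select (D.X ω) η) ^ 2) D.P ∧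
    ∫ ω, tupleMean (fun η : Tuple d D.n => a (select (D.X ω) η) ^ 2) ∂D.P =
      ∫ x, a x ^ 2 ∂(productLaw F d) := by
  have hi : ∀ η ∈ S0star d D.n, Integrable (fun ω => a (select (D.X ω) η) ^ 2) D.P :=
    fun η hη => (D.memLp_select ha hη).integrable_sq
  refine ⟨(integrable_finsetSum _ hi).const_mul _, ?_⟩
  unfold tupleMean
  rw [integral_const_mul, integral_finsetSum _ hi, Finset.sum_congr rfl fun η hη =>
    integral_comp_of_measurePreserving (D.measurePreserving_select_X hη)
      ha.integrable_sq.aestronglyMeasurable, Finset.sum_const, nsmul_eq_mul,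
    inv_mul_cancel_left₀ D.card_S0star_ne_zero]

theorem abs_meanBlock_le {a b : (Pos d → ℝ) → ℝ} (ha : MemLp a 2 (productLaw F d))
    (hb : MemLp b 2 (productLaw F d)) (v : Finset (Pos d)) {τ : ℝ} (hτ : 0 < τ) :
    |D.meanBlock v a b| ≤ D.ratio *
      ((τ * ∫ x, a x ^ 2 ∂(productLaw F d) + τ⁻¹ * ∫ x, b x ^ 2 ∂(productLaw F d)) / 2) := by
  obtain ⟨ha1, ha2⟩ := D.integral_tupleMean_sq ha
  obtain ⟨hb1, hb2⟩ := D.integral_tupleMean_sq hb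
  rw [← ha2, ← hb2, ← integral_const_mul, ← integral_const_mul,
    ← integral_add (ha1.const_mul _) (hb1.const_mul _), ← integral_div, ← integral_const_mul]
  refine (abs_integral_le_integral_abs).trans (integral_mono (D.integrable_blockForm_c ha hb v).abs
    ((((ha1.const_mul _).add (hb1.const_mul _)).div_const 2).const_mul _) fun ω => ?_)
  exact abs_blockForm_le (D.c_ordered ω).1 _ _ hτ D.card_S0star_pos v

theorem meanBlock_sub_meanBlock {a b : (Pos d → ℝ) → ℝ} (ha : MemLp a 2 (productLaw F d))
    (hb : MemLp b 2 (productLaw F d)) (v : Finset (Pos d)) :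
    D.meanBlock v a a - D.meanBlock v b b = D.meanBlock v (a - b) a +
      D.meanBlock v a (a - b) - D.meanBlock v (a - b) (a - b) := by
  have hab := ha.sub hb
  refine integral_sub_eq_of_sub_eq (D.integrable_blockForm_c ha ha v)
    (D.integrable_blockForm_c hb hb v) (D.integrable_blockForm_c hab ha v)
    (D.integrable_blockForm_c ha hab v) (D.integrable_blockForm_c hab hab v) fun ω => ?_
  simp only [blockForm, Pi.sub_apply]
  rw [← mul_sub, ← mul_add, ← mul_sub]
  congr 1
  rw [← Finset.sum_sub_distrib, ← Finset.sum_add_distrib, ← Finset.sum_sub_distrib]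
  refine Finset.sum_congr rfl fun η _ => ?_
  rw [← Finset.sum_sub_distrib, ← Finset.sum_add_distrib, ← Finset.sum_sub_distrib]
  refine Finset.sum_congr rfl fun η' _ => ?_
  ring

theorem meanDraw_le {a : (Pos d → ℝ) → ℝ} (ha : MemLp a 2 (productLaw F d)) :
    D.meanDraw a ≤ D.ratio * ∫ x, a x ^ 2 ∂(productLaw F d) := by
  obtain ⟨ha1, ha2⟩ := D.integral_tupleMean_sq ha
  rw [← ha2, ← integral_const_mul]
  exact integral_mono (D.integrable_drawForm_c ha) (ha1.const_mul _) fun ω =>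
    drawForm_le (D.c_ordered ω).1 _

theorem meanBlock_univ_le_meanDraw {a : (Pos d → ℝ) → ℝ} (ha : MemLp a 2 (productLaw F d)) :
    D.meanBlock Finset.univ a a ≤ D.meanDraw a :=
  integral_mono (D.integrable_blockForm_c ha ha _) (D.integrable_drawForm_c ha) fun _ =>
    blockForm_univ_le_drawForm D.levels_ne_zero _ _

/-! ### Bounded continuous kernels -/

/-- If no unit occurs twice among two tuples, the two subsamples are independent with the product
law and the term equals the cross moment exactly. The other pairs are a fraction at most 4d²/L, with
error at most 2M² each. -/
theorem integral_mixedForm {f : (Pos d → ℝ) → ℝ} (hf : Measurable f) {M : ℝ}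
    (hM : ∀ y, |f y| ≤ M) (hn : ∀ k, D.L ≤ D.n k) (hL : 0 < D.L) (v : Finset (Pos d)) :
    Integrable (fun ω => mixedForm v f (D.X ω)) D.P ∧
    |∫ ω, mixedForm v f (D.X ω) ∂D.P - crossMoment F v f f| ≤
      8 * M ^ 2 * (Fintype.card (Pos d) : ℝ) ^ 2 / D.L := by
  classical
  have hM0 : 0 ≤ M := (abs_nonneg _).trans (hM 0)
  have hL0 : (0 : ℝ) < D.L := by exact_mod_cast hL
  have hN : (0 : ℝ) < Fintype.card (Tuple d D.n) :=
    lt_of_lt_of_le (by exact_mod_cast D.card_S0star_pos) card_S0star_le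
  have hprod : ∀ y z, |f y * f z| ≤ M ^ 2 := fun y z => by
    rw [abs_mul, sq]
    exact mul_le_mul (hM _) (hM _) (abs_nonneg _) hM0
  have hfL : MemLp f 2 (productLaw F d) :=
    MemLp.of_bound hf.aestronglyMeasurable M (Eventually.of_forall hM)
  have hcm : Measurable fun z : (Pos d → ℝ) × (Pos d → ℝ) => f z.1 * f (mix v z.1 z.2) :=
    (hf.comp measurable_fst).mul (hf.comp (measurable_mix v))
  have hmeas : ∀ η η' : Tuple d D.n, Measurable fun ω =>
      f (select (D.X ω) η) * f (mix v (select (D.X ω) η) (select (D.X ω) η')) := fun η η' =>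
    hcm.comp (((measurable_select η).comp D.X_measurable).prodMk
      ((measurable_select η').comp D.X_measurable))
  have hint : ∀ η η' : Tuple d D.n, Integrable (fun ω =>
      f (select (D.X ω) η) * f (mix v (select (D.X ω) η) (select (D.X ω) η'))) D.P :=
    fun η η' => Integrable.of_bound (hmeas η η').aestronglyMeasurable (M ^ 2)
      (Eventually.of_forall fun ω => hprod _ _)
  refine ⟨(integrable_finsetSum _ fun η _ => integrable_finsetSum _ fun η' _ =>
    hint η η').const_mul _, ?_⟩
  have hcross : |crossMoment F v f f| ≤ M ^ 2 := by
    have := norm_integral_le_of_norm_le_const (μ := (productLaw F d).prod (productLaw F d))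
      (f := fun z => f z.1 * f (mix v z.1 z.2)) (C := M ^ 2)
      (Eventually.of_forall fun z => hprod _ _)
    simpa [crossMoment] using this
  have hterm : ∀ η η' : Tuple d D.n,
      |∫ ω, f (select (D.X ω) η) * f (mix v (select (D.X ω) η) (select (D.X ω) η')) ∂D.P -
        crossMoment F v f f| ≤ 2 * M ^ 2 *
        if Function.Injective (Sum.elim (units η) (units η')) then (0 : ℝ) else 1 := by
    intro η η'
    split_ifs with h
    · have hp := (measurePreserving_select_pair F h).comp
        (⟨D.X_measurable, D.X_law⟩ : MeasurePreserving D.X D.P (productLaw F D.n))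
      have := integral_comp_of_measurePreserving hp hcm.aestronglyMeasurable
      rw [crossMoment, ← this]
      simp
    · have := norm_integral_le_of_norm_le_const (μ := D.P) (C := M ^ 2)
        (f := fun ω => f (select (D.X ω) η) *
          f (mix v (select (D.X ω) η) (select (D.X ω) η')))
        (Eventually.of_forall fun z => hprod _ _)
      rw [Real.norm_eq_abs] at this
      rw [probReal_univ, mul_one] at this
      refine (abs_sub _ _).trans ?_
      linarith
  set N : ℝ := (Fintype.card (Tuple d D.n) : ℝ) with hNdef
  have hE : ∫ ω, mixedForm v f (D.X ω) ∂D.P = (N ^ 2)⁻¹ * ∑ η : Tuple d D.n, ∑ η' : Tuple d D.n,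
      ∫ ω, f (select (D.X ω) η) * f (mix v (select (D.X ω) η) (select (D.X ω) η')) ∂D.P := by
    unfold mixedForm
    rw [integral_const_mul, integral_finsetSum _ fun η _ => integrable_finsetSum _ fun η' _ =>
      hint η η']
    congr 1
    exact Finset.sum_congr rfl fun η _ => integral_finsetSum _ fun η' _ => hint η η'
  have hC : crossMoment F v f f = (N ^ 2)⁻¹ * ∑ _η : Tuple d D.n, ∑ _η' : Tuple d D.n,
      crossMoment F v f f := by
    simp only [Finset.sum_const, Finset.card_univ, nsmul_eq_mul, ← hNdef]
    field_simp
  rw [hE, hC, ← mul_sub, ← Finset.sum_sub_distrib]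
  simp_rw [← Finset.sum_sub_distrib]
  rw [abs_mul, abs_of_nonneg (by positivity), inv_mul_le_iff₀ (by positivity)]
  have hcoll := card_pair_collisions_le (d := d) hn
  calc _ ≤ ∑ η : Tuple d D.n, ∑ η' : Tuple d D.n, 2 * M ^ 2 *
        if Function.Injective (Sum.elim (units η) (units η')) then (0 : ℝ) else 1 :=
        (Finset.abs_sum_le_sum_abs _ _).trans (Finset.sum_le_sum fun η _ =>
          (Finset.abs_sum_le_sum_abs _ _).trans (Finset.sum_le_sum fun η' _ => hterm η η'))
    _ = 2 * M ^ 2 / D.L * (D.L * ∑ η : Tuple d D.n, ∑ η' : Tuple d D.n,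
        if Function.Injective (Sum.elim (units η) (units η')) then (0 : ℝ) else 1) := by
        simp_rw [← Finset.mul_sum]
        field_simp
    _ ≤ 2 * M ^ 2 / D.L * (4 * (Fintype.card (Pos d) : ℝ) ^ 2 * N ^ 2) := by gcongr
    _ = _ := by ring

theorem abs_meanBlock_sub_crossMoment_le {φ : ℝ → ℝ} (hφ : Monotone φ) {B : ℝ}
    (hB : ∀ y, |φ y| ≤ B) {δ : ℝ} (hδ : 0 < δ) {f : (Pos d → ℝ) → ℝ} (hf : Measurable f) {M : ℝ}
    (hM : ∀ y, |f y| ≤ M) {ε : ℝ} (hε0 : 0 ≤ ε)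
    (hε : ∀ y z : Pos d → ℝ, (∀ p, |φ (y p) - φ (z p)| < δ) → |f y - f z| ≤ ε)
    (hn : ∀ k, D.L ≤ D.n k) (hL : 0 < D.L) (hLd : 2 * Fintype.card (Pos d) ^ 2 ≤ D.L)
    (v : Finset (Pos d)) :
    |D.meanBlock v f f - crossMoment F v f f| ≤ M * ε +
      (16 * M ^ 2 * (Fintype.card (Pos d) : ℝ) ^ 2 +
        2 * M ^ 2 * Fintype.card (Pos d) * (Finset.Icc ⌊-B / δ⌋ ⌊B / δ⌋).card) / D.L := by
  have hM0 : 0 ≤ M := (abs_nonneg _).trans (hM 0)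
  have hL0 : (0 : ℝ) < D.L := by exact_mod_cast hL
  have hs : (0 : ℝ) < (S0star d D.n).card := by exact_mod_cast D.card_S0star_pos
  have hsN := card_S0star_le (d := d) (n := D.n)
  have hN : (0 : ℝ) < Fintype.card (Tuple d D.n) := hs.trans_le hsN
  have hfL : MemLp f 2 (productLaw F d) :=
    MemLp.of_bound hf.aestronglyMeasurable M (Eventually.of_forall hM)
  obtain ⟨hmi, hmc⟩ := D.integral_mixedForm hf hM hn hL v
  obtain ⟨hr1, hr2, hr3⟩ := D.ratio_le hn hL hLd
  have hr0 : 1 ≤ D.ratio := by rw [ratio, le_div_iff₀ hs, one_mul]; exact hsN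
  have hpt : ∀ ω, |blockForm (D.c ω) v (fun η => f (select (D.X ω) η))
      (fun η => f (select (D.X ω) η)) - mixedForm v f (D.X ω)| ≤
      M ^ 2 * (8 * (Fintype.card (Pos d) : ℝ) ^ 2 / D.L) +
      M * (ε + 2 * M * (Fintype.card (Pos d) *
        (Finset.Icc ⌊-B / δ⌋ ⌊B / δ⌋).card / D.L)) := by
    intro ω
    have h1 := abs_blockForm_sub_fullForm_le (D.c_ordered ω).1
      (h := fun η => f (select (D.X ω) η)) (fun η => hM _) D.card_S0star_pos v
    have h2 := abs_fullForm_sub_mixedForm_le (D.c_ordered ω) hφ hB hδ hM hε hε0 hL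
      (by exact_mod_cast hN) v
    -- r² - 1 = (r - 1)(r + 1) ≤ 3(r - 1), as the ratio r is at most 2.
    have h3 : (Fintype.card (Tuple d D.n) : ℝ) ^ 2 / ((S0star d D.n).card : ℝ) ^ 2 - 1 ≤
        6 * (Fintype.card (Pos d) : ℝ) ^ 2 / D.L := by
      rw [← div_pow, ← ratio]
      have h6 : 6 * (Fintype.card (Pos d) : ℝ) ^ 2 / D.L =
          3 * (2 * (Fintype.card (Pos d) : ℝ) ^ 2 / D.L) := by ring
      rw [h6]
      nlinarith
    have h4 : M ^ 2 * (((Fintype.card (Tuple d D.n) : ℝ) ^ 2 / ((S0star d D.n).card : ℝ) ^ 2 - 1) +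
        2 * (Fintype.card (Tuple d D.n) - (S0star d D.n).card) / Fintype.card (Tuple d D.n)) ≤
        M ^ 2 * (8 * (Fintype.card (Pos d) : ℝ) ^ 2 / D.L) := by
      refine mul_le_mul_of_nonneg_left ?_ (by positivity)
      rw [mul_div_assoc 2]
      have h8 : 8 * (Fintype.card (Pos d) : ℝ) ^ 2 / D.L =
          6 * (Fintype.card (Pos d) : ℝ) ^ 2 / D.L +
          2 * ((Fintype.card (Pos d) : ℝ) ^ 2 / D.L) := by ring
      rw [h8]
      linarith
    exact (abs_sub_le _ _ _).trans (add_le_add (h1.trans h4) h2)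
  have hbi := D.integrable_blockForm_c hfL hfL v
  have h1 : |D.meanBlock v f f - ∫ ω, mixedForm v f (D.X ω) ∂D.P| ≤
      M ^ 2 * (8 * (Fintype.card (Pos d) : ℝ) ^ 2 / D.L) +
      M * (ε + 2 * M * (Fintype.card (Pos d) *
        (Finset.Icc ⌊-B / δ⌋ ⌊B / δ⌋).card / D.L)) := by
    rw [meanBlock, ← integral_sub hbi hmi]
    have := norm_integral_le_of_norm_le_const (μ := D.P) (f := fun ω =>
      blockForm (D.c ω) v (fun η => f (select (D.X ω) η)) (fun η => f (select (D.X ω) η)) -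
        mixedForm v f (D.X ω)) (Eventually.of_forall hpt)
    simpa using this
  refine (abs_sub_le _ _ _).trans ((add_le_add h1 hmc).trans (le_of_eq ?_))
  field_simp
  ring

end DebiasedICUDO

/-! ### Passage to the limit -/

namespace DebiasedICUDO

open ICUDO

section Limits

variable {K : ℕ} {d : Fin K → ℕ} {F : Fin K → Measure ℝ} {t : ℕ}
  {D : ℕ → DebiasedICUDO.{u} d F t}

theorem eventually_ratio_le (hL : Tendsto (fun ν => (D ν).L) atTop atTop)
    (hn : ∀ᶠ ν in atTop, ∀ k, (D ν).L ≤ (D ν).n k) :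
    ∀ᶠ ν in atTop, (D ν).ratio ≤ 1 + 2 * (Fintype.card (Pos d) : ℝ) ^ 2 / (D ν).L ∧
      (D ν).ratio ≤ 2 := by
  filter_upwards [hn, hL.eventually_gt_atTop 0,
    hL.eventually_ge_atTop (2 * Fintype.card (Pos d) ^ 2)] with ν h1 h2 h3
  obtain ⟨h4, h5, -⟩ := (D ν).ratio_le h1 h2 h3
  exact ⟨h4, h5⟩

variable [∀ k, IsProbabilityMeasure (F k)] {g : (Pos d → ℝ) → ℝ}

theorem tendsto_meanBlock_of_hasCompactSupport (hL : Tendsto (fun ν => (D ν).L) atTop atTop)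
    (hn : ∀ᶠ ν in atTop, ∀ k, (D ν).L ≤ (D ν).n k) {f : (Pos d → ℝ) → ℝ} (hf : Continuous f)
    (hs : HasCompactSupport f) (v : Finset (Pos d)) :
    Tendsto (fun ν => (D ν).meanBlock v f f) atTop (𝓝 (crossMoment F v f f)) := by
  obtain ⟨M, hM⟩ := hs.exists_bound_of_continuous hf
  simp only [Real.norm_eq_abs] at hM
  have hM0 : 0 ≤ M := (abs_nonneg _).trans (hM 0)
  obtain ⟨φ, B, hφ, hB, hmod⟩ := exists_modulus hf hs
  rw [Metric.tendsto_nhds]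
  intro ε hε
  obtain ⟨δ, hδ, hδε⟩ := hmod (ε / (2 * (M + 1))) (by positivity)
  have hC : ∀ C : ℝ, Tendsto (fun ν => C / ((D ν).L : ℝ)) atTop (𝓝 0) := fun C =>
    tendsto_const_nhds.div_atTop (tendsto_natCast_atTop_atTop.comp hL)
  filter_upwards [hn, hL.eventually_gt_atTop 0,
    hL.eventually_ge_atTop (2 * Fintype.card (Pos d) ^ 2),
    (hC (16 * M ^ 2 * (Fintype.card (Pos d) : ℝ) ^ 2 + 2 * M ^ 2 * Fintype.card (Pos d) *
      (Finset.Icc ⌊-B / δ⌋ ⌊B / δ⌋).card)).eventually_lt_const (half_pos hε)] with ν h1 h2 h3 h4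
  rw [Real.dist_eq]
  have h5 := (D ν).abs_meanBlock_sub_crossMoment_le hφ hB hδ hf.measurable hM
    (by positivity) hδε h1 h2 h3 v
  have h6 : M * (ε / (2 * (M + 1))) ≤ ε / 2 := by
    rw [← mul_div_assoc, div_le_div_iff₀ (by positivity) (by positivity)]
    nlinarith
  linarith

theorem tendsto_meanBlock (hL : Tendsto (fun ν => (D ν).L) atTop atTop)
    (hn : ∀ᶠ ν in atTop, ∀ k, (D ν).L ≤ (D ν).n k) (hg : MemLp g 2 (productLaw F d))
    (v : Finset (Pos d)) :
    Tendsto (fun ν => (D ν).meanBlock v g g) atTop (𝓝 (crossMoment F v g g)) := by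
  set G : ℝ := ∫ x, g x ^ 2 ∂(productLaw F d) with hG
  have hG0 : 0 ≤ G := integral_nonneg fun x => sq_nonneg _
  rw [Metric.tendsto_nhds]
  intro ε hε
  -- First τ makes τG small, then the approximation error ζ makes τ⁻¹ζ small. The three block forms
  -- that involve g - f are then at most ε/10 each and the three cross moments at most ε/20 each;
  -- with ε/4 for the approximating kernel the total stays below ε.
  obtain ⟨τ, hτ, hτG⟩ : ∃ τ : ℝ, 0 < τ ∧ τ * G ≤ ε / 20 :=
    ⟨ε / (20 * (G + 1)), by positivity, by
      rw [div_mul_eq_mul_div, div_le_div_iff₀ (by positivity) (by positivity)]; nlinarith⟩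
  obtain ⟨ζ, hζ, hζτ, hζε⟩ : ∃ ζ : ℝ, 0 < ζ ∧ τ⁻¹ * ζ ≤ ε / 20 ∧ ζ ≤ ε / 20 :=
    ⟨min (τ * (ε / 20)) (ε / 20), by positivity,
      (mul_le_mul_of_nonneg_left (min_le_left _ _) (by positivity)).trans
        (by rw [inv_mul_cancel_left₀ hτ.ne']), min_le_right _ _⟩
  have hg' : MemLp g (ENNReal.ofReal 2) (productLaw F d) := by simpa using hg
  obtain ⟨f, hfs, hfε, hfc, hfL⟩ :=
    hg'.exists_hasCompactSupport_integral_rpow_sub_le two_pos hζ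
  have hfL2 : MemLp f 2 (productLaw F d) := by simpa using hfL
  have hgf := hg.sub hfL2
  have hsmall : ∫ x, (g - f) x ^ 2 ∂(productLaw F d) ≤ ζ := by
    refine le_trans (le_of_eq ?_) hfε
    congr 1
    funext x
    rw [Real.rpow_two, Real.norm_eq_abs, sq_abs, Pi.sub_apply]
  set H : ℝ := ∫ x, (g - f) x ^ 2 ∂(productLaw F d) with hH
  have hH0 : 0 ≤ H := integral_nonneg fun x => sq_nonneg _
  have hτH : τ⁻¹ * H ≤ ε / 20 :=
    (mul_le_mul_of_nonneg_left hsmall (by positivity)).trans hζτ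
  have hlim := Metric.tendsto_nhds.mp
    (tendsto_meanBlock_of_hasCompactSupport hL hn hfc hfs v) (ε / 4) (by positivity)
  filter_upwards [hlim, eventually_ratio_le hL hn] with ν h1 hr
  have h2 := hr.2
  have hr0 : 0 ≤ (D ν).ratio := by unfold ratio; positivity
  have hbound : ∀ y b : ℝ, 0 ≤ b → |y| ≤ (D ν).ratio * b → |y| ≤ 2 * b := fun y b hb hy =>
    hy.trans (mul_le_mul_of_nonneg_right h2 hb)
  have m1 := hbound _ _ (by positivity) ((D ν).abs_meanBlock_le hgf hg v (inv_pos.mpr hτ))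
  have m2 := hbound _ _ (by positivity) ((D ν).abs_meanBlock_le hg hgf v hτ)
  have m3 := hbound _ _ (by positivity) ((D ν).abs_meanBlock_le hgf hgf v one_pos)
  have c1 := abs_crossMoment_le hgf hg v (inv_pos.mpr hτ)
  have c2 := abs_crossMoment_le hg hgf v hτ
  have c3 := abs_crossMoment_le hgf hgf v one_pos
  have e1 := (D ν).meanBlock_sub_meanBlock hg hfL2 v
  have e2 := crossMoment_sub_crossMoment hg hfL2 v
  rw [inv_inv] at m1 c1
  rw [inv_one, one_mul] at m3 c3
  rw [← hG, ← hH] at m1 m2 c1 c2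
  rw [← hH] at m3 c3
  rw [Real.dist_eq] at h1 ⊢
  rw [abs_lt] at h1 ⊢
  rw [abs_le] at m1 m2 m3 c1 c2 c3
  constructor <;> linarith [m1.1, m1.2, m2.1, m2.2, m3.1, m3.2, c1.1, c1.2, c2.1, c2.2, c3.1,
    c3.2, h1.1, h1.2]

/-- Squeeze: the difference is nonnegative, and the second moment of a draw is at most (1 + O(1/L))
E g², while the full block form tends to E g². -/
theorem tendsto_meanDraw_sub_meanBlock (hL : Tendsto (fun ν => (D ν).L) atTop atTop)
    (hn : ∀ᶠ ν in atTop, ∀ k, (D ν).L ≤ (D ν).n k) (hg : MemLp g 2 (productLaw F d)) :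
    Tendsto (fun ν => (D ν).meanDraw g - (D ν).meanBlock Finset.univ g g) atTop (𝓝 0) := by
  have hG0 : 0 ≤ ∫ x, g x ^ 2 ∂(productLaw F d) := integral_nonneg fun x => sq_nonneg _
  have h1 := tendsto_meanBlock hL hn hg Finset.univ
  rw [crossMoment_univ g hg] at h1
  have hC : Tendsto (fun ν => 2 * (Fintype.card (Pos d) : ℝ) ^ 2 / ((D ν).L : ℝ)) atTop (𝓝 0) :=
    tendsto_const_nhds.div_atTop (tendsto_natCast_atTop_atTop.comp hL)
  have h2 := (((tendsto_const_nhds (x := (1 : ℝ))).add hC).mul_const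
    (∫ x, g x ^ 2 ∂(productLaw F d))).sub h1
  rw [add_zero, one_mul, sub_self] at h2
  refine tendsto_of_tendsto_of_tendsto_of_le_of_le' tendsto_const_nhds h2
    (Eventually.of_forall fun ν => sub_nonneg.mpr ((D ν).meanBlock_univ_le_meanDraw hg)) ?_
  filter_upwards [eventually_ratio_le hL hn] with ν h
  have h3 := (D ν).meanDraw_le hg
  have h4 := mul_le_mul_of_nonneg_right h.1 hG0
  linarith

theorem tendsto_scaled_mse_sub_mse (hgm : Measurable g) (hgs : SymmetricKernel g)
    (hg : MemLp g 2 (productLaw F d)) (hL : Tendsto (fun ν => (D ν).L) atTop atTop)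
    (hn : ∀ᶠ ν in atTop, ∀ k, (D ν).L ≤ (D ν).n k)
    (hlam : t < ∑ k, d k → (fun ν => ((D ν).lam : ℝ)) =o[atTop] fun ν => ((D ν).L : ℝ)) :
    Tendsto (fun ν => ((D ν).m : ℝ) * (mse (D ν).P ((D ν).Utilde g) (theta F g) -
      mse (D ν).P (fun ω => U0 g ((D ν).X ω)) (theta F g))) atTop (𝓝 (ICUDO.R F g t)) := by
  have hM : ∀ u, Tendsto (fun ν => moebiusSum (fun v => (D ν).meanBlock v g g) u) atTop
      (𝓝 (moebiusSum (fun v => crossMoment F v g g) u)) := by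
    intro u
    unfold moebiusSum
    exact tendsto_finsetSum _ fun v _ => (tendsto_meanBlock hL hn hg v).const_mul _
  have hτ : ∀ u : Finset (Pos d), t < u.card →
      Tendsto (fun ν => tau (D ν).A₀ u) atTop (𝓝 1) := by
    intro u hu
    -- A set of more than t positions exists only if t < d, which releases the growth condition on
    -- λ.
    have ht : t < ∑ k, d k := by
      rw [← card_pos_eq]
      exact hu.trans_le (Finset.card_le_univ u)
    have h0 := (hlam ht).tendsto_div_nhds_zero.const_mul ((2 : ℝ) ^ (u.card + u.card))
    rw [mul_zero] at h0
    rw [tendsto_iff_norm_sub_tendsto_zero]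
    refine squeeze_zero' (Eventually.of_forall fun ν => norm_nonneg _) ?_ h0
    filter_upwards [hL.eventually_ge_atTop 2] with ν hν
    exact abs_tau_sub_one_le (D ν).orthogonal (D ν).coincidenceFree (D ν).m_pos hν hu
  have hR : ICUDO.R F g t = 0 + ∑ u : Finset (Pos d) with t < u.card,
      1 * moebiusSum (fun v => crossMoment F v g g) u := by
    rw [ICUDO.R, zero_add]
    refine Finset.sum_congr rfl fun u hu => ?_
    have hu' := (Finset.mem_filter.mp hu).2
    rw [one_mul, deltaSq_eq hg]
    rintro rfl
    simp at hu'
  rw [hR]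
  refine Tendsto.congr' ?_ ((tendsto_meanDraw_sub_meanBlock hL hn hg).add
    (tendsto_finsetSum _ fun u hu => (hτ u (Finset.mem_filter.mp hu).2).mul (hM u)))
  filter_upwards [hL.eventually_ge_atTop 2] with ν hν
  exact ((D ν).mse_sub_mse hgm hgs hg hν).symm

end Limits

end DebiasedICUDO

theorem theorem5 {K : ℕ} (d : Fin K → ℕ) (F : Fin K → Measure ℝ)
    [∀ k, IsProbabilityMeasure (F k)] (g : (ICUDO.Pos d → ℝ) → ℝ)
    (g_measurable : Measurable g) (g_symm : ICUDO.SymmetricKernel g)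
    (g_sq : MemLp g 2 (ICUDO.productLaw F d)) (t : ℕ) :
    (∀ D : DebiasedICUDO.{u} d F t,
      MemLp (D.Utilde g) 2 D.P ∧ ∫ ω, D.Utilde g ω ∂D.P = ICUDO.theta F g) ∧
    (∀ D : ℕ → DebiasedICUDO.{u} d F t,
      Tendsto (fun ν => (D ν).L) atTop atTop →
      (∀ k, (fun ν => ((D ν).L : ℝ)) =o[atTop] fun ν => ((D ν).n k : ℝ)) →
      (t < ∑ k, d k → (fun ν => ((D ν).lam : ℝ)) =o[atTop] fun ν => ((D ν).L : ℝ)) →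
      (fun ν => ICUDO.mse (D ν).P ((D ν).Utilde g) (ICUDO.theta F g)
          - (ICUDO.mse (D ν).P (fun ω => ICUDO.U0 g ((D ν).X ω)) (ICUDO.theta F g)
            + ICUDO.R F g t / ((D ν).m : ℝ)))
        =o[atTop] fun ν => 1 / ((D ν).m : ℝ)) := by
  refine ⟨fun D => ⟨D.memLp_Utilde g_sq, D.integral_Utilde g_measurable g_sq⟩, ?_⟩
  intro D hL hLn hlam
  -- Samples of size at least L keep the proportion of tuples with repeated units at O(1/L).
  have hn : ∀ᶠ ν in atTop, ∀ k, (D ν).L ≤ (D ν).n k := by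
    rw [eventually_all]
    intro k
    filter_upwards [(hLn k).bound one_pos] with ν hν
    rw [one_mul, Real.norm_natCast, Real.norm_natCast] at hν
    exact_mod_cast hν
  have hm : ∀ ν, ((D ν).m : ℝ) ≠ 0 := fun ν => by exact_mod_cast (D ν).m_pos.ne'
  rw [isLittleO_iff_tendsto fun ν h => absurd h (one_div_ne_zero (hm ν))]
  have h := (DebiasedICUDO.tendsto_scaled_mse_sub_mse g_measurable g_symm g_sq hL hn hlam).sub_const
    (ICUDO.R F g t)
  rw [sub_self] at h
  refine h.congr fun ν => ?_
  have := hm ν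
  field_simp
  ring
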